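/- **Setting.** Let $\Omega_{os}$ be the set of pairs $(\xi,Q)$, where $\xi=(\xi_i)_{i\in\mathbb N}$ satisfies $\xi_1\ge\xi_2\ge\dots\ge 0$, $\sum_i\xi_i\le 1$, and $Q=\{q_{ij}\}$ is a real symmetric positive semidefinite matrix indexed by $\mathbb N=\{1,2,\dots\}$ with $q_{ii}=1$. A ROSt is a random element $(\xi,Q)$ of $\Omega_{os}$; we assume that almost surely $\xi_i>0$ for all $i$ and $|q_{ij}|<1$ for all $i\ne j$. Let $\psi:\mathbb R\to\mathbb R$ be $C^2$ with bounded first and second derivatives and such that the law of $\psi(Y)$, $Y$ standard Gaussian, is absolutely continuous with respect to Lebesgue measure. Fix $r\in\mathbb N$, and let $\nu_{Q^{*r}}$ be the law of the centered Gaussian field $(\kappa_i)_{i\in\mathbb N}$ with covariance $Q^{*r}=\{q_{ij}^r\}$. For a function $\varphi$, the evolution $\Phi_{\varphi(\kappa)}$ sends $(\xi,Q)$ to $\big((w_{\pi(i)})_i,\{q_{\pi(i)\pi(j)}\}_{i,j}\big)$, where $w_i=\xi_ie^{\varphi(\kappa_i)}/\sum_j\xi_je^{\varphi(\kappa_j)}$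 and $\pi$ is the permutation of $\mathbb N$ that puts the $w_i$ in decreasing order (ties keep their original order). The ROSt is *quasi-stationary under $\Phi_r$ with function $\varphi$* if $\Phi_{\varphi(\kappa)}(\xi,Q)$ has the same law as $(\xi,Q)$ when, given $(\xi,Q)$, $\kappa$ has law $\nu_{Q^{*r}}$; it is *ergodic* if every bounded measurable $f:\Omega_{os}\to\mathbb R$ with $\mathbb E[f(\Phi_{\varphi(\kappa)}(\xi,Q))\mid\xi,Q]=f(\xi,Q)$ a.s. is a.s. constant. On $\Omega=\Omega_{os}\times(\mathbb R^{\mathbb N})^{\mathbb Z}$ let $$\Lambda(\xi,Q,(\kappa(t))_{t\in\mathbb Z})=\big(\Phi_{\varphi(\kappa(0))}(\xi,Q),\ (\kappa_{\pi(i)}(t+1))_{i\in\mathbb N,\,t\in\mathbb Z}\big),$$ with $\pi$ the permutation induced by $\Phi_{\varphi(\kappa(0))}$. For a quasi-stationary ROSt, $\mathbb P_r$ denotes the $\Lambda$-invariant probability measure on $\Omega$ under which $(\xi,Q)$ has the given law and, given $(\xi,Q)$, the fields $\kappa(t)$, $t\ge0$, are i.i.d. with law $\nu_{Q^{*r}}$.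 The past velocity of particle $i$ is $v_i(\omega)=\lim_{T\to\infty}\frac1T\sum_{t=1}^T\psi(\kappa_i(-t))$. **Proposition.** Let $U\subseteq\mathbb R$ be open and suppose that $(\xi,Q)$ is quasi-stationary under $\Phi_r$ with function $\lambda\psi$ for every $\lambda\in U$. Let $\lambda\in U$ and let $\mathbb P_r$ be the measure above for $\varphi=\lambda\psi$. Then $\mathbb P_r$-almost surely the limits $v_i(\omega)$ exist for all $i\in\mathbb N$ and share a common value $v(\omega)$. If moreover $(\xi,Q)$ is ergodic under $\Phi_r$ with function $\lambda\psi$, then $\sum_i\xi_i\psi(\kappa_i(-1))$ converges absolutely $\mathbb P_r$-a.s. and is $\mathbb P_r$-integrable, and $$v(\omega)=\mathbb E_r\Big[\sum_i\xi_i\,\psi(\kappa_i(-1))\Big]\qquad \mathbb P_r\text{-a.s.}$$ -/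

import Mathlib

open MeasureTheory ProbabilityTheory Filter Topology

noncomputable section

namespace CompetingParticles

/-! ### Overlap structures -/

/-- The ambient space of pairs `(ξ, Q)` (weights, overlap matrix), with its product Borel
`σ`-algebra.  Particles are indexed from `0`. -/
abbrev Config : Type := (ℕ → ℝ) × (ℕ → ℕ → ℝ)

/-- The set `Ω_os` of overlap structures: nonincreasing nonnegative sequences of sum at most one,
together with a positive semidefinite symmetric matrix with ones on the diagonal. -/
def overlapSpace : Set Config :=
  {p | Antitone p.1 ∧ (∀ i, 0 ≤ p.1 i) ∧ Summable p.1 ∧ ∑' i, p.1 i ≤ 1 ∧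
    (Matrix.of p.2).PosSemidef ∧ ∀ i, p.2 i i = 1}

/-- `μ` is the law of a random overlap structure. -/
structure IsROSt (μ : Measure Config) : Prop where
  isProbabilityMeasure : IsProbabilityMeasure μ
  ae_mem : ∀ᵐ p ∂μ, p ∈ overlapSpace

/-! ### Gaussian fields -/

/-- `ν` is the law of a centered Gaussian field `(κ_i)` indexed by `ℕ` with covariance matrix
`C`. -/
structure IsCenteredGaussianField (C : ℕ → ℕ → ℝ) (ν : Measure (ℕ → ℝ)) : Prop where
  gaussian : IsGaussianProcess (fun (i : ℕ) (κ : ℕ → ℝ) => κ i) ν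
  integral_eq_zero : ∀ i, ∫ κ, κ i ∂ν = 0
  covariance_eq : ∀ i j, cov[fun κ : ℕ → ℝ => κ i, fun κ : ℕ → ℝ => κ j; ν] = C i j

/-- The vectors of a sequence in an inner product space are finite combinations of an orthogonal
sequence, so that their Gram matrix is `L Lᵀ` with `L` lower triangular. -/
lemma exists_triangular_gram {E : Type*} [NormedAddCommGroup E] [InnerProductSpace ℝ E]
    (f : ℕ → E) : ∃ L : ℕ → ℕ → ℝ, (∀ n k, n < k → L n k = 0) ∧
      ∀ i j N, i < N → j < N → inner ℝ (f i) (f j) = ∑ k ∈ Finset.range N, L i k * L j k := by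
  classical
  set g := InnerProductSpace.gramSchmidt ℝ f with hg
  let c : ℕ → ℕ → ℝ := fun n k =>
    if k < n then inner ℝ (g k) (f n) / ‖g k‖ ^ 2 else if k = n then 1 else 0
  have hf : ∀ n N, n < N → f n = ∑ k ∈ Finset.range N, c n k • g k := by
    intro n N hn
    have h1 : ∑ k ∈ Finset.range N, c n k • g k = ∑ k ∈ Finset.range (n + 1), c n k • g k := by
      symm
      refine Finset.sum_subset (fun k hk => ?_) (fun k _ hk => ?_)
      · simp only [Finset.mem_range] at hk ⊢; omega
      · simp only [Finset.mem_range] at hk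
        have h2 : ¬ k < n := by omega
        have h3 : ¬ k = n := by omega
        simp [c, h2, h3]
    rw [h1, Finset.sum_range_succ]
    have h4 : c n n = 1 := by simp [c]
    have h5 : ∑ k ∈ Finset.range n, c n k • g k
        = ∑ k ∈ Finset.Iio n, (inner ℝ (g k) (f n) / ‖g k‖ ^ 2) • g k := by
      rw [← Nat.Iio_eq_range]
      refine Finset.sum_congr rfl (fun k hk => ?_)
      simp [c, Finset.mem_Iio.1 hk]
    rw [h4, h5, one_smul, add_comm]
    have := InnerProductSpace.gramSchmidt_def'' ℝ f n
    simpa [hg] using this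
  refine ⟨fun n k => c n k * ‖g k‖, fun n k hnk => ?_, fun i j N hi hj => ?_⟩
  · have h2 : ¬ k < n := by omega
    have h3 : ¬ k = n := by omega
    simp [c, h2, h3]
  · rw [hf i N hi, hf j N hj, sum_inner]
    refine Finset.sum_congr rfl (fun k hk => ?_)
    rw [inner_sum, Finset.sum_eq_single_of_mem k hk]
    · rw [inner_smul_left, inner_smul_right, real_inner_self_eq_norm_sq]
      simp only [conj_trivial]
      ring
    · intro l _ hl
      rw [inner_smul_left, inner_smul_right, hg,
        InnerProductSpace.gramSchmidt_orthogonal ℝ f (Ne.symm hl)]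
      simp

/-- A positive semidefinite matrix indexed by `ℕ` is `L Lᵀ` with `L` lower triangular. -/
lemma exists_cholesky {C : ℕ → ℕ → ℝ} (hC : (Matrix.of C).PosSemidef) :
    ∃ L : ℕ → ℕ → ℝ, (∀ n k, n < k → L n k = 0) ∧
      ∀ i j N, i < N → j < N → C i j = ∑ k ∈ Finset.range N, L i k * L j k := by
  classical
  let K : Matrix ℕ ℕ (ℝ →L[ℝ] ℝ) := fun i j => C i j • ContinuousLinearMap.id ℝ ℝ
  have hsymm : ∀ i j, C j i = C i j := fun i j => by simpa using hC.1.apply i j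
  have hK : K.PosSemidef := by
    have hiff := (RKHS.posSemidef_tfae (K := K)).out 2 0
    refine hiff.1 ⟨?_, fun v => ?_⟩
    · refine Matrix.IsHermitian.ext fun i j => ?_
      simp only [K, hsymm i j]
      rw [star_smul, ContinuousLinearMap.star_eq_adjoint, ContinuousLinearMap.adjoint_id]
      simp
    · have h := hC.2 v
      simp only [star_trivial, Matrix.of_apply] at h
      simp only [RCLike.re_to_real]
      refine h.trans_eq (Finsupp.sum_congr fun x _ => Finsupp.sum_congr fun y _ => ?_)
      simp [K, hsymm x y]
      ring
  have : Fact K.PosSemidef := ⟨hK⟩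
  obtain ⟨L, h1, h2⟩ := exists_triangular_gram
    (fun n : ℕ => RKHS.kerFun (RKHS.OfKernel K) n (1 : ℝ))
  refine ⟨L, h1, fun i j N hi hj => ?_⟩
  rw [← h2 i j N hi hj, ← RKHS.kernel_inner, RKHS.OfKernel.kernel_ofKernel]
  simp [K, hsymm]

/-- Every positive semidefinite matrix is the covariance of a centered Gaussian field. -/
theorem exists_isCenteredGaussianField {C : ℕ → ℕ → ℝ} (hC : (Matrix.of C).PosSemidef) :
    ∃ ν, IsCenteredGaussianField C ν := by
  classical
  obtain ⟨L, hL0, hL⟩ := exists_cholesky hC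
  obtain ⟨Ω, _, P, g, hgm, hgl, hgi, hP⟩ := exists_iid ℕ (gaussianReal 0 1)
  have hgG : ∀ i, HasGaussianLaw (g i) P := fun i => (hgl i).hasGaussianLaw
  have hg : IsGaussianProcess g P := ⟨fun I => by
    have := iIndepFun.hasGaussianLaw (X := fun i : I => g i) (P := P) (fun i => hgG i)
      (hgi.precomp Subtype.val_injective)
    exact this⟩
  let X : ℕ → Ω → ℝ := fun n ω => ∑ k ∈ Finset.range (n + 1), L n k * g k ω
  have hXm : ∀ n, Measurable (X n) := fun n => by fun_prop
  have hX : IsGaussianProcess X P := by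
    refine hg.of_isGaussianProcess (fun n => ⟨Finset.range (n + 1),
      ∑ k : Finset.range (n + 1), L n k • ContinuousLinearMap.proj k, fun ω => ?_⟩)
    simp only [X, sum_apply]
    rw [← Finset.sum_coe_sort]
    simp
  have hXN : ∀ n N, n < N → X n = fun ω => ∑ k ∈ Finset.range N, L n k * g k ω := by
    intro n N hn
    funext ω
    refine Finset.sum_subset (fun k hk => ?_) (fun k _ hk => ?_)
    · simp only [Finset.mem_range] at hk ⊢; omega
    · simp only [Finset.mem_range] at hk
      rw [hL0 n k (by omega), zero_mul]
  have hvar : ∀ k l, cov[g k, g l; P] = if k = l then 1 else 0 := by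
    intro k l
    split_ifs with h
    · subst h
      rw [covariance_self (hgm k).aemeasurable, (hgl k).variance_eq]
      simp
    · exact (hgi.indepFun h).covariance_eq_zero (hgG k).memLp_two (hgG l).memLp_two
  have hmean : ∀ k, ∫ ω, g k ω ∂P = 0 := fun k => by
    rw [(hgl k).integral_eq]; simp
  have hTm : Measurable (fun ω n => X n ω) := measurable_pi_lambda _ hXm
  refine ⟨P.map (fun ω n => X n ω), ⟨fun I => ⟨?_⟩⟩, fun i => ?_, fun i j => ?_⟩
  · rw [Measure.map_map (by fun_prop) hTm]
    exact (hX.hasGaussianLaw I).isGaussian_map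
  · rw [integral_map hTm.aemeasurable (measurable_pi_apply i).aestronglyMeasurable]
    simp only [X]
    rw [integral_finsetSum _ (fun k _ => ((hgG k).integrable).const_mul _)]
    simp [integral_const_mul, hmean]
  · rw [covariance_map_fun (measurable_pi_apply i).aestronglyMeasurable
      (measurable_pi_apply j).aestronglyMeasurable hTm.aemeasurable]
    have hi := hXN i (max i j + 1) (by omega)
    have hj := hXN j (max i j + 1) (by omega)
    change cov[X i, X j; P] = _
    rw [hi, hj, covariance_fun_sum_fun_sum' (fun k _ => (hgG k).memLp_two.const_mul _)
      (fun k _ => (hgG k).memLp_two.const_mul _), hL i j (max i j + 1) (by omega) (by omega)]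
    refine Finset.sum_congr rfl (fun k hk => ?_)
    rw [Finset.sum_eq_single_of_mem k hk]
    · simp [covariance_const_mul_left, covariance_const_mul_right, hvar, mul_comm]
    · intro l _ hl
      simp [covariance_const_mul_left, covariance_const_mul_right, hvar, hl.symm]

/-- The entrywise power `C^{*r}` of a matrix. -/
def entrywisePow (C : ℕ → ℕ → ℝ) (r : ℕ) : ℕ → ℕ → ℝ := fun i j => C i j ^ r

/-- Entrywise powers of a positive semidefinite matrix are positive semidefinite. -/
lemma posSemidef_entrywisePow {C : ℕ → ℕ → ℝ} (hC : (Matrix.of C).PosSemidef) (r : ℕ) :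
    (Matrix.of (entrywisePow C r)).PosSemidef := by
  classical
  have hsymm : ∀ i j, C j i = C i j := fun i j => by simpa using hC.1.apply i j
  have hH : ∀ s, (Matrix.of (entrywisePow C s)).IsHermitian := fun s => by
    ext i j
    simp [entrywisePow, hsymm i j]
  induction r with
  | zero =>
    refine ⟨hH 0, fun x => ?_⟩
    have : (x.sum fun i xi => x.sum fun j xj =>
        star xi * Matrix.of (entrywisePow C 0) i j * xj) = (∑ i ∈ x.support, x i) ^ 2 := by
      simp only [Finsupp.sum, sq, Finset.sum_mul_sum]
      simp [entrywisePow]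
    rw [this]
    positivity
  | succ r ih =>
    obtain ⟨L, -, hL⟩ := exists_cholesky ih
    refine ⟨hH (r + 1), fun x => ?_⟩
    set N := x.support.sup id + 1 with hN
    have hlt : ∀ i ∈ x.support, i < N := fun i hi =>
      Nat.lt_succ_of_le (Finset.le_sup (f := id) hi)
    have key : (x.sum fun i xi => x.sum fun j xj =>
        star xi * Matrix.of (entrywisePow C (r + 1)) i j * xj)
        = ∑ k ∈ Finset.range N, ∑ i ∈ x.support, ∑ j ∈ x.support,
            (x i * L i k) * C i j * (x j * L j k) := by
      simp only [Finsupp.sum]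
      conv_rhs => rw [Finset.sum_comm]
      refine Finset.sum_congr rfl fun i hi => ?_
      conv_rhs => rw [Finset.sum_comm]
      refine Finset.sum_congr rfl fun j hj => ?_
      have := hL i j N (hlt i hi) (hlt j hj)
      simp only [entrywisePow] at this
      simp only [Matrix.of_apply, entrywisePow, star_trivial, pow_succ, this, Finset.sum_mul,
        Finset.mul_sum]
      exact Finset.sum_congr rfl fun k _ => by ring
    rw [key]
    refine Finset.sum_nonneg fun k _ => ?_
    have h := hC.2 (Finsupp.onFinset x.support (fun i => x i * L i k) (fun i hi => by
      simp only [Finsupp.mem_support_iff]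
      exact left_ne_zero_of_mul hi))
    have hs : ∀ F : ℕ → ℝ → ℝ, (∀ i, F i 0 = 0) →
        (Finsupp.onFinset x.support (fun i => x i * L i k) (fun i hi => by
          simp only [Finsupp.mem_support_iff]
          exact left_ne_zero_of_mul hi)).sum F = ∑ i ∈ x.support, F i (x i * L i k) :=
      fun F hF => Finsupp.onFinset_sum _ hF
    rw [hs _ (by simp [Finsupp.sum])] at h
    refine h.trans_eq (Finset.sum_congr rfl fun i _ => ?_)
    rw [hs _ (by simp)]
    simp

open Classical in
/-- The law `ν_C` of the centered Gaussian field with covariance matrix `C` (a Dirac mass when `C`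
is not a covariance matrix). -/
def gaussianField (C : ℕ → ℕ → ℝ) : Measure (ℕ → ℝ) :=
  if h : ∃ ν, IsCenteredGaussianField C ν then h.choose else Measure.dirac 0

lemma isCenteredGaussianField_gaussianField {C : ℕ → ℕ → ℝ} (hC : (Matrix.of C).PosSemidef) :
    IsCenteredGaussianField C (gaussianField C) := by
  have h := exists_isCenteredGaussianField hC
  rw [gaussianField, dif_pos h]
  exact h.choose_spec

instance (C : ℕ → ℕ → ℝ) : IsProbabilityMeasure (gaussianField C) := by
  unfold gaussianField
  split_ifs with h
  · exact h.choose_spec.gaussian.isProbabilityMeasure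
  · infer_instance

/-! ### The competitive evolution -/

/-- The permutation `π` lists the weights `w` in decreasing order, ties being broken by the
original order: `w (π 0) ≥ w (π 1) ≥ ⋯`. -/
def IsDecreasingOrder (w : ℕ → ℝ) (π : Equiv.Perm ℕ) : Prop :=
  ∀ i j, i < j → w (π j) < w (π i) ∨ (w (π j) = w (π i) ∧ π i < π j)

open Classical in
/-- The reordering permutation of `w`.  It exists, and is unique, for every summable sequence of
positive weights; it is the identity where no reordering exists. -/
def sortPerm (w : ℕ → ℝ) : Equiv.Perm ℕ :=
  if h : ∃ π, IsDecreasingOrder w π then h.choose else 1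

/-- The weights `ξ_i e^{x_i} / ∑_j ξ_j e^{x_j}` before reordering. -/
def tilt (x : ℕ → ℝ) (ξ : ℕ → ℝ) : ℕ → ℝ :=
  fun i => ξ i * Real.exp (x i) / ∑' j, ξ j * Real.exp (x j)

/-- The permutation `π` induced by the evolution of `(ξ, Q)` with increments `x`: the particle of
rank `i` after the evolution had rank `π i` before it. -/
def reshuffle (x : ℕ → ℝ) (p : Config) : Equiv.Perm ℕ := sortPerm (tilt x p.1)

/-- The evolution of `(ξ, Q)` with increments `x`. -/
def evolve (x : ℕ → ℝ) (p : Config) : Config :=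
  (fun i => tilt x p.1 (reshuffle x p i), fun i j => p.2 (reshuffle x p i) (reshuffle x p j))

/-- The law of `Φ_r(ξ, Q) = Φ_{φ(κ)}(ξ, Q)` when `(ξ, Q)` has law `μ` and, given `(ξ, Q)`, `κ` is a
centered Gaussian field with covariance `Q^{*r}`. -/
def evolvedLaw (r : ℕ) (φ : ℝ → ℝ) (μ : Measure Config) : Measure Config :=
  μ.bind fun p => (gaussianField (entrywisePow p.2 r)).map fun κ => evolve (fun i => φ (κ i)) p

/-- Quasi-stationarity of the law `μ` under `Φ_r` with the function `φ`. -/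
def IsQuasiStationary (r : ℕ) (φ : ℝ → ℝ) (μ : Measure Config) : Prop :=
  evolvedLaw r φ μ = μ

/-- Ergodicity of the law `μ` under `Φ_r` with the function `φ`: the only bounded measurable
functions `f` with `𝔼_r[f(Φ_r(ξ, Q)) | ξ, Q] = f(ξ, Q)` a.s. are the a.s. constants. -/
def IsErgodic (r : ℕ) (φ : ℝ → ℝ) (μ : Measure Config) : Prop :=
  ∀ f : Config → ℝ, Measurable f → (∃ M, ∀ p, |f p| ≤ M) →
    (∀ᵐ p ∂μ, ∫ κ, f (evolve (fun i => φ (κ i)) p) ∂gaussianField (entrywisePow p.2 r) = f p) →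
    ∃ c, ∀ᵐ p ∂μ, f p = c

/-- The functions `ψ` under consideration: `C²` with bounded first and second derivatives, and such
that the law of `ψ(Y)` is absolutely continuous for `Y` a standard Gaussian variable. -/
structure IsAdmissible (ψ : ℝ → ℝ) : Prop where
  contDiff : ContDiff ℝ 2 ψ
  bounded_deriv : ∃ M, ∀ x, |deriv ψ x| ≤ M
  bounded_deriv2 : ∃ M, ∀ x, |iteratedDeriv 2 ψ x| ≤ M
  absolutelyContinuous : (gaussianReal 0 1).map ψ ≪ volume

/-! ### Past and future increments -/

/-- The space `Ω` of points `ω = ((ξ, Q), (κ(t))_{t ∈ ℤ})`; the increment `κ_i(t)` is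
`ω.2 t i`. -/
abbrev History : Type := Config × (ℤ → ℕ → ℝ)

/-- The map `Λ`: evolve `(ξ, Q)` with the increments `φ(κ(0))`, shift time by one, and reindex all
the fields by the new order of the particles. -/
def timeStep (φ : ℝ → ℝ) (ω : History) : History :=
  (evolve (fun i => φ (ω.2 0 i)) ω.1,
    fun t i => ω.2 (t + 1) (reshuffle (fun i => φ (ω.2 0 i)) ω.1 i))

/-- The law of `((ξ, Q), (κ(t))_{t ≥ 0})` where `(ξ, Q)` has law `μ` and, given `(ξ, Q)`, the
`κ(t)` are independent centered Gaussian fields with covariance `Q^{*r}`. -/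
def forwardLaw (r : ℕ) (μ : Measure Config) : Measure (Config × (ℕ → ℕ → ℝ)) :=
  μ.bind fun p =>
    (Measure.dirac p).prod (Measure.infinitePi fun _ : ℕ => gaussianField (entrywisePow p.2 r))

/-- `P` is the law `ℙ_r` on `Ω`: it is invariant under `Λ`, and it extends the law of
`((ξ, Q), (κ(t))_{t ≥ 0})` to the past increments. -/
structure IsStationaryExtension (r : ℕ) (φ : ℝ → ℝ) (μ : Measure Config) (P : Measure History) :
    Prop where
  isProbabilityMeasure : IsProbabilityMeasure P
  map_forward : P.map (fun ω => (ω.1, fun t : ℕ => ω.2 (t : ℤ))) = forwardLaw r μ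
  invariant : MeasurePreserving (timeStep φ) P P

/-- The past velocity `v_i(ω) = lim_{T → ∞} T⁻¹ ∑_{t=1}^T ψ(κ_i(-t))` exists and equals `v`. -/
def HasPastVelocity (ψ : ℝ → ℝ) (ω : History) (i : ℕ) (v : ℝ) : Prop :=
  Tendsto (fun T : ℕ => (T : ℝ)⁻¹ * ∑ t ∈ Finset.Icc 1 T, ψ (ω.2 (-(t : ℤ)) i)) atTop (𝓝 v)

/-- The weighted mean `∑_i ξ_i ψ(κ_i(-1))` of the last increments. -/
def meanLastIncrement (ψ : ℝ → ℝ) (ω : History) : ℝ := ∑' i, ω.1.1 i * ψ (ω.2 (-1) i)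

end CompetingParticles

end

open scoped ENNReal

noncomputable section

namespace CompetingParticles

/-! ### Gaussian fields and product measures -/

/-! Choose a particle at random with probability equal to its weight; this is the law `tagged P`. By
invariance, a sum over particles at time zero may be read after `T` steps. There the weights are
`ξ_j e^{λ(ψ(κ_j(0)) + ⋯ + ψ(κ_j(T-1)))}` divided by their sum, which is symmetric in the times,
while the `κ(t)` are conditionally i.i.d. given `(ξ, Q)`. Hence the past increments of the tagged
particle have the same pair laws after any transposition of times (`IsRegular.map_past_swap`), so
that `∫ ψ(past n) ψ(past m)` depends only on whether `n = m`. A Hilbert space argument then gives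
convergence of the averages, in mean square at rate `1/n` and almost surely
(`exists_ae_tendsto_average`). All weights being positive, every particle has a velocity.

The velocities agree because of quasi-stationarity in a neighbourhood of `λ`. Let `S_i` be the
displacement over the last `T` steps and `Y_T = log ∑ ξ_i e^{ε S_i} + log ∑ ξ_i e^{-ε S_i}`. Seen
forward, `Y_T` is a second difference in `λ` of logarithms of partition functions. These are
additive along the evolution, so `𝔼 Y_T = T 𝔼 Y_1`, and `𝔼 Y_1` is of order `ε²`. But `Y_T ≥ log ξ_i
+ log ξ_j + ε (S_i - S_j)`. Dividing by `T` and applying Fatou yields `ε 𝔼 (v_i - v_j)⁺ = O(ε²)`,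
and `ε → 0` gives `v_i ≤ v_j` (`IsRegular.ae_velocity_le`).

For the value under ergodicity, the common velocity `V` is invariant under `Λ`. Thus it is close in
mean both to the weighted mean of the past averages and, after `n` steps, to a function of `(ξ, Q)`
and of `κ(0), …, κ(n-1)` that is symmetric in the times. A conditional Hewitt–Savage argument
(`exists_measurable_eq_of_symmetric_limit`) shows that `V` is a function of `(ξ, Q)`, and ergodicity
makes it constant. The constant is the mean of `V`, which equals that of one past increment of the
tagged particle since these are identically distributed. -/

/-- The law of a centered Gaussian field is determined by its covariance matrix. -/
lemma IsCenteredGaussianField.unique {C : ℕ → ℕ → ℝ} {ν₁ ν₂ : Measure (ℕ → ℝ)}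
    (h₁ : IsCenteredGaussianField C ν₁) (h₂ : IsCenteredGaussianField C ν₂) : ν₁ = ν₂ := by
  have key : ∀ I : Finset ℕ, ν₁.map I.restrict = ν₂.map I.restrict := by
    intro I
    -- A Gaussian law on a Euclidean space is determined by its mean and its covariance form, hence
    -- the passage to the `ℓ²` norm.
    apply (MeasurableEquiv.toLp 2 (_ → ℝ)).map_measurableEquiv_injective
    rw [MeasurableEquiv.coe_toLp, ← PiLp.coe_symm_continuousLinearEquiv 2 ℝ]
    have hg : ∀ {ν}, IsCenteredGaussianField C ν → IsGaussian (ν.map I.restrict) := fun h =>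
      (h.gaussian.hasGaussianLaw I).isGaussian_map
    have hg₁ := hg h₁
    have hg₂ := hg h₂
    have hmean : ∀ {ν}, IsCenteredGaussianField C ν →
        ∫ x, id x ∂((ν.map I.restrict).map ⇑(PiLp.continuousLinearEquiv 2 ℝ fun _ : I => ℝ).symm)
          = 0 := by
      intro ν h
      have := hg h
      rw [integral_map, integral_map]
      · simp only [id_eq]
        rw [ContinuousLinearEquiv.integral_comp_comm]
        simp only [PiLp.continuousLinearEquiv_symm_apply, WithLp.toLp_eq_zero]
        ext i
        rw [eval_integral]
        · simpa using h.integral_eq_zero i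
        · exact fun i => (h.gaussian.hasGaussianLaw_eval i).integrable
      all_goals fun_prop
    apply IsGaussian.ext
    · rw [hmean h₁, hmean h₂]
    · rw [← ContinuousLinearMap.toBilinForm_inj]
      refine LinearMap.BilinForm.ext_of_isSymm isPosSemidef_covarianceBilin.isSymm
        isPosSemidef_covarianceBilin.isSymm fun x => ?_
      simp only [ContinuousLinearMap.toBilinForm_apply]
      rw [PiLp.coe_symm_continuousLinearEquiv, covarianceBilin_apply_pi, covarianceBilin_apply_pi]
      · have hc : ∀ {ν}, IsCenteredGaussianField C ν → ∀ i j : I,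
            cov[fun x : I → ℝ => x i, fun x => x j; ν.map I.restrict] = C i j := by
          intro ν h i j
          rw [covariance_map_fun]
          · simpa using h.covariance_eq i j
          all_goals first | exact Measurable.aestronglyMeasurable (by fun_prop)
                          | exact Measurable.aemeasurable (by fun_prop)
        simp only [hc h₁, hc h₂]
      · exact fun i => (IsGaussian.hasGaussianLaw_id.eval i).memLp_two
      · exact fun i => (IsGaussian.hasGaussianLaw_id.eval i).memLp_two
  have := h₁.gaussian.isProbabilityMeasure
  have := h₂.gaussian.isProbabilityMeasure
  have hl : IsProjectiveLimit ν₁ (fun I => ν₂.map I.restrict) := fun I => key I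
  exact hl.unique (fun I => rfl)

/-- Relabelling a centered Gaussian field relabels its covariance matrix. -/
lemma map_comp_gaussianField {C : ℕ → ℕ → ℝ} (hC : (Matrix.of C).PosSemidef)
    (π : Equiv.Perm ℕ) :
    (gaussianField C).map (fun κ i => κ (π i)) = gaussianField (fun i j => C (π i) (π j)) := by
  have h := isCenteredGaussianField_gaussianField hC
  have hC' : (Matrix.of fun i j => C (π i) (π j)).PosSemidef := hC.submatrix π
  have hm : Measurable fun (κ : ℕ → ℝ) i => κ (π i) := by fun_prop
  refine IsCenteredGaussianField.unique (C := fun i j => C (π i) (π j)) ⟨⟨fun I => ⟨?_⟩⟩, ?_, ?_⟩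
    (isCenteredGaussianField_gaussianField hC')
  · rw [Measure.map_map (by fun_prop) hm]
    exact ((h.gaussian.comp_right π).hasGaussianLaw I).isGaussian_map
  · intro i
    rw [integral_map hm.aemeasurable (measurable_pi_apply i).aestronglyMeasurable]
    exact h.integral_eq_zero _
  · intro i j
    rw [covariance_map_fun (measurable_pi_apply i).aestronglyMeasurable
      (measurable_pi_apply j).aestronglyMeasurable hm.aemeasurable]
    exact h.covariance_eq _ _

lemma map_eval_gaussianField {C : ℕ → ℕ → ℝ} (hC : (Matrix.of C).PosSemidef) {i : ℕ}
    (hi : C i i = 1) : (gaussianField C).map (fun κ => κ i) = gaussianReal 0 1 := by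
  have h := isCenteredGaussianField_gaussianField hC
  have h1 := (h.gaussian.hasGaussianLaw_eval i).map_eq_gaussianReal
  rw [h1, h.integral_eq_zero, ← covariance_self (measurable_pi_apply i).aemeasurable, h.covariance_eq, hi]
  simp

/-- Under a product measure, disjoint subfamilies of the coordinates are independent. -/
lemma map_infinitePi_disjoint {X ι α β : Type*} [MeasurableSpace X]
    (γ : Measure X) [IsProbabilityMeasure γ] {f : α → ι} {g : β → ι}
    (hf : Function.Injective f) (hg : Function.Injective g) (hfg : ∀ a b, f a ≠ g b) :
    (Measure.infinitePi fun _ : ι => γ).map (fun κ => (fun a => κ (f a), fun b => κ (g b)))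
      = (Measure.infinitePi fun _ : α => γ).prod (Measure.infinitePi fun _ : β => γ) := by
  classical
  have h1 := Measure.map_infinitePi_infinitePi_of_inj (P := fun _ : ι => γ)
    (f := Sum.elim f g) (hf.sumElim hg hfg)
  let G : (α → X) × (β → X) → (α ⊕ β → X) := fun x => Sum.elim x.1 x.2
  have hG : Measurable G := by
    refine measurable_pi_lambda _ fun c => ?_
    rcases c with a | b <;> simp only [G, Sum.elim_inl, Sum.elim_inr] <;> fun_prop
  have h2 : ((Measure.infinitePi fun _ : α => γ).prod (Measure.infinitePi fun _ : β => γ)).map G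
      = Measure.infinitePi fun _ : α ⊕ β => γ := by
    refine Measure.eq_infinitePi _ fun s t ht => ?_
    have hpre : G ⁻¹' (Set.pi s t) = (Set.pi s.toLeft fun a => t (Sum.inl a)) ×ˢ
        (Set.pi s.toRight fun b => t (Sum.inr b)) := by
      ext x
      simp [G, Set.mem_pi]
    rw [Measure.map_apply hG (.pi s.countable_toSet fun _ _ => ht _), hpre, Measure.prod_prod,
      Measure.infinitePi_pi _ (fun i _ => ht _), Measure.infinitePi_pi _ (fun i _ => ht _)]
    conv_rhs => rw [← Finset.toLeft_disjSum_toRight (u := s)]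
    rw [Finset.prod_disjSum]
  let R : (α ⊕ β → X) → (α → X) × (β → X) := fun x => (fun a => x (Sum.inl a), fun b => x (Sum.inr b))
  have hR : Measurable R := by fun_prop
  have h3 : R ∘ G = id := by ext x <;> rfl
  have h4 := congrArg (Measure.map R) (h1.trans h2.symm)
  rw [Measure.map_map hR hG, h3, Measure.map_id, Measure.map_map hR (by fun_prop)] at h4
  exact h4

lemma map_infinitePi_zero_succ {X : Type*} [MeasurableSpace X] (γ : Measure X)
    [IsProbabilityMeasure γ] :
    (Measure.infinitePi fun _ : ℕ => γ).map (fun κ => (κ 0, fun t => κ (t + 1)))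
      = γ.prod (Measure.infinitePi fun _ : ℕ => γ) := by
  have h := map_infinitePi_disjoint γ (f := fun _ : Unit => 0) (g := fun t : ℕ => t + 1)
    (fun _ _ _ => rfl) (fun a b h => by simpa using h) (fun _ b h => by simp at h)
  have h2 := congrArg (Measure.map (Prod.map (fun x : Unit → X => x ()) (id : (ℕ → X) → ℕ → X))) h
  rw [Measure.map_map (by fun_prop) (by fun_prop),
    ← Measure.map_prod_map _ _ (by fun_prop) (by fun_prop), Measure.map_id,
    Measure.infinitePi_map_eval] at h2
  exact h2

lemma map_infinitePi_even_odd {X : Type*} [MeasurableSpace X] (γ : Measure X)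
    [IsProbabilityMeasure γ] :
    (Measure.infinitePi fun _ : ℕ => γ).map (fun κ => (fun t => κ (2 * t), fun t => κ (2 * t + 1)))
      = (Measure.infinitePi fun _ : ℕ => γ).prod (Measure.infinitePi fun _ : ℕ => γ) :=
  map_infinitePi_disjoint γ (f := fun t : ℕ => 2 * t) (g := fun t : ℕ => 2 * t + 1)
    (fun a b h => by simpa using h) (fun a b h => by simpa using h) (fun a b h => by omega)

/-! ### Measurability of the evolution -/

/-- The particle `j` has exactly `i` particles before it in the order of decreasing weights. -/
def HasRank (w : ℕ → ℝ) (j i : ℕ) : Prop :=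
  ∃ S : Finset ℕ, S.card = i ∧ ∀ k, (w j < w k ∨ (w j = w k ∧ k < j)) ↔ k ∈ S

lemma HasRank.unique {w : ℕ → ℝ} {j i i' : ℕ} (h : HasRank w j i) (h' : HasRank w j i') :
    i = i' := by
  obtain ⟨S, rfl, hS⟩ := h
  obtain ⟨S', rfl, hS'⟩ := h'
  congr 1
  ext k
  rw [← hS, hS']

/-- If `a` precedes `b`, then `a` and all its predecessors precede `b`, so the rank of `b` is
strictly larger. As any two distinct particles are comparable, equal ranks force equality. -/
lemma HasRank.injective {w : ℕ → ℝ} {j j' i : ℕ} (h : HasRank w j i) (h' : HasRank w j' i) :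
    j = j' := by
  obtain ⟨S, hc, hS⟩ := h
  obtain ⟨S', hc', hS'⟩ := h'
  have key : ∀ {a b : ℕ} {A B : Finset ℕ}, A.card = B.card →
      (∀ k, (w a < w k ∨ (w a = w k ∧ k < a)) ↔ k ∈ A) →
      (∀ k, (w b < w k ∨ (w b = w k ∧ k < b)) ↔ k ∈ B) →
      ¬ (w b < w a ∨ (w b = w a ∧ a < b)) := by
    intro a b A B hAB hA hB hab
    have ha : a ∉ A := fun h => by have := (hA a).2 h; simp at this
    have hsub : insert a A ⊆ B := by
      intro k hk
      rw [Finset.mem_insert] at hk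
      rcases hk with rfl | hk
      · exact (hB _).1 hab
      · have := (hA k).2 hk
        refine (hB k).1 ?_
        rcases this with h1 | ⟨h1, h2⟩ <;> rcases hab with h3 | ⟨h3, h4⟩
        · exact Or.inl (h3.trans h1)
        · exact Or.inl (h3 ▸ h1)
        · exact Or.inl (h1 ▸ h3)
        · exact Or.inr ⟨h3.trans h1, h2.trans h4⟩
    have := Finset.card_le_card hsub
    rw [Finset.card_insert_of_notMem ha] at this
    omega
  by_contra hne
  have h1 := key (hc.trans hc'.symm) hS hS'
  have h2 := key (hc'.trans hc.symm) hS' hS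
  push Not at h1 h2
  have h3 : w j = w j' := le_antisymm h1.1 h2.1
  have := h1.2 h3.symm
  have := h2.2 h3
  omega

lemma IsDecreasingOrder.hasRank {w : ℕ → ℝ} {π : Equiv.Perm ℕ} (h : IsDecreasingOrder w π)
    (i : ℕ) : HasRank w (π i) i := by
  refine ⟨(Finset.range i).map π.toEmbedding, by simp, fun k => ?_⟩
  obtain ⟨l, rfl⟩ := π.surjective k
  simp only [Finset.mem_map_equiv, Equiv.symm_apply_apply, Finset.mem_range]
  constructor
  · intro hl
    by_contra hil
    rcases (not_lt.1 hil).lt_or_eq with h1 | rfl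
    · rcases h i l h1 with h2 | ⟨h2, h3⟩ <;> rcases hl with h4 | ⟨h4, h5⟩ <;> linarith
    · simp at hl
  · intro hl
    rcases h l i hl with h2 | ⟨h2, h3⟩
    · exact Or.inl h2
    · exact Or.inr ⟨h2, h3⟩

/-- This replaces the quantifier over the uncountable set of permutations by countable ones over
ranks, which makes the existence of a reordering a measurable event. -/
lemma exists_isDecreasingOrder_iff (w : ℕ → ℝ) :
    (∃ π, IsDecreasingOrder w π) ↔ (∀ j, ∃ i, HasRank w j i) ∧ ∀ i, ∃ j, HasRank w j i := by
  constructor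
  · rintro ⟨π, hπ⟩
    refine ⟨fun j => ⟨π.symm j, ?_⟩, fun i => ⟨π i, hπ.hasRank i⟩⟩
    simpa using hπ.hasRank (π.symm j)
  · rintro ⟨h1, h2⟩
    choose rk hrk using h1
    choose p hp using h2
    let π : Equiv.Perm ℕ := ⟨p, rk, fun i => (hrk (p i)).unique (hp i),
      fun j => (hp (rk j)).injective (hrk j)⟩
    refine ⟨π, fun i j hij => ?_⟩
    change w (p j) < w (p i) ∨ (w (p j) = w (p i) ∧ p i < p j)
    by_contra hcon
    have hne : p i ≠ p j := fun h => by
      have := (h ▸ hp i : HasRank w (p j) i).unique (hp j)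
      omega
    have hji : w (p i) < w (p j) ∨ (w (p i) = w (p j) ∧ p j < p i) := by
      push Not at hcon
      rcases hcon.1.lt_or_eq with h | h
      · exact Or.inl h
      · have := hcon.2 h.symm
        exact Or.inr ⟨h, by omega⟩
    obtain ⟨S, hc, hS⟩ := hp i
    obtain ⟨S', hc', hS'⟩ := hp j
    have hsub : S' ⊆ S := by
      intro k hk
      have := (hS' k).2 hk
      refine (hS k).1 ?_
      rcases this with h1 | ⟨h1, h2⟩ <;> rcases hji with h3 | ⟨h3, h4⟩
      · exact Or.inl (h3.trans h1)
      · exact Or.inl (h3 ▸ h1)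
      · exact Or.inl (h1 ▸ h3)
      · exact Or.inr ⟨h3.trans h1, h2.trans h4⟩
    have := Finset.card_le_card hsub
    omega

lemma measurableSet_hasRank (j i : ℕ) : MeasurableSet {w : ℕ → ℝ | HasRank w j i} := by
  have : {w : ℕ → ℝ | HasRank w j i} = ⋃ S : Finset ℕ, ⋃ _ : S.card = i, ⋂ k,
      {w : ℕ → ℝ | (w j < w k ∨ (w j = w k ∧ k < j)) ↔ k ∈ S} := by
    ext w
    simp [HasRank]
  rw [this]
  refine .iUnion fun S => .iUnion fun _ => .iInter fun k => ?_
  have hm : MeasurableSet {w : ℕ → ℝ | w j < w k ∨ (w j = w k ∧ k < j)} := by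
    refine (measurableSet_lt (measurable_pi_apply j) (measurable_pi_apply k)).union ?_
    exact (measurableSet_eq_fun (measurable_pi_apply j) (measurable_pi_apply k)).inter (.const _)
  by_cases hk : k ∈ S
  · simpa [hk] using hm
  · simp only [hk, iff_false]
    exact hm.compl

/-- Where a reordering exists, the value at `i` is the unique particle of rank `i`; elsewhere the
default is the identity. Both descriptions are measurable in `w`. -/
lemma measurable_sortPerm_apply (i : ℕ) : Measurable fun w : ℕ → ℝ => sortPerm w i := by
  refine measurable_to_countable' fun j => ?_
  have hex : MeasurableSet {w : ℕ → ℝ | ∃ π, IsDecreasingOrder w π} := by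
    simp only [exists_isDecreasingOrder_iff, Set.ofPred_and, Set.ofPred_forall, Set.ofPred_exists]
    exact (MeasurableSet.iInter fun j => .iUnion fun i => measurableSet_hasRank j i).inter
      (MeasurableSet.iInter fun i => .iUnion fun j => measurableSet_hasRank j i)
  have : (fun w : ℕ → ℝ => sortPerm w i) ⁻¹' {j} =
      ({w : ℕ → ℝ | ∃ π, IsDecreasingOrder w π} ∩ {w | HasRank w j i}) ∪
        ({w : ℕ → ℝ | ∃ π, IsDecreasingOrder w π}ᶜ ∩ {_w | i = j}) := by
    ext w
    by_cases h : ∃ π, IsDecreasingOrder w π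
    · have hr := h.choose_spec.hasRank i
      simp only [Set.mem_preimage, Set.mem_singleton_iff, sortPerm, Set.mem_union,
        Set.mem_inter_iff, Set.mem_ofPred_eq, h, true_and, Set.mem_compl_iff, not_true,
        false_and, or_false]
      exact ⟨fun h' => h' ▸ hr, fun h' => hr.injective h'⟩
    · simp [sortPerm, h]
  rw [this]
  exact (hex.inter (measurableSet_hasRank j i)).union (hex.compl.inter (.const _))

lemma measurable_apply_nat {A E : Type*} [MeasurableSpace A] [MeasurableSpace E]
    {f : A → ℕ → E} (hf : Measurable f) {n : A → ℕ} (hn : Measurable n) :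
    Measurable fun a => f a (n a) := by
  have : Measurable fun q : A × ℕ => f q.1 q.2 := by
    refine measurable_from_prod_countable_left fun k => ?_
    exact (measurable_pi_apply k).comp hf
  exact this.comp (measurable_id.prodMk hn)

lemma measurable_tilt : Measurable fun q : (ℕ → ℝ) × (ℕ → ℝ) => tilt q.1 q.2 := by
  unfold tilt
  refine measurable_pi_lambda _ fun i => ?_
  refine Measurable.div (by fun_prop) ?_
  exact Measurable.tsum fun j => by fun_prop

lemma measurable_reshuffle_apply (i : ℕ) :
    Measurable fun q : (ℕ → ℝ) × Config => reshuffle q.1 q.2 i :=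
  (measurable_sortPerm_apply i).comp
    (measurable_tilt.comp (measurable_fst.prodMk (measurable_fst.comp measurable_snd)))

lemma measurable_evolve : Measurable fun q : (ℕ → ℝ) × Config => evolve q.1 q.2 := by
  unfold evolve
  refine Measurable.prodMk (measurable_pi_lambda _ fun i => ?_)
    (measurable_pi_lambda _ fun i => measurable_pi_lambda _ fun j => ?_)
  · exact measurable_apply_nat (measurable_tilt.comp
      (measurable_fst.prodMk (measurable_fst.comp measurable_snd))) (measurable_reshuffle_apply i)
  · refine measurable_apply_nat (f := fun (q : (ℕ → ℝ) × Config) k => q.2.2 (reshuffle q.1 q.2 i) k)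
      ?_ (measurable_reshuffle_apply j)
    exact measurable_apply_nat (f := fun (q : (ℕ → ℝ) × Config) k => q.2.2 k) (by fun_prop)
      (measurable_reshuffle_apply i)

/-- One step of the evolution, with the increments at all times `t ≥ 0`. -/
def forwardStep (φ : ℝ → ℝ) (w : Config × (ℕ → ℕ → ℝ)) : Config × (ℕ → ℕ → ℝ) :=
  (evolve (fun i => φ (w.2 0 i)) w.1,
    fun t i => w.2 (t + 1) (reshuffle (fun i => φ (w.2 0 i)) w.1 i))

lemma measurable_forwardStep {φ : ℝ → ℝ} (hφ : Measurable φ) : Measurable (forwardStep φ) := by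
  have hx : Measurable fun w : Config × (ℕ → ℕ → ℝ) => ((fun i => φ (w.2 0 i), w.1) :
      (ℕ → ℝ) × Config) := by fun_prop
  refine (measurable_evolve.comp hx).prodMk
    (measurable_pi_lambda _ fun t => measurable_pi_lambda _ fun i => ?_)
  exact measurable_apply_nat (f := fun (w : Config × (ℕ → ℕ → ℝ)) k => w.2 (t + 1) k)
    (by fun_prop) ((measurable_reshuffle_apply i).comp hx)

/-! ### The law of the increments at nonnegative times -/

/-- By convention `Measure.bind` is zero when its kernel is not a.e. measurable, so a nonzero bind
certifies measurability. The Gaussian kernels are picked by choice; their measurability in `(ξ, Q)`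
is read off from the existence of `ℙ_r`, or from quasi-stationarity. -/
lemma aemeasurable_of_bind_ne_zero {α β : Type*} [MeasurableSpace α] [MeasurableSpace β]
    {m : Measure α} {f : α → Measure β} (h : m.bind f ≠ 0) : AEMeasurable f m := by
  by_contra hf
  exact h (by rw [Measure.bind, Measure.map_of_not_aemeasurable hf, Measure.join_zero])

/-- The law of the increments at times `t ≥ 0`, given `(ξ, Q)`. -/
abbrev noise (r : ℕ) (p : Config) : Measure (ℕ → ℕ → ℝ) :=
  Measure.infinitePi fun _ : ℕ => gaussianField (entrywisePow p.2 r)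

lemma lintegral_dirac_prod {α β : Type*} [MeasurableSpace α] [MeasurableSpace β] (a : α)
    (ν : Measure β) [SFinite ν] {g : α × β → ℝ≥0∞} (hg : Measurable g) :
    ∫⁻ w, g w ∂((Measure.dirac a).prod ν) = ∫⁻ b, g (a, b) ∂ν := by
  rw [lintegral_prod _ hg.aemeasurable, lintegral_dirac' a hg.lintegral_prod_right']

section Forward

variable {r : ℕ} {μ : Measure Config}

lemma lintegral_forwardLaw (hF : forwardLaw r μ ≠ 0) {g : Config × (ℕ → ℕ → ℝ) → ℝ≥0∞}
    (hg : Measurable g) :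
    ∫⁻ w, g w ∂(forwardLaw r μ) = ∫⁻ p, ∫⁻ κ, g (p, κ) ∂(noise r p) ∂μ := by
  have hk := aemeasurable_of_bind_ne_zero hF
  rw [forwardLaw, Measure.lintegral_bind hk hg.aemeasurable]
  exact lintegral_congr fun p => lintegral_dirac_prod p _ hg

lemma aemeasurable_lintegral_noise (hF : forwardLaw r μ ≠ 0)
    {g : Config × (ℕ → ℕ → ℝ) → ℝ≥0∞} (hg : Measurable g) :
    AEMeasurable (fun p => ∫⁻ κ, g (p, κ) ∂(noise r p)) μ := by
  have hk := aemeasurable_of_bind_ne_zero hF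
  refine ((Measure.measurable_lintegral hg).comp_aemeasurable hk).congr (.of_forall fun p => ?_)
  exact lintegral_dirac_prod p _ hg

/-- Relabelling the particles by a fixed permutation turns the noise of `Q` into the noise of the
relabelled `Q`. This is why future increments, listed in the new order, still have the prescribed
law. -/
lemma map_comp_noise {p : Config} (hp : p ∈ overlapSpace) (π : Equiv.Perm ℕ) :
    (noise r p).map (fun κ t i => κ t (π i))
      = Measure.infinitePi fun _ : ℕ =>
          gaussianField (entrywisePow (fun i j => p.2 (π i) (π j)) r) := by
  have h := Measure.infinitePi_map_pi (fun _ : ℕ => gaussianField (entrywisePow p.2 r))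
    (f := fun _ (κ : ℕ → ℝ) i => κ (π i)) (fun _ => by fun_prop)
  rw [noise, h]
  congr 1
  funext _
  exact map_comp_gaussianField (posSemidef_entrywisePow hp.2.2.2.2.1 r) π

/-- The Markov property of the evolution at time `1`. -/
lemma lintegral_noise_forwardStep {φ : ℝ → ℝ} (hφ : Measurable φ) {p : Config}
    (hp : p ∈ overlapSpace) {g : Config × (ℕ → ℕ → ℝ) → ℝ≥0∞} (hg : Measurable g) :
    ∫⁻ κ, g (forwardStep φ (p, κ)) ∂(noise r p)
      = ∫⁻ x, ∫⁻ κ, g (evolve (fun i => φ (x i)) p, κ) ∂(noise r (evolve (fun i => φ (x i)) p))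
          ∂(gaussianField (entrywisePow p.2 r)) := by
  -- The first field is separated from the later ones: it alone determines the permutation, which is
  -- therefore fixed when the later fields are integrated.
  let G : (ℕ → ℝ) × (ℕ → ℕ → ℝ) → ℝ≥0∞ := fun q =>
    g (evolve (fun i => φ (q.1 i)) p, fun t i => q.2 t (reshuffle (fun i => φ (q.1 i)) p i))
  have hx : Measurable fun q : (ℕ → ℝ) × (ℕ → ℕ → ℝ) => (((fun i => φ (q.1 i)), p) :
      (ℕ → ℝ) × Config) := by fun_prop
  have hG : Measurable G := by
    refine hg.comp ((measurable_evolve.comp hx).prodMk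
      (measurable_pi_lambda _ fun t => measurable_pi_lambda _ fun i => ?_))
    exact measurable_apply_nat (f := fun (q : (ℕ → ℝ) × (ℕ → ℕ → ℝ)) k => q.2 t k)
      (by fun_prop) ((measurable_reshuffle_apply i).comp hx)
  have h1 : ∫⁻ κ, g (forwardStep φ (p, κ)) ∂(noise r p)
      = ∫⁻ q, G q ∂((gaussianField (entrywisePow p.2 r)).prod (noise r p)) := by
    rw [← map_infinitePi_zero_succ, lintegral_map hG (by fun_prop)]
    rfl
  rw [h1, lintegral_prod _ hG.aemeasurable]
  refine lintegral_congr fun x => ?_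
  have h2 := map_comp_noise (r := r) hp (reshuffle (fun i => φ (x i)) p)
  change _ = ∫⁻ κ, g (evolve (fun i => φ (x i)) p, κ) ∂(Measure.infinitePi fun _ : ℕ =>
          gaussianField (entrywisePow (fun i j => p.2 (reshuffle (fun i => φ (x i)) p i)
            (reshuffle (fun i => φ (x i)) p j)) r))
  rw [← h2, lintegral_map (by fun_prop) (by fun_prop)]

/-- Quasi-stationarity takes care of the configuration, and the Markov property of the remaining
increments given the new configuration. -/
lemma measurePreserving_forwardStep [IsProbabilityMeasure μ] (hF : forwardLaw r μ ≠ 0)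
    (hμ : ∀ᵐ p ∂μ, p ∈ overlapSpace) {φ : ℝ → ℝ} (hφ : Measurable φ)
    (hq : IsQuasiStationary r φ μ) :
    MeasurePreserving (forwardStep φ) (forwardLaw r μ) (forwardLaw r μ) := by
  have hθ := measurable_forwardStep hφ
  refine ⟨hθ, Measure.ext fun A hA => ?_⟩
  have hA' : Measurable (A.indicator (fun _ => (1 : ℝ≥0∞))) := measurable_const.indicator hA
  have hne : evolvedLaw r φ μ ≠ 0 := by rw [hq]; exact IsProbabilityMeasure.ne_zero μ
  have hk := aemeasurable_of_bind_ne_zero hne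
  set H : Config → ℝ≥0∞ := fun p => ∫⁻ κ, A.indicator (fun _ => 1) (p, κ) ∂(noise r p) with hH
  have hHm : AEMeasurable H μ := aemeasurable_lintegral_noise hF hA'
  have hHm' : AEMeasurable H (evolvedLaw r φ μ) := by rw [hq]; exact hHm
  have e1 : (Measure.map (forwardStep φ) (forwardLaw r μ)) A
      = ∫⁻ w, A.indicator (fun _ => 1) (forwardStep φ w) ∂(forwardLaw r μ) := by
    rw [← lintegral_map hA' hθ, lintegral_indicator hA]
    simp
  have e2 : forwardLaw r μ A = ∫⁻ p, H p ∂μ := by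
    rw [← lintegral_forwardLaw hF hA', lintegral_indicator hA]
    simp
  have e3 : ∫⁻ p, H p ∂μ = ∫⁻ p, H p ∂(evolvedLaw r φ μ) := by rw [hq]
  rw [e1, e2, e3, lintegral_forwardLaw
    (g := fun w => A.indicator (fun _ => 1) (forwardStep φ w)) hF (hA'.comp hθ), evolvedLaw,
    Measure.lintegral_bind hk hHm']
  refine lintegral_congr_ae ?_
  filter_upwards [hμ, hk.ae_of_bind hHm'] with p hp hpm
  rw [lintegral_map' hpm]
  · exact lintegral_noise_forwardStep hφ hp hA'
  · have hx : Measurable fun κ : ℕ → ℝ => (((fun i => φ (κ i)), p) : (ℕ → ℝ) × Config) := by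
      fun_prop
    exact (measurable_evolve.comp hx).aemeasurable

/-- Permuting the times leaves the law of the increments unchanged. -/
lemma measurePreserving_permute_time (hF : forwardLaw r μ ≠ 0) (σ : Equiv.Perm ℕ) :
    MeasurePreserving (fun w : Config × (ℕ → ℕ → ℝ) => (w.1, fun t => w.2 (σ t)))
      (forwardLaw r μ) (forwardLaw r μ) := by
  have hm : Measurable fun w : Config × (ℕ → ℕ → ℝ) => (w.1, fun t => w.2 (σ t)) := by fun_prop
  refine ⟨hm, Measure.ext_of_lintegral _ fun g hg => ?_⟩
  rw [lintegral_map hg hm, lintegral_forwardLaw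
    (g := fun w => g (w.1, fun t => w.2 (σ t))) hF (hg.comp hm), lintegral_forwardLaw hF hg]
  refine lintegral_congr fun p => ?_
  have h := Measure.map_infinitePi_infinitePi_of_inj
    (P := fun _ : ℕ => gaussianField (entrywisePow p.2 r)) σ.injective
  conv_rhs => rw [noise, ← h]
  rw [lintegral_map (by fun_prop) (by fun_prop)]

/-- The increments at even times and at odd times are conditionally independent copies of the
whole family of increments. -/
lemma lintegral_forwardLaw_even_odd (hF : forwardLaw r μ ≠ 0)
    {g : Config × (ℕ → ℕ → ℝ) × (ℕ → ℕ → ℝ) → ℝ≥0∞} (hg : Measurable g) :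
    ∫⁻ w, g (w.1, fun t => w.2 (2 * t), fun t => w.2 (2 * t + 1)) ∂(forwardLaw r μ)
      = ∫⁻ p, ∫⁻ κ, ∫⁻ κ', g (p, κ, κ') ∂(noise r p) ∂(noise r p) ∂μ := by
  rw [lintegral_forwardLaw hF (by fun_prop)]
  refine lintegral_congr fun p => ?_
  have hgp : Measurable fun q : (ℕ → ℕ → ℝ) × (ℕ → ℕ → ℝ) => g (p, q.1, q.2) := by fun_prop
  rw [← lintegral_prod (fun q : (ℕ → ℕ → ℝ) × (ℕ → ℕ → ℝ) => g (p, q.1, q.2)) hgp.aemeasurable,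
    noise, ← map_infinitePi_even_odd, lintegral_map hgp (by fun_prop)]

/-- The mean of a weighted sum over the particles of a function of the increments at time `0`. -/
lemma lintegral_forwardLaw_tsum (hr : forwardLaw r μ ≠ 0) (hμ : ∀ᵐ p ∂μ, p ∈ overlapSpace)
    {g : ℝ → ℝ≥0∞} (hg : Measurable g) :
    ∫⁻ w, ∑' j, ENNReal.ofReal (w.1.1 j) * g (w.2 0 j) ∂(forwardLaw r μ)
      = (∫⁻ p, ∑' j, ENNReal.ofReal (p.1 j) ∂μ) * ∫⁻ y, g y ∂(gaussianReal 0 1) := by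
  rw [lintegral_forwardLaw hr (Measurable.tsum fun j => by fun_prop), ← lintegral_mul_const _
    (Measurable.tsum fun j => by fun_prop)]
  refine lintegral_congr_ae ?_
  filter_upwards [hμ] with p hp
  rw [lintegral_tsum (fun j => Measurable.aemeasurable (by fun_prop)), ENNReal.tsum_mul_right.symm]
  congr 1
  funext j
  rw [lintegral_const_mul _ (by fun_prop)]
  congr 1
  have h1 : ∫⁻ κ, g (κ 0 j) ∂(noise r p) = ∫⁻ x, g (x j) ∂(gaussianField (entrywisePow p.2 r)) := by
    rw [← Measure.infinitePi_map_eval (fun _ : ℕ => gaussianField (entrywisePow p.2 r)) 0,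
      lintegral_map (by fun_prop) (by fun_prop)]
  rw [h1, ← map_eval_gaussianField (posSemidef_entrywisePow hp.2.2.2.2.1 r) (i := j)
    (by simp [entrywisePow, hp.2.2.2.2.2 j]), lintegral_map hg (by fun_prop)]

end Forward

/-! ### Partition functions -/

/-- The unnormalized weight `ξ_j e^{φ(κ_j(0)) + ⋯ + φ(κ_j(T-1))}` of a particle after `T` steps. -/
def rawWeight (φ : ℝ → ℝ) (T : ℕ) (w : Config × (ℕ → ℕ → ℝ)) (j : ℕ) : ℝ :=
  w.1.1 j * Real.exp (∑ t ∈ Finset.range T, φ (w.2 t j))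

/-- The sum of the unnormalized weights after `T` steps. -/
def partition (φ : ℝ → ℝ) (T : ℕ) (w : Config × (ℕ → ℕ → ℝ)) : ℝ := ∑' j, rawWeight φ T w j

lemma measurable_rawWeight {φ : ℝ → ℝ} (hφ : Measurable φ) (T j : ℕ) :
    Measurable fun w => rawWeight φ T w j := by
  unfold rawWeight
  fun_prop

lemma measurable_partition {φ : ℝ → ℝ} (hφ : Measurable φ) (T : ℕ) :
    Measurable (partition φ T) :=
  Measurable.tsum fun j => measurable_rawWeight hφ T j

lemma rawWeight_one (φ : ℝ → ℝ) (w : Config × (ℕ → ℕ → ℝ)) (j : ℕ) :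
    rawWeight φ 1 w j = w.1.1 j * Real.exp (φ (w.2 0 j)) := by
  simp [rawWeight]

lemma rawWeight_forwardStep (φ : ℝ → ℝ) (T : ℕ) (w : Config × (ℕ → ℕ → ℝ)) (i : ℕ) :
    rawWeight φ T (forwardStep φ w) i =
      rawWeight φ (T + 1) w (reshuffle (fun i => φ (w.2 0 i)) w.1 i) / partition φ 1 w := by
  simp only [partition, rawWeight_one]
  simp only [rawWeight, forwardStep, evolve, tilt, Finset.sum_range_succ', Real.exp_add]
  ring

/-- This cocycle relation makes `log (partition φ T)` additive along the evolution, so that its mean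
is linear in `T`. -/
lemma partition_forwardStep (φ : ℝ → ℝ) (T : ℕ) (w : Config × (ℕ → ℕ → ℝ)) :
    partition φ T (forwardStep φ w) = partition φ (T + 1) w / partition φ 1 w := by
  rw [partition, funext (rawWeight_forwardStep φ T w),
    (reshuffle (fun i => φ (w.2 0 i)) w.1).tsum_eq
      (fun j => rawWeight φ (T + 1) w j / partition φ 1 w), tsum_div_const]
  rfl

/-- Summability is pulled back from the image point, so sums over many steps are handled by
induction, without moments of several increments at once. -/
lemma summable_rawWeight_succ {φ : ℝ → ℝ} {T : ℕ} {w : Config × (ℕ → ℕ → ℝ)}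
    (hZ : partition φ 1 w ≠ 0) (h : Summable (rawWeight φ T (forwardStep φ w))) :
    Summable (rawWeight φ (T + 1) w) := by
  rw [funext (rawWeight_forwardStep φ T w)] at h
  have h2 := ((reshuffle (fun i => φ (w.2 0 i)) w.1).summable_iff
      (f := fun j => rawWeight φ (T + 1) w j / partition φ 1 w)).1 h
  exact (summable_div_const_iff hZ).1 h2

/-- The increments at times `t ≥ 0` of a history. -/
def forward (ω : History) : Config × (ℕ → ℕ → ℝ) := (ω.1, fun t : ℕ => ω.2 (t : ℤ))

lemma measurable_forward : Measurable forward := by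
  unfold forward
  fun_prop

/-- After `T` steps the particles are the original ones, up to a permutation, with weights
proportional to `ξ_j e^{φ(κ_j(0)) + ⋯ + φ(κ_j(T-1))}`. -/
lemma exists_perm_timeStep_iterate (φ : ℝ → ℝ) (ω : History)
    (h0 : partition φ 0 (forward ω) = 1) (hZ : ∀ T, partition φ T (forward ω) ≠ 0) (T : ℕ) :
    ∃ π : Equiv.Perm ℕ,
      (∀ i, ((timeStep φ)^[T] ω).1.1 i
        = rawWeight φ T (forward ω) (π i) / partition φ T (forward ω)) ∧
      ∀ t i, ((timeStep φ)^[T] ω).2 t i = ω.2 (t + T) (π i) := by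
  induction T with
  | zero =>
    exact ⟨1, fun i => by rw [h0]; simp [rawWeight, forward], fun t i => by simp⟩
  | succ T ih =>
    obtain ⟨π, h1, h2⟩ := ih
    set ω' := (timeStep φ)^[T] ω with hω'
    set ρ := reshuffle (fun i => φ (ω'.2 0 i)) ω'.1 with hρ
    refine ⟨ρ.trans π, fun i => ?_, fun t i => ?_⟩
    · rw [Function.iterate_succ_apply', ← hω']
      have hw : ∀ k, ω'.1.1 k * Real.exp (φ (ω'.2 0 k))
          = rawWeight φ (T + 1) (forward ω) (π k) / partition φ T (forward ω) := by
        intro k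
        rw [h1, h2]
        simp only [rawWeight, Finset.sum_range_succ, Real.exp_add, forward, zero_add]
        ring
      change ω'.1.1 (ρ i) * Real.exp (φ (ω'.2 0 (ρ i))) / ∑' k, ω'.1.1 k * Real.exp (φ (ω'.2 0 k))
        = _
      simp only [hw]
      rw [π.tsum_eq (fun j => rawWeight φ (T + 1) (forward ω) j / partition φ T (forward ω)),
        tsum_div_const, div_div_div_cancel_right₀ (hZ T)]
      rfl
    · rw [Function.iterate_succ_apply', ← hω']
      change ω'.2 (t + 1) (ρ i) = _
      have ht : t + 1 + (T : ℤ) = t + ((T + 1 : ℕ) : ℤ) := by push_cast; ring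
      rw [h2, ht]
      rfl

/-! ### Moments of the increments -/

/-- Jensen's inequality, from the tangent line to `exp` at the mean `m`. -/
lemma tsum_mul_le_log_tsum_mul_exp {ξ x : ℕ → ℝ} (hξ : ∀ i, 0 ≤ ξ i) (h1 : HasSum ξ 1)
    (hx : Summable fun i => ξ i * x i) (he : Summable fun i => ξ i * Real.exp (x i)) :
    0 < ∑' i, ξ i * Real.exp (x i) ∧
      ∑' i, ξ i * x i ≤ Real.log (∑' i, ξ i * Real.exp (x i)) := by
  set m := ∑' i, ξ i * x i with hm
  have hle : HasSum (fun i => Real.exp m * (ξ i * x i + ξ i * (1 - m)))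
      (Real.exp m * (m + 1 * (1 - m))) := (hx.hasSum.add (h1.mul_right _)).mul_left _
  have key : Real.exp m ≤ ∑' i, ξ i * Real.exp (x i) := by
    have h2 := hasSum_le (fun i => ?_) hle he.hasSum
    · simpa using h2
    · have h3 : x i - m + 1 ≤ Real.exp (x i - m) := Real.add_one_le_exp _
      have h4 : Real.exp (x i) = Real.exp m * Real.exp (x i - m) := by
        rw [← Real.exp_add]; ring_nf
      rw [h4]
      have h5 := mul_le_mul_of_nonneg_left h3 (mul_nonneg (hξ i) (Real.exp_pos m).le)
      nlinarith
  exact ⟨(Real.exp_pos m).trans_le key, (Real.le_log_iff_exp_le ((Real.exp_pos m).trans_le key)).2 key⟩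

/-- Nonnegativity of the variance. -/
lemma sq_tsum_mul_le {ξ u : ℕ → ℝ} (hξ : ∀ i, 0 ≤ ξ i) (h1 : HasSum ξ 1)
    (hu : Summable fun i => ξ i * u i) (hu2 : Summable fun i => ξ i * u i ^ 2) :
    (∑' i, ξ i * u i) ^ 2 ≤ ∑' i, ξ i * u i ^ 2 := by
  set m := ∑' i, ξ i * u i with hm
  have hle := (hu.hasSum.mul_left (2 * m)).sub (h1.mul_left (m ^ 2))
  have h2 := hasSum_le (fun i => ?_) hle hu2.hasSum
  · rw [← hm] at h2; linarith
  · have := mul_nonneg (hξ i) (sq_nonneg (u i - m))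
    nlinarith

/-- The increments `ψ` of a particle have exponential moments of all orders with respect to the
weights. -/
def HasExpSums (ψ : ℝ → ℝ) (ξ : ℕ → ℝ) (κ : ℕ → ℝ) : Prop :=
  ∀ c : ℝ, Summable fun j => ξ j * Real.exp (c * |ψ (κ j)|)

lemma HasExpSums.summable_exp {ψ : ℝ → ℝ} {ξ κ : ℕ → ℝ} (h : HasExpSums ψ ξ κ)
    (hξ : ∀ j, 0 ≤ ξ j) (c : ℝ) : Summable fun j => ξ j * Real.exp (c * ψ (κ j)) := by
  refine Summable.of_nonneg_of_le (fun j => mul_nonneg (hξ j) (Real.exp_pos _).le) (fun j => ?_)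
    (h |c|)
  refine mul_le_mul_of_nonneg_left (Real.exp_le_exp.2 ?_) (hξ j)
  rw [← abs_mul]
  exact le_abs_self _

lemma HasExpSums.summable_mul {ψ : ℝ → ℝ} {ξ κ : ℕ → ℝ} (h : HasExpSums ψ ξ κ)
    (hξ : ∀ j, 0 ≤ ξ j) (c : ℝ) : Summable fun j => ξ j * (c * ψ (κ j)) := by
  refine Summable.of_norm_bounded (h |c|) fun j => ?_
  rw [norm_mul, Real.norm_eq_abs, abs_of_nonneg (hξ j), Real.norm_eq_abs, abs_mul]
  refine mul_le_mul_of_nonneg_left ?_ (hξ j)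
  have := Real.add_one_le_exp (|c| * |ψ (κ j)|)
  linarith

/-- Jensen bounds the logarithm from below by the mean exponent, and `log z ≤ z - 1` bounds it from
above. -/
lemma abs_log_tsum_le {ψ : ℝ → ℝ} {ξ κ : ℕ → ℝ} (hξ : ∀ j, 0 ≤ ξ j) (h1 : HasSum ξ 1)
    (h : HasExpSums ψ ξ κ) (c : ℝ) :
    |Real.log (∑' j, ξ j * Real.exp (c * ψ (κ j)))| ≤ ∑' j, ξ j * Real.exp (|c| * |ψ (κ j)|) := by
  obtain ⟨hpos, hlog⟩ := tsum_mul_le_log_tsum_mul_exp hξ h1 (h.summable_mul hξ c)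
    (h.summable_exp hξ c)
  have hb : ∑' j, ξ j * Real.exp (c * ψ (κ j)) ≤ ∑' j, ξ j * Real.exp (|c| * |ψ (κ j)|) := by
    refine (h.summable_exp hξ c).tsum_le_tsum (fun j => ?_) (h |c|)
    refine mul_le_mul_of_nonneg_left (Real.exp_le_exp.2 ?_) (hξ j)
    rw [← abs_mul]
    exact le_abs_self _
  rw [abs_le]
  constructor
  · refine le_trans ?_ hlog
    rw [neg_le, ← tsum_neg]
    refine (h.summable_mul hξ c).neg.tsum_le_tsum (fun j => ?_) (h |c|)
    rw [← mul_neg]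
    refine mul_le_mul_of_nonneg_left ?_ (hξ j)
    have := Real.add_one_le_exp (|c| * |ψ (κ j)|)
    have h2 := neg_le_abs (c * ψ (κ j))
    rw [abs_mul] at h2
    linarith
  · have := Real.log_le_sub_one_of_pos hpos
    linarith

/-- Exponential moments survive the normalized tilt. Jensen at `c` and at `-c` gives `1 / Z(c) ≤
Z(-c)`, which removes the denominator. With `b = |c| + |d|` the tilted moment is at most the square
of `∑ ξ_j e^{b|ψ|}`, and Cauchy–Schwarz turns this square into the exponent `2b`. -/
lemma tsum_exp_div_le {ψ : ℝ → ℝ} {ξ κ : ℕ → ℝ} (hξ : ∀ j, 0 ≤ ξ j) (h1 : HasSum ξ 1)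
    (h : HasExpSums ψ ξ κ) (c d : ℝ) :
    (Summable fun j => ξ j * Real.exp (c * ψ (κ j)) / (∑' k, ξ k * Real.exp (c * ψ (κ k)))
        * Real.exp (d * |ψ (κ j)|)) ∧
    ∑' j, ξ j * Real.exp (c * ψ (κ j)) / (∑' k, ξ k * Real.exp (c * ψ (κ k)))
        * Real.exp (d * |ψ (κ j)|)
      ≤ ∑' j, ξ j * Real.exp (2 * (|c| + |d|) * |ψ (κ j)|) := by
  set Z := ∑' k, ξ k * Real.exp (c * ψ (κ k)) with hZ
  set b := |c| + |d| with hb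
  set A := ∑' j, ξ j * Real.exp (b * |ψ (κ j)|) with hA
  obtain ⟨hpos, hlog⟩ := tsum_mul_le_log_tsum_mul_exp hξ h1 (h.summable_mul hξ c)
    (h.summable_exp hξ c)
  obtain ⟨hpos', hlog'⟩ := tsum_mul_le_log_tsum_mul_exp hξ h1 (h.summable_mul hξ (-c))
    (h.summable_exp hξ (-c))
  set Z' := ∑' k, ξ k * Real.exp (-c * ψ (κ k)) with hZ'
  have hinv : Z⁻¹ ≤ Z' := by
    have e : ∑' j, ξ j * (-c * ψ (κ j)) = -∑' j, ξ j * (c * ψ (κ j)) := by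
      rw [← tsum_neg]; congr 1; funext j; ring
    rw [e] at hlog'
    rw [← Real.log_le_log_iff (inv_pos.2 hpos) hpos', Real.log_inv]
    linarith
  have hle : ∀ e : ℝ, |e| ≤ b → ∀ j, ξ j * Real.exp (e * ψ (κ j)) ≤ ξ j * Real.exp (b * |ψ (κ j)|) := by
    intro e he j
    refine mul_le_mul_of_nonneg_left (Real.exp_le_exp.2 ?_) (hξ j)
    refine (le_abs_self _).trans ?_
    rw [abs_mul]
    exact mul_le_mul_of_nonneg_right he (abs_nonneg _)
  have hZA : Z' ≤ A := (h.summable_exp hξ (-c)).tsum_le_tsum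
    (hle (-c) (by rw [abs_neg, hb]; linarith [abs_nonneg d])) (h b)
  have hterm : ∀ j, ξ j * Real.exp (c * ψ (κ j)) / Z * Real.exp (d * |ψ (κ j)|)
      ≤ Z⁻¹ * (ξ j * Real.exp (b * |ψ (κ j)|)) := by
    intro j
    have : Real.exp (c * ψ (κ j)) * Real.exp (d * |ψ (κ j)|) ≤ Real.exp (b * |ψ (κ j)|) := by
      rw [← Real.exp_add]
      refine Real.exp_le_exp.2 ?_
      have e1 : c * ψ (κ j) ≤ |c| * |ψ (κ j)| := (le_abs_self _).trans (abs_mul _ _).le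
      have e2 : d * |ψ (κ j)| ≤ |d| * |ψ (κ j)| :=
        mul_le_mul_of_nonneg_right (le_abs_self d) (abs_nonneg _)
      rw [hb]; linarith
    have h2 := mul_le_mul_of_nonneg_left this (mul_nonneg (inv_nonneg.2 hpos.le) (hξ j))
    calc _ = Z⁻¹ * ξ j * (Real.exp (c * ψ (κ j)) * Real.exp (d * |ψ (κ j)|)) := by
            rw [div_eq_mul_inv]; ring
      _ ≤ _ := h2
      _ = _ := by ring
  have hs := (h b).mul_left Z⁻¹
  have hA0 : 0 ≤ A := tsum_nonneg fun j => mul_nonneg (hξ j) (Real.exp_pos _).le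
  have hs' : Summable fun j => ξ j * Real.exp (c * ψ (κ j)) / Z * Real.exp (d * |ψ (κ j)|) := by
    refine Summable.of_nonneg_of_le (fun j => ?_) hterm hs
    exact mul_nonneg (div_nonneg (mul_nonneg (hξ j) (Real.exp_pos _).le) hpos.le) (Real.exp_pos _).le
  have e1 : ∑' j, ξ j * Real.exp (c * ψ (κ j)) / Z * Real.exp (d * |ψ (κ j)|) ≤ Z⁻¹ * A := by
    rw [hA, ← tsum_mul_left]
    exact Summable.tsum_le_tsum hterm hs' hs
  have hexp : ∀ j, Real.exp (b * |ψ (κ j)|) ^ 2 = Real.exp (2 * b * |ψ (κ j)|) := by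
    intro j; rw [← Real.exp_nat_mul]; congr 1; push_cast; ring
  have hsq := sq_tsum_mul_le hξ h1 (h b) (by simpa only [hexp] using h (2 * b))
  simp only [hexp] at hsq
  refine ⟨hs', ?_⟩
  calc _ ≤ Z⁻¹ * A := e1
    _ ≤ A * A := mul_le_mul_of_nonneg_right (hinv.trans hZA) hA0
    _ = A ^ 2 := (sq A).symm
    _ ≤ _ := hsq

/-! ### The law of large numbers for sequences with constant correlations -/

section Averages

variable {E : Type*} [NormedAddCommGroup E] [InnerProductSpace ℝ E]

/-- Each `F j` with `j < m ≤ n` has the same inner product `n * a + (b - a)` with the longer sum, so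
the result does not depend on `m`. -/
lemma inner_average_average {F : ℕ → E} {a b : ℝ} (hb : ∀ n, inner ℝ (F n) (F n) = b)
    (ha : ∀ n m, n ≠ m → inner ℝ (F n) (F m) = a) {m n : ℕ} (hm : 1 ≤ m) (hmn : m ≤ n) :
    inner ℝ ((n : ℝ)⁻¹ • ∑ i ∈ Finset.range n, F i) ((m : ℝ)⁻¹ • ∑ i ∈ Finset.range m, F i)
      = a + (b - a) * (n : ℝ)⁻¹ := by
  have hm0 : (m : ℝ) ≠ 0 := by positivity
  have hn0 : (n : ℝ) ≠ 0 := by have : 0 < n := by omega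
                               positivity
  have h1 : ∀ j ∈ Finset.range m, ∑ i ∈ Finset.range n, inner ℝ (F i) (F j) = n * a + (b - a) := by
    intro j hj
    have hjn : j ∈ Finset.range n := Finset.mem_range.2 ((Finset.mem_range.1 hj).trans_le hmn)
    have : ∀ i ∈ Finset.range n, inner ℝ (F i) (F j) = a + if i = j then b - a else 0 := by
      intro i _
      split_ifs with h
      · subst h; rw [hb]; ring
      · rw [ha i j h, add_zero]
    rw [Finset.sum_congr rfl this, Finset.sum_add_distrib, Finset.sum_ite_eq', if_pos hjn]
    simp
  rw [inner_smul_left, inner_smul_right, inner_sum]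
  simp only [sum_inner]
  rw [Finset.sum_congr rfl h1]
  simp only [Finset.sum_const, Finset.card_range, nsmul_eq_mul, conj_trivial]
  field_simp

lemma norm_average_sub_average_sq {F : ℕ → E} {a b : ℝ} (hb : ∀ n, inner ℝ (F n) (F n) = b)
    (ha : ∀ n m, n ≠ m → inner ℝ (F n) (F m) = a) {m n : ℕ} (hm : 1 ≤ m) (hmn : m ≤ n) :
    ‖(n : ℝ)⁻¹ • ∑ i ∈ Finset.range n, F i - (m : ℝ)⁻¹ • ∑ i ∈ Finset.range m, F i‖ ^ 2
      = (b - a) * ((m : ℝ)⁻¹ - (n : ℝ)⁻¹) := by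
  rw [norm_sub_sq_real, ← real_inner_self_eq_norm_sq, ← real_inner_self_eq_norm_sq,
    inner_average_average hb ha hm hmn, inner_average_average hb ha (hm.trans hmn) le_rfl,
    inner_average_average hb ha hm le_rfl]
  ring

/-- The exact distance `(b - a)(1/m - 1/n)` between two averages makes them a Cauchy sequence;
letting `n → ∞` gives the rate. -/
lemma exists_tendsto_average [CompleteSpace E] {F : ℕ → E} {a b : ℝ}
    (hb : ∀ n, inner ℝ (F n) (F n) = b) (ha : ∀ n m, n ≠ m → inner ℝ (F n) (F m) = a) :
    ∃ V : E, ∀ n : ℕ, 1 ≤ n →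
      ‖(n : ℝ)⁻¹ • ∑ i ∈ Finset.range n, F i - V‖ ^ 2 ≤ (b - a) * (n : ℝ)⁻¹ := by
  set A : ℕ → E := fun n => (n : ℝ)⁻¹ • ∑ i ∈ Finset.range n, F i with hA
  have hba : 0 ≤ b - a := by
    have h := norm_average_sub_average_sq hb ha (m := 1) (n := 2) le_rfl (by norm_num)
    have h2 := sq_nonneg ‖((2 : ℕ) : ℝ)⁻¹ • ∑ i ∈ Finset.range 2, F i
      - ((1 : ℕ) : ℝ)⁻¹ • ∑ i ∈ Finset.range 1, F i‖
    rw [h] at h2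
    norm_num at h2
    linarith
  have hle : ∀ m n : ℕ, 1 ≤ m → m ≤ n → ‖A n - A m‖ ^ 2 ≤ (b - a) * (m : ℝ)⁻¹ := by
    intro m n hm hmn
    rw [hA, norm_average_sub_average_sq hb ha hm hmn]
    exact mul_le_mul_of_nonneg_left (sub_le_self _ (by positivity)) hba
  have hc : CauchySeq A := by
    -- The average at index `0` is a default value outside the estimate, so the bound there is
    -- merely some constant that dominates its distance to all the averages.
    refine cauchySeq_of_le_tendsto_0' (fun m : ℕ => if m = 0 then dist (A 0) 0 + 1 + √(b - a) +
      ‖A 1‖ else √((b - a) * (m : ℝ)⁻¹)) (fun m n hmn => ?_) ?_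
    · rcases Nat.eq_zero_or_pos m with rfl | hm
      · simp only [if_true]
        rcases Nat.eq_zero_or_pos n with rfl | hn
        · rw [dist_self]; positivity
        · have h1 := hle 1 n le_rfl hn
          have h2 : ‖A n - A 1‖ ≤ √(b - a) := Real.le_sqrt_of_sq_le (by simpa using h1)
          have h3 : dist (A 0) (A n) ≤ dist (A 0) 0 + dist 0 (A n) := dist_triangle _ _ _
          have h4 : ‖A n‖ ≤ ‖A n - A 1‖ + ‖A 1‖ := by simpa using norm_add_le (A n - A 1) (A 1)
          rw [dist_zero_left] at h3
          linarith
      · rw [if_neg hm.ne', dist_comm, dist_eq_norm]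
        exact Real.le_sqrt_of_sq_le (hle m n hm hmn)
    · have : Tendsto (fun m : ℕ => √((b - a) * (m : ℝ)⁻¹)) atTop (𝓝 0) := by
        have h := (tendsto_inv_atTop_nhds_zero_nat (𝕜 := ℝ)).const_mul (b - a)
        rw [mul_zero] at h
        simpa using h.sqrt
      refine this.congr' ?_
      filter_upwards [eventually_ge_atTop 1] with m hm
      rw [if_neg (by omega)]
  obtain ⟨V, hV⟩ := cauchySeq_tendsto_of_complete hc
  refine ⟨V, fun n hn => ?_⟩
  have h1 : Tendsto (fun k => ‖A n - A k‖ ^ 2) atTop (𝓝 (‖A n - V‖ ^ 2)) :=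
    ((tendsto_const_nhds.sub hV).norm).pow 2
  refine le_of_tendsto h1 ?_
  filter_upwards [eventually_ge_atTop n] with k hk
  rw [norm_sub_rev]
  exact hle n k hn hk

end Averages

/-- The sum of the squares has finite integral, hence is finite almost everywhere, and its terms
tend to zero. -/
lemma ae_tendsto_zero_of_summable_sq {α : Type*} [MeasurableSpace α] {M : Measure α}
    {h : ℕ → α → ℝ} (hm : ∀ n, AEMeasurable (h n) M) {c : ℕ → ℝ}
    (hc : Summable c) (hc0 : ∀ n, 0 ≤ c n)
    (hle : ∀ n, ∫⁻ x, ENNReal.ofReal (h n x ^ 2) ∂M ≤ ENNReal.ofReal (c n)) :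
    ∀ᵐ x ∂M, Tendsto (fun n => h n x) atTop (𝓝 0) := by
  have hm' : ∀ n, AEMeasurable (fun x => ENNReal.ofReal (h n x ^ 2)) M := fun n =>
    ((hm n).pow_const 2).ennreal_ofReal
  have h1 : ∫⁻ x, ∑' n, ENNReal.ofReal (h n x ^ 2) ∂M ≠ ⊤ := by
    rw [lintegral_tsum hm']
    refine ne_top_of_le_ne_top ?_ (ENNReal.tsum_le_tsum hle)
    rw [← ENNReal.ofReal_tsum_of_nonneg hc0 hc]
    exact ENNReal.ofReal_ne_top
  filter_upwards [ae_lt_top' (AEMeasurable.tsum hm') h1] with x hx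
  have h2 := ENNReal.tendsto_atTop_zero_of_tsum_ne_top hx.ne
  have h3 : Tendsto (fun n => h n x ^ 2) atTop (𝓝 0) := by
    have := (ENNReal.tendsto_toReal ENNReal.zero_ne_top).comp h2
    simpa [Function.comp_def, ENNReal.toReal_ofReal (sq_nonneg _)] using this
  have h4 := h3.sqrt
  simp only [Real.sqrt_sq_eq_abs, Real.sqrt_zero] at h4
  exact (tendsto_zero_iff_abs_tendsto_zero _).2 h4

/-- If `∫ f_n f_m` depends only on whether `n = m`, then the averages of the sequence converge
almost everywhere and in mean square. -/
theorem exists_ae_tendsto_average {α : Type*} [MeasurableSpace α] {M : Measure α}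
    {f : ℕ → α → ℝ} (hf : ∀ n, MemLp (f n) 2 M) {a b : ℝ} (hb : ∀ n, ∫ x, f n x * f n x ∂M = b)
    (ha : ∀ n m, n ≠ m → ∫ x, f n x * f m x ∂M = a) :
    ∃ v : α → ℝ, Measurable v ∧ MemLp v 2 M ∧
      (∀ᵐ x ∂M, Tendsto (fun n : ℕ => (n : ℝ)⁻¹ * ∑ i ∈ Finset.range n, f i x) atTop (𝓝 (v x))) ∧
      ∃ C : ℝ, ∀ n : ℕ, 1 ≤ n →
        ∫⁻ x, ENNReal.ofReal (((n : ℝ)⁻¹ * ∑ i ∈ Finset.range n, f i x - v x) ^ 2) ∂M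
          ≤ ENNReal.ofReal (C * (n : ℝ)⁻¹) := by
  set F : ℕ → Lp ℝ 2 M := fun n => (hf n).toLp (f n) with hF
  have hin : ∀ n m, inner ℝ (F n) (F m) = ∫ x, f n x * f m x ∂M := by
    intro n m
    rw [L2.inner_def]
    refine integral_congr_ae ?_
    filter_upwards [(hf n).coeFn_toLp, (hf m).coeFn_toLp] with x h1 h2
    rw [hF]
    simp only [h1, h2]
    simp [mul_comm]
  obtain ⟨V, hV⟩ := exists_tendsto_average (F := F) (a := a) (b := b)
    (fun n => (hin n n).trans (hb n)) (fun n m h => (hin n m).trans (ha n m h))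
  have hnorm : ∀ G : Lp ℝ 2 M, ∫⁻ x, ENNReal.ofReal (G x ^ 2) ∂M = ENNReal.ofReal (‖G‖ ^ 2) := by
    intro G
    have hi : Integrable (fun x => G x ^ 2) M := (Lp.memLp G).integrable_sq
    rw [← ofReal_integral_eq_lintegral_ofReal hi (.of_forall fun x => sq_nonneg _),
      ← real_inner_self_eq_norm_sq, L2.inner_def]
    congr 2
    funext x
    simp [sq]
  have hAe : ∀ n : ℕ, ⇑((n : ℝ)⁻¹ • ∑ i ∈ Finset.range n, F i) =ᵐ[M]
      fun x => (n : ℝ)⁻¹ * ∑ i ∈ Finset.range n, f i x := by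
    intro n
    have h2 : ∀ s : Finset ℕ, ⇑(∑ i ∈ s, F i) =ᵐ[M] fun x => ∑ i ∈ s, f i x := by
      intro s
      induction s using Finset.induction_on with
      | empty =>
        simp only [Finset.sum_empty]
        exact Lp.coeFn_zero ℝ 2 M
      | insert i s his ih =>
        simp only [Finset.sum_insert his]
        filter_upwards [Lp.coeFn_add (F i) (∑ j ∈ s, F j), ih, (hf i).coeFn_toLp] with x h1 h2 h3
        rw [h1, Pi.add_apply, h2, ← h3]
    filter_upwards [Lp.coeFn_smul (n : ℝ)⁻¹ (∑ i ∈ Finset.range n, F i), h2 (Finset.range n)]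
      with x h1 h2
    rw [h1, Pi.smul_apply, h2, smul_eq_mul]
  have hdiff : ∀ G H : Lp ℝ 2 M, ∀ g h : α → ℝ, G =ᵐ[M] g → H =ᵐ[M] h →
      ∫⁻ x, ENNReal.ofReal ((g x - h x) ^ 2) ∂M = ENNReal.ofReal (‖G - H‖ ^ 2) := by
    intro G H g h hg hh
    rw [← hnorm]
    refine lintegral_congr_ae ?_
    filter_upwards [Lp.coeFn_sub G H, hg, hh] with x h1 h2 h3
    rw [h1, Pi.sub_apply, h2, h3]
  set A : ℕ → α → ℝ := fun n x => (n : ℝ)⁻¹ * ∑ i ∈ Finset.range n, f i x with hA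
  have hbound : ∀ n : ℕ, 1 ≤ n → ∫⁻ x, ENNReal.ofReal ((A n x - V x) ^ 2) ∂M
      ≤ ENNReal.ofReal ((b - a) * (n : ℝ)⁻¹) := by
    intro n hn
    rw [hdiff _ _ _ _ (hAe n) (ae_eq_refl _)]
    exact ENNReal.ofReal_le_ofReal (hV n hn)
  refine ⟨V, (Lp.stronglyMeasurable V).measurable, Lp.memLp V, ?_, b - a, hbound⟩
  have hba : 0 ≤ b - a := by
    have h := (sq_nonneg _).trans (hV 1 le_rfl)
    simpa using h
  have hAm : ∀ n, AEMeasurable (A n) M := fun n =>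
    (Lp.aestronglyMeasurable _).aemeasurable.congr (hAe n)
  have hVm : AEMeasurable V M := (Lp.aestronglyMeasurable _).aemeasurable
  -- Along the squares `(k+1)²` the mean square error is `O(k⁻²)`, which is summable.
  have hsq : ∀ᵐ x ∂M, Tendsto (fun k => A ((k + 1) ^ 2) x - V x) atTop (𝓝 0) := by
    refine ae_tendsto_zero_of_summable_sq (c := fun k : ℕ => (b - a) * (((k + 1 : ℕ) : ℝ) ^ 2)⁻¹)
      (fun n => (hAm _).sub hVm) ?_ (fun n => by positivity) (fun k => ?_)
    · refine Summable.mul_left _ ?_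
      exact (summable_nat_add_iff 1 (f := fun k : ℕ => ((k : ℝ) ^ 2)⁻¹)).2
        (Real.summable_nat_pow_inv.2 (by norm_num))
    · have := hbound ((k + 1) ^ 2) (Nat.one_le_pow _ _ (by omega))
      simpa using this
  -- Between squares, `N` is compared with `s²` for `s = ⌊√N⌋`. Since `N - s² ≤ 2s` and `√N ≤ 2s`,
  -- the difference `1/s² - 1/N` is at most `4 N^{-3/2}`, again summable.
  have hgap : ∀ᵐ x ∂M, Tendsto (fun n => A (n + 1) x - A (Nat.sqrt (n + 1) ^ 2) x) atTop (𝓝 0) := by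
    refine ae_tendsto_zero_of_summable_sq
      (c := fun n : ℕ => (b - a) * (4 * (((n + 1 : ℕ) : ℝ) ^ (3 / 2 : ℝ))⁻¹))
      (fun n => (hAm _).sub (hAm _)) ?_ (fun n => by positivity) (fun n => ?_)
    · refine (Summable.mul_left 4 ?_).mul_left _
      exact (summable_nat_add_iff 1 (f := fun k : ℕ => ((k : ℝ) ^ (3 / 2 : ℝ))⁻¹)).2
        (Real.summable_nat_rpow_inv.2 (by norm_num))
    · set N := n + 1 with hN
      set s := Nat.sqrt N with hs
      have hs1 : 1 ≤ s := by
        rw [hs, Nat.le_sqrt]; omega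
      have hsN : s ^ 2 ≤ N := by rw [sq]; exact Nat.sqrt_le N
      have hNs : N ≤ s ^ 2 + 2 * s := by
        have := Nat.sqrt_le_add N
        rw [← hs] at this
        rw [sq]; omega
      rw [hdiff _ _ _ _ (hAe N) (hAe (s ^ 2)), norm_average_sub_average_sq
        (fun n => (hin n n).trans (hb n)) (fun n m h => (hin n m).trans (ha n m h))
        (Nat.one_le_pow _ _ hs1) hsN]
      refine ENNReal.ofReal_le_ofReal (mul_le_mul_of_nonneg_left ?_ hba)
      have hS : (1 : ℝ) ≤ s := by exact_mod_cast hs1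
      have hS2 : (s : ℝ) ^ 2 ≤ N := by exact_mod_cast hsN
      have hN2 : (N : ℝ) ≤ (s : ℝ) ^ 2 + 2 * s := by exact_mod_cast hNs
      have hN0 : (0 : ℝ) < N := by positivity
      have hrt : √(N : ℝ) ≤ 2 * s := by
        rw [Real.sqrt_le_left (by positivity)]
        nlinarith
      have hpow : (N : ℝ) ^ (3 / 2 : ℝ) = N * √N := by
        rw [Real.sqrt_eq_rpow, show (3 / 2 : ℝ) = 1 + 1 / 2 by norm_num, Real.rpow_add hN0,
          Real.rpow_one]
      have hq : 0 < √(N : ℝ) := Real.sqrt_pos.2 hN0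
      rw [hpow]
      push_cast
      have e1 : ((s : ℝ) ^ 2)⁻¹ - (N : ℝ)⁻¹ = (N - s ^ 2) / (s ^ 2 * N) := by
        field_simp
      rw [e1, ← div_eq_mul_inv, div_le_div_iff₀ (by positivity) (by positivity)]
      calc ((N : ℝ) - s ^ 2) * (N * √N) ≤ (2 * s) * (N * (2 * s)) := by
            refine mul_le_mul (by linarith) (mul_le_mul_of_nonneg_left hrt hN0.le) (by positivity)
              (by positivity)
        _ = 4 * (s ^ 2 * N) := by ring
  filter_upwards [hsq, hgap] with x h1 h2
  rw [← tendsto_add_atTop_iff_nat 1]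
  have hsqrt : Tendsto (fun n : ℕ => Nat.sqrt (n + 1) - 1) atTop atTop := by
    refine tendsto_atTop.2 fun k => ?_
    filter_upwards [eventually_ge_atTop ((k + 1) * (k + 1))] with n hn
    have : k + 1 ≤ Nat.sqrt (n + 1) := Nat.le_sqrt.2 (by omega)
    omega
  have h3 := h1.comp hsqrt
  have h4 := (h2.add h3).add_const (V x)
  simp only [add_zero, zero_add] at h4
  refine h4.congr fun n => ?_
  have : Nat.sqrt (n + 1) - 1 + 1 = Nat.sqrt (n + 1) :=
    Nat.sub_add_cancel (Nat.le_sqrt.2 (by omega))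
  simp only [Function.comp_apply, this]
  ring

/-! ### Integrability along the evolution -/

/-- The conditions on the law of `(ξ, Q)` and on the function `ψ` that the law of large numbers for
the past increments requires, besides quasi-stationarity. -/
structure IsRegular (r : ℕ) (ψ : ℝ → ℝ) (μ : Measure Config) : Prop where
  isProbabilityMeasure : IsProbabilityMeasure μ
  ae_mem : ∀ᵐ p ∂μ, p ∈ overlapSpace
  ae_pos : ∀ᵐ p ∂μ, ∀ i, 0 < p.1 i
  forwardLaw_ne_zero : forwardLaw r μ ≠ 0
  measurable : Measurable ψ
  exp_moment : ∀ c : ℝ, ∫⁻ y, ENNReal.ofReal (Real.exp (c * |ψ y|)) ∂(gaussianReal 0 1) ≠ ⊤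

/-- A function with bounded derivative has exponential moments under the Gaussian law. -/
lemma lintegral_exp_abs_gaussianReal_ne_top {ψ : ℝ → ℝ} (hd : Differentiable ℝ ψ) {M : ℝ}
    (hM : ∀ x, |deriv ψ x| ≤ M) (c : ℝ) :
    ∫⁻ y, ENNReal.ofReal (Real.exp (c * |ψ y|)) ∂(gaussianReal 0 1) ≠ ⊤ := by
  have hlip : ∀ y, |ψ y| ≤ |ψ 0| + M * |y| := by
    intro y
    have h := Convex.norm_image_sub_le_of_norm_deriv_le (f := ψ) (s := Set.univ) (C := M) (x := 0)
      (y := y) (fun x _ => hd x) (fun x _ => hM x) convex_univ trivial trivial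
    simp only [Real.norm_eq_abs, sub_zero] at h
    have := abs_sub_abs_le_abs_sub (ψ y) (ψ 0)
    linarith
  have hi := (((integrable_exp_mul_gaussianReal (μ := 0) (v := 1) (|c| * M)).add
    (integrable_exp_mul_gaussianReal (μ := 0) (v := 1) (-(|c| * M)))).const_mul
      (Real.exp (|c| * |ψ 0|)))
  refine ne_top_of_le_ne_top hi.lintegral_lt_top.ne (lintegral_mono fun y => ?_)
  refine ENNReal.ofReal_le_ofReal ?_
  have h1 : c * |ψ y| ≤ |c| * |ψ 0| + |c| * M * |y| := by
    have h2 := mul_le_mul_of_nonneg_left (hlip y) (abs_nonneg c)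
    have h3 := mul_le_mul_of_nonneg_right (le_abs_self c) (abs_nonneg (ψ y))
    linarith
  refine (Real.exp_le_exp.2 h1).trans ?_
  rw [Real.exp_add]
  refine mul_le_mul_of_nonneg_left ?_ (Real.exp_pos _).le
  rcases abs_cases y with ⟨h, _⟩ | ⟨h, _⟩ <;> rw [h]
  · exact le_add_of_nonneg_right (Real.exp_pos _).le
  · rw [show |c| * M * -y = -(|c| * M) * y by ring]
    exact le_add_of_nonneg_left (Real.exp_pos _).le

/-- Positive weights of total mass one, with exponential moments of the increments at time `0`. -/
structure IsGood (ψ : ℝ → ℝ) (w : Config × (ℕ → ℕ → ℝ)) : Prop where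
  pos : ∀ j, 0 < w.1.1 j
  hasSum : HasSum w.1.1 1
  expSums : HasExpSums ψ w.1.1 (w.2 0)

lemma IsGood.summable_rawWeight_one {ψ : ℝ → ℝ} {w : Config × (ℕ → ℕ → ℝ)} (h : IsGood ψ w)
    (lam : ℝ) : Summable (rawWeight (fun x => lam * ψ x) 1 w) := by
  rw [funext (rawWeight_one _ w)]
  exact h.expSums.summable_exp (fun j => (h.pos j).le) lam

lemma rawWeight_pos {ψ : ℝ → ℝ} {w : Config × (ℕ → ℕ → ℝ)} (h : IsGood ψ w)
    (φ : ℝ → ℝ) (T : ℕ) (j : ℕ) : 0 < rawWeight φ T w j :=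
  mul_pos (h.pos j) (Real.exp_pos _)

lemma partition_zero {ψ : ℝ → ℝ} {w : Config × (ℕ → ℕ → ℝ)} (h : IsGood ψ w) (φ : ℝ → ℝ) :
    partition φ 0 w = 1 := by
  simpa [partition, rawWeight] using h.hasSum.tsum_eq

/-- Induction by peeling off the first step. The claim is made for all `w` because the induction
hypothesis is applied at the image point, whose orbit is the tail of that of `w`. -/
lemma summable_rawWeight_of_orbit {ψ : ℝ → ℝ} {lam : ℝ} (T : ℕ) :
    ∀ {w : Config × (ℕ → ℕ → ℝ)},
      (∀ n, IsGood ψ ((forwardStep fun x => lam * ψ x)^[n] w)) →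
      Summable (rawWeight (fun x => lam * ψ x) T w) ∧ 0 < partition (fun x => lam * ψ x) T w := by
  have aux : ∀ {T : ℕ} {w : Config × (ℕ → ℕ → ℝ)}, IsGood ψ w →
      Summable (rawWeight (fun x => lam * ψ x) T w) → 0 < partition (fun x => lam * ψ x) T w :=
    fun h hs => hs.tsum_pos (fun j => (rawWeight_pos h _ _ j).le) 0 (rawWeight_pos h _ _ 0)
  induction T with
  | zero =>
    intro w h
    have hs : Summable (rawWeight (fun x => lam * ψ x) 0 w) := by
      refine (h 0).hasSum.summable.congr fun j => ?_
      simp [rawWeight]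
    exact ⟨hs, aux (h 0) hs⟩
  | succ T ih =>
    intro w h
    have h' : ∀ n, IsGood ψ ((forwardStep fun x => lam * ψ x)^[n]
        (forwardStep (fun x => lam * ψ x) w)) := fun n => h (n + 1)
    have h1 : 0 < partition (fun x => lam * ψ x) 1 w :=
      aux (h 0) ((h 0).summable_rawWeight_one lam)
    have hs := summable_rawWeight_succ h1.ne' (ih h').1
    exact ⟨hs, aux (h 0) hs⟩

lemma integrable_comp_measurePreserving {α β : Type*} [MeasurableSpace α] [MeasurableSpace β]
    {m : Measure α} {m' : Measure β} {θ : α → β} (hθ : MeasurePreserving θ m m') {g : β → ℝ}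
    (hg : Measurable g) (hi : Integrable g m') :
    Integrable (fun x => g (θ x)) m ∧ ∫ x, g (θ x) ∂m = ∫ y, g y ∂m' := by
  refine ⟨(hθ.integrable_comp hg.aestronglyMeasurable).2 hi, ?_⟩
  rw [← hθ.map_eq, integral_map hθ.measurable.aemeasurable hg.aestronglyMeasurable]

/-! ### Moments and partition functions under the forward law -/

section Regular

variable {r : ℕ} {ψ : ℝ → ℝ} {μ : Measure Config}

lemma measurePreserving_fst_forwardLaw (hF : forwardLaw r μ ≠ 0) :
    MeasurePreserving Prod.fst (forwardLaw r μ) μ := by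
  refine ⟨measurable_fst, Measure.ext_of_lintegral _ fun g hg => ?_⟩
  rw [lintegral_map hg measurable_fst, lintegral_forwardLaw (g := fun w => g w.1) hF (by fun_prop)]
  simp

lemma IsRegular.lintegral_exp_ne_top (h : IsRegular r ψ μ) (c : ℝ) :
    ∫⁻ w, ∑' j, ENNReal.ofReal (w.1.1 j) * ENNReal.ofReal (Real.exp (c * |ψ (w.2 0 j)|))
      ∂(forwardLaw r μ) ≠ ⊤ := by
  have hψ := h.measurable
  have := h.isProbabilityMeasure
  rw [lintegral_forwardLaw_tsum (g := fun y => ENNReal.ofReal (Real.exp (c * |ψ y|)))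
    h.forwardLaw_ne_zero h.ae_mem (by fun_prop)]
  refine ENNReal.mul_ne_top ?_ (h.exp_moment c)
  refine ne_top_of_le_ne_top ENNReal.one_ne_top ?_
  calc ∫⁻ p, ∑' j, ENNReal.ofReal (p.1 j) ∂μ ≤ ∫⁻ p, 1 ∂μ := by
        refine lintegral_mono_ae ?_
        filter_upwards [h.ae_mem] with p hp
        rw [← ENNReal.ofReal_tsum_of_nonneg hp.2.1 hp.2.2.1]
        exact ENNReal.ofReal_le_one.2 hp.2.2.2.1
    _ = 1 := by simp

lemma IsRegular.ae_summable (h : IsRegular r ψ μ) : ∀ᵐ w ∂(forwardLaw r μ),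
    (∀ j, 0 < w.1.1 j) ∧ Summable w.1.1 ∧ HasExpSums ψ w.1.1 (w.2 0) := by
  have hψ := h.measurable
  have hfst := (measurePreserving_fst_forwardLaw h.forwardLaw_ne_zero).quasiMeasurePreserving
  have hc : ∀ᵐ w ∂(forwardLaw r μ), ∀ c : ℕ, ∑' j, ENNReal.ofReal (w.1.1 j) *
      ENNReal.ofReal (Real.exp (c * |ψ (w.2 0 j)|)) < ⊤ := by
    rw [ae_all_iff]
    intro c
    exact ae_lt_top (Measurable.tsum fun j => by fun_prop) (h.lintegral_exp_ne_top c)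
  filter_upwards [hfst.ae h.ae_mem, hfst.ae h.ae_pos, hc] with w h1 h2 h3
  refine ⟨h2, h1.2.2.1, fun c => ?_⟩
  obtain ⟨n, hn⟩ := exists_nat_ge c
  have h4 := ENNReal.summable_toReal (h3 n).ne
  refine Summable.of_nonneg_of_le (fun j => mul_nonneg (h2 j).le (Real.exp_pos _).le)
    (fun j => ?_) h4
  rw [ENNReal.toReal_mul, ENNReal.toReal_ofReal (h2 j).le, ENNReal.toReal_ofReal (Real.exp_pos _).le]
  exact mul_le_mul_of_nonneg_left
    (Real.exp_le_exp.2 (mul_le_mul_of_nonneg_right hn (abs_nonneg _))) (h2 j).le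

variable {lam : ℝ}

lemma IsRegular.measurePreserving_forwardStep (h : IsRegular r ψ μ)
    (hq : IsQuasiStationary r (fun x => lam * ψ x) μ) :
    MeasurePreserving (forwardStep fun x => lam * ψ x) (forwardLaw r μ) (forwardLaw r μ) :=
  have := h.isProbabilityMeasure
  CompetingParticles.measurePreserving_forwardStep h.forwardLaw_ne_zero h.ae_mem
    (h.measurable.const_mul lam) hq

/-- Total mass one is not assumed of an overlap structure. It holds because the weights after one
step are normalized and the law is invariant. -/
lemma IsRegular.ae_isGood (h : IsRegular r ψ μ)
    (hq : IsQuasiStationary r (fun x => lam * ψ x) μ) :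
    ∀ᵐ w ∂(forwardLaw r μ), IsGood ψ w := by
  have hmp := h.measurePreserving_forwardStep hq
  have hm : MeasurableSet {w : Config × (ℕ → ℕ → ℝ) | ∑' j, ENNReal.ofReal (w.1.1 j) = 1} :=
    (Measurable.tsum fun j => by fun_prop) (measurableSet_singleton (1 : ℝ≥0∞))
  have h1 : ∀ᵐ w ∂(forwardLaw r μ), ∑' j, ENNReal.ofReal (w.1.1 j) = 1 := by
    rw [← hmp.map_eq, ae_map_iff hmp.measurable.aemeasurable hm]
    filter_upwards [h.ae_summable] with w hw
    obtain ⟨hpos, -, hexp⟩ := hw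
    have hs : Summable (rawWeight (fun x => lam * ψ x) 1 w) := by
      rw [funext (rawWeight_one _ w)]
      exact hexp.summable_exp (fun j => (hpos j).le) lam
    have hp : ∀ j, 0 < rawWeight (fun x => lam * ψ x) 1 w j := fun j =>
      mul_pos (hpos j) (Real.exp_pos _)
    have hZ : 0 < partition (fun x => lam * ψ x) 1 w := hs.tsum_pos (fun j => (hp j).le) 0 (hp 0)
    have e : (forwardStep (fun x => lam * ψ x) w).1.1 = fun i =>
        rawWeight (fun x => lam * ψ x) 1 w
          (reshuffle (fun i => lam * ψ (w.2 0 i)) w.1 i) / partition (fun x => lam * ψ x) 1 w := by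
      funext i
      have := rawWeight_forwardStep (fun x => lam * ψ x) 0 w i
      simpa [rawWeight] using this
    rw [e, (reshuffle (fun i => lam * ψ (w.2 0 i)) w.1).tsum_eq (fun j => ENNReal.ofReal
      (rawWeight (fun x => lam * ψ x) 1 w j / partition (fun x => lam * ψ x) 1 w)),
      ← ENNReal.ofReal_tsum_of_nonneg (fun j => (div_pos (hp j) hZ).le) (hs.div_const _),
      tsum_div_const]
    change ENNReal.ofReal (partition _ 1 w / partition _ 1 w) = 1
    rw [div_self hZ.ne', ENNReal.ofReal_one]
  filter_upwards [h.ae_summable, h1] with w hw hw1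
  obtain ⟨hpos, hsum, hexp⟩ := hw
  refine ⟨hpos, ?_, hexp⟩
  rw [← ENNReal.ofReal_tsum_of_nonneg (fun j => (hpos j).le) hsum, ENNReal.ofReal_eq_one] at hw1
  exact hw1 ▸ hsum.hasSum

lemma IsRegular.ae_orbit (h : IsRegular r ψ μ)
    (hq : IsQuasiStationary r (fun x => lam * ψ x) μ) :
    ∀ᵐ w ∂(forwardLaw r μ), ∀ n, IsGood ψ ((forwardStep fun x => lam * ψ x)^[n] w) :=
  ae_all_iff.2 fun n =>
    ((h.measurePreserving_forwardStep hq).iterate n).quasiMeasurePreserving.ae (h.ae_isGood hq)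

lemma IsGood.abs_log_partition_one_le {w : Config × (ℕ → ℕ → ℝ)} (h : IsGood ψ w) (lam : ℝ) :
    |Real.log (partition (fun x => lam * ψ x) 1 w)|
      ≤ ∑' j, w.1.1 j * Real.exp (|lam| * |ψ (w.2 0 j)|) := by
  rw [partition, funext (rawWeight_one _ w)]
  exact abs_log_tsum_le (fun j => (h.pos j).le) h.hasSum h.expSums lam

lemma IsGood.ofReal_tsum_exp {w : Config × (ℕ → ℕ → ℝ)} (h : IsGood ψ w) (c : ℝ) :
    ENNReal.ofReal (∑' j, w.1.1 j * Real.exp (c * |ψ (w.2 0 j)|))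
      = ∑' j, ENNReal.ofReal (w.1.1 j) * ENNReal.ofReal (Real.exp (c * |ψ (w.2 0 j)|)) := by
  rw [ENNReal.ofReal_tsum_of_nonneg
    (fun j => mul_nonneg (h.pos j).le (Real.exp_pos _).le) (h.expSums c)]
  exact tsum_congr fun j => ENNReal.ofReal_mul (h.pos j).le

lemma IsRegular.integrable_log_partition_one (h : IsRegular r ψ μ)
    (hq : IsQuasiStationary r (fun x => lam * ψ x) μ) :
    Integrable (fun w => Real.log (partition (fun x => lam * ψ x) 1 w)) (forwardLaw r μ) := by
  refine ⟨(Real.measurable_log.comp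
    (measurable_partition (h.measurable.const_mul lam) 1)).aestronglyMeasurable, ?_⟩
  refine lt_of_le_of_lt (lintegral_mono_ae ?_) (h.lintegral_exp_ne_top |lam|).lt_top
  filter_upwards [h.ae_isGood hq] with w hw
  rw [← hw.ofReal_tsum_exp, ← ofReal_norm]
  exact ENNReal.ofReal_le_ofReal (hw.abs_log_partition_one_le lam)

/-- The mean of the logarithm of the partition function is proportional to the number of steps. -/
lemma IsRegular.integral_log_partition (h : IsRegular r ψ μ)
    (hq : IsQuasiStationary r (fun x => lam * ψ x) μ) (T : ℕ) :
    Integrable (fun w => Real.log (partition (fun x => lam * ψ x) T w)) (forwardLaw r μ) ∧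
      ∫ w, Real.log (partition (fun x => lam * ψ x) T w) ∂(forwardLaw r μ)
        = T * ∫ w, Real.log (partition (fun x => lam * ψ x) 1 w) ∂(forwardLaw r μ) := by
  have hmp := h.measurePreserving_forwardStep hq
  have h1 := h.integrable_log_partition_one hq
  induction T with
  | zero =>
    have h0 : (fun w => Real.log (partition (fun x => lam * ψ x) 0 w)) =ᵐ[forwardLaw r μ]
        fun _ => (0 : ℝ) := by
      filter_upwards [h.ae_isGood hq] with w hw
      rw [partition_zero hw, Real.log_one]
    exact ⟨(integrable_zero _ _ _).congr h0.symm, by rw [integral_congr_ae h0]; simp⟩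
  | succ T ih =>
    obtain ⟨hi, he⟩ := ih
    have hm : Measurable fun w => Real.log (partition (fun x => lam * ψ x) T w) :=
      Real.measurable_log.comp (measurable_partition (h.measurable.const_mul lam) T)
    -- The cocycle relation is split into logarithms, which needs both partition functions to be
    -- nonzero; invariance then evaluates the mean of the second term.
    have hs : (fun w => Real.log (partition (fun x => lam * ψ x) (T + 1) w)) =ᵐ[forwardLaw r μ]
        fun w => Real.log (partition (fun x => lam * ψ x) 1 w) +
          Real.log (partition (fun x => lam * ψ x) T (forwardStep (fun x => lam * ψ x) w)) := by
      filter_upwards [h.ae_orbit hq] with w hw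
      rw [partition_forwardStep, Real.log_div (summable_rawWeight_of_orbit _ hw).2.ne'
        (summable_rawWeight_of_orbit _ hw).2.ne']
      ring
    obtain ⟨hi', h2⟩ := integrable_comp_measurePreserving hmp hm hi
    refine ⟨(h1.add hi').congr hs.symm, ?_⟩
    rw [integral_congr_ae hs, integral_add h1 hi']
    rw [h2, he]
    push_cast
    ring

end Regular

/-! ### The past increments of a particle chosen according to the weights -/

/-- The law of a history together with a particle chosen according to the weights. -/
def tagged (P : Measure History) : Measure (History × ℕ) :=
  (P.prod Measure.count).withDensity fun q => ENNReal.ofReal (q.1.1.1 q.2)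

/-- The increment of a tagged particle at time `-(n + 1)`. -/
def past (n : ℕ) (q : History × ℕ) : ℝ := q.1.2 (-((n : ℤ) + 1)) q.2

@[fun_prop]
lemma measurable_past (n : ℕ) : Measurable (past n) := by
  refine measurable_from_prod_countable_left fun k => ?_
  change Measurable fun ω : History => ω.2 (-((n : ℤ) + 1)) k
  fun_prop

lemma measurable_tag_weight :
    Measurable fun q : History × ℕ => ENNReal.ofReal (q.1.1.1 q.2) := by
  refine measurable_from_prod_countable_left fun k => ?_
  change Measurable fun ω : History => ENNReal.ofReal (ω.1.1 k)
  fun_prop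

lemma lintegral_tagged (P : Measure History) [SFinite P] {g : History × ℕ → ℝ≥0∞}
    (hg : Measurable g) :
    ∫⁻ q, g q ∂(tagged P) = ∫⁻ ω, ∑' i, ENNReal.ofReal (ω.1.1 i) * g (ω, i) ∂P := by
  rw [tagged, lintegral_withDensity_eq_lintegral_mul _ measurable_tag_weight hg,
    lintegral_prod _ (measurable_tag_weight.mul hg).aemeasurable]
  refine lintegral_congr fun ω => ?_
  rw [lintegral_count]
  rfl

/-- Properties of almost every tagged particle hold for every particle, as the weights are
positive. -/
lemma ae_forall_of_ae_tagged {P : Measure History} [SFinite P] (hpos : ∀ᵐ ω ∂P, ∀ i, 0 < ω.1.1 i)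
    {p : History × ℕ → Prop} (hp : ∀ᵐ q ∂(tagged P), p q) : ∀ᵐ ω ∂P, ∀ i, p (ω, i) := by
  rw [tagged, ae_withDensity_iff measurable_tag_weight] at hp
  have h := Measure.ae_ae_of_ae_prod hp
  filter_upwards [h, hpos] with ω h1 h2 i
  rw [Measure.ae_count_iff] at h1
  exact h1 i (by simpa using h2 i)

/-! ### Exchangeability of the past of a tagged particle -/

section Stationary

variable {r : ℕ} {ψ : ℝ → ℝ} {μ : Measure Config} {lam : ℝ} {P : Measure History}

lemma IsStationaryExtension.measurePreserving_forward {φ : ℝ → ℝ}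
    (hP : IsStationaryExtension r φ μ P) : MeasurePreserving forward P (forwardLaw r μ) :=
  ⟨measurable_forward, hP.map_forward⟩

lemma IsStationaryExtension.forwardLaw_ne_zero {φ : ℝ → ℝ}
    (hP : IsStationaryExtension r φ μ P) : forwardLaw r μ ≠ 0 := by
  have := hP.isProbabilityMeasure
  rw [← hP.measurePreserving_forward.map_eq]
  have := Measure.isProbabilityMeasure_map (μ := P) measurable_forward.aemeasurable
  exact IsProbabilityMeasure.ne_zero _

lemma IsRegular.ae_orbit_history (h : IsRegular r ψ μ)
    (hq : IsQuasiStationary r (fun x => lam * ψ x) μ)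
    (hP : IsStationaryExtension r (fun x => lam * ψ x) μ P) :
    ∀ᵐ ω ∂P, ∀ n, IsGood ψ ((forwardStep fun x => lam * ψ x)^[n] (forward ω)) :=
  hP.measurePreserving_forward.quasiMeasurePreserving.ae (h.ae_orbit hq)

/-- The configuration at time `T`, with the increments between `0` and `T`, up to the labels of the
particles. -/
lemma exists_perm_past {ω : History}
    (hω : ∀ n, IsGood ψ ((forwardStep fun x => lam * ψ x)^[n] (forward ω))) (T : ℕ) :
    ∃ π : Equiv.Perm ℕ, ∀ i,
      (((timeStep fun x => lam * ψ x)^[T] ω).1.1 i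
        = rawWeight (fun x => lam * ψ x) T (forward ω) (π i)
          / partition (fun x => lam * ψ x) T (forward ω)) ∧
      ∀ n < T, ((timeStep fun x => lam * ψ x)^[T] ω).2 (-((n : ℤ) + 1)) i
        = (forward ω).2 (T - 1 - n) (π i) := by
  obtain ⟨π, h1, h2⟩ := exists_perm_timeStep_iterate (fun x => lam * ψ x) ω
    (partition_zero (hω 0) _) (fun T => (summable_rawWeight_of_orbit T hω).2.ne') T
  refine ⟨π, fun i => ⟨h1 i, fun n hn => ?_⟩⟩
  have e : -((n : ℤ) + 1) + T = ((T - 1 - n : ℕ) : ℤ) := by omega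
  rw [h2, e]
  rfl

/-- By invariance the integrand may be evaluated at `Λ^T ω`, where the past becomes the forward
increments in reverse order. A sum over all the particles does not see the permutation of labels. -/
lemma IsRegular.lintegral_tsum_past (h : IsRegular r ψ μ)
    (hq : IsQuasiStationary r (fun x => lam * ψ x) μ)
    (hP : IsStationaryExtension r (fun x => lam * ψ x) μ P) {T n m : ℕ} (hn : n < T) (hm : m < T)
    {G : ℝ × ℝ × ℝ → ℝ≥0∞} (hG : Measurable G) :
    ∫⁻ ω, ∑' i, G (ω.1.1 i, past n (ω, i), past m (ω, i)) ∂P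
      = ∫⁻ w, ∑' j, G (rawWeight (fun x => lam * ψ x) T w j / partition (fun x => lam * ψ x) T w,
          w.2 (T - 1 - n) j, w.2 (T - 1 - m) j) ∂(forwardLaw r μ) := by
  have hψ := h.measurable
  have hφ : Measurable fun x => lam * ψ x := hψ.const_mul lam
  have hmp := hP.invariant.iterate T
  have hL : Measurable fun ω : History => ∑' i, G (ω.1.1 i, past n (ω, i), past m (ω, i)) := by
    exact Measurable.tsum fun i => by fun_prop
  have hR : Measurable fun w : Config × (ℕ → ℕ → ℝ) => ∑' j,
      G (rawWeight (fun x => lam * ψ x) T w j / partition (fun x => lam * ψ x) T w,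
          w.2 (T - 1 - n) j, w.2 (T - 1 - m) j) := by
    refine Measurable.tsum fun j => hG.comp (Measurable.prodMk ?_ (by fun_prop))
    exact (measurable_rawWeight hφ T j).div (measurable_partition hφ T)
  rw [← hmp.lintegral_comp hL, ← hP.measurePreserving_forward.lintegral_comp hR]
  refine lintegral_congr_ae ?_
  filter_upwards [h.ae_orbit_history hq hP] with ω hω
  obtain ⟨π, hπ⟩ := exists_perm_past hω T
  conv_rhs => rw [← π.tsum_eq]
  refine tsum_congr fun i => ?_
  simp only [past]
  rw [(hπ i).1, (hπ i).2 n hn, (hπ i).2 m hm]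

lemma rawWeight_permute_time (φ : ℝ → ℝ) {T a b : ℕ} (ha : a < T) (hb : b < T)
    (w : Config × (ℕ → ℕ → ℝ)) (j : ℕ) :
    rawWeight φ T (w.1, fun t => w.2 (Equiv.swap a b t)) j = rawWeight φ T w j := by
  simp only [rawWeight]
  congr 2
  refine Finset.sum_equiv (Equiv.swap a b) (fun t => ?_) (fun t _ => rfl)
  simp only [Finset.mem_range, Equiv.swap_apply_def]
  split_ifs <;> omega

/-- In the forward picture the weights are symmetric in the first `T` times and the fields are
conditionally i.i.d., so two times may be exchanged. -/
lemma IsRegular.lintegral_tsum_past_swap (h : IsRegular r ψ μ)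
    (hq : IsQuasiStationary r (fun x => lam * ψ x) μ)
    (hP : IsStationaryExtension r (fun x => lam * ψ x) μ P) (a b n m : ℕ)
    {G : ℝ × ℝ × ℝ → ℝ≥0∞} (hG : Measurable G) :
    ∫⁻ ω, ∑' i, G (ω.1.1 i, past (Equiv.swap a b n) (ω, i), past (Equiv.swap a b m) (ω, i)) ∂P
      = ∫⁻ ω, ∑' i, G (ω.1.1 i, past n (ω, i), past m (ω, i)) ∂P := by
  have hφ : Measurable fun x => lam * ψ x := h.measurable.const_mul lam
  -- The window contains all four indices. The time reversal `k ↦ T - 1 - k` conjugates the given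
  -- transposition to one of forward times.
  set T := a + b + n + m + 1 with hT
  have hs : ∀ k < T, Equiv.swap a b k < T := by
    intro k hk
    rw [Equiv.swap_apply_def]
    split_ifs <;> omega
  have hc : ∀ k < T, T - 1 - Equiv.swap a b k = Equiv.swap (T - 1 - a) (T - 1 - b) (T - 1 - k) := by
    intro k hk
    simp only [Equiv.swap_apply_def]
    split_ifs <;> omega
  rw [h.lintegral_tsum_past hq hP (T := T) (n := n) (m := m) (by omega) (by omega) hG,
    h.lintegral_tsum_past hq hP (T := T) (hs n (by omega)) (hs m (by omega)) hG,
    hc n (by omega), hc m (by omega)]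
  have hR : Measurable fun w : Config × (ℕ → ℕ → ℝ) => ∑' j,
      G (rawWeight (fun x => lam * ψ x) T w j / partition (fun x => lam * ψ x) T w,
          w.2 (T - 1 - n) j, w.2 (T - 1 - m) j) := by
    refine Measurable.tsum fun j => hG.comp (Measurable.prodMk ?_ (by fun_prop))
    exact (measurable_rawWeight hφ T j).div (measurable_partition hφ T)
  rw [← (measurePreserving_permute_time h.forwardLaw_ne_zero
    (Equiv.swap (T - 1 - a) (T - 1 - b))).lintegral_comp hR]
  simp only [partition, rawWeight_permute_time _ (show T - 1 - a < T by omega)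
    (show T - 1 - b < T by omega)]

lemma IsRegular.map_past_swap (h : IsRegular r ψ μ)
    (hq : IsQuasiStationary r (fun x => lam * ψ x) μ)
    (hP : IsStationaryExtension r (fun x => lam * ψ x) μ P) (a b n m : ℕ) :
    (tagged P).map (fun q => (past (Equiv.swap a b n) q, past (Equiv.swap a b m) q))
      = (tagged P).map (fun q => (past n q, past m q)) := by
  have := hP.isProbabilityMeasure
  have hm : ∀ k l, Measurable fun q => (past k q, past l q) := fun k l =>
    (measurable_past k).prodMk (measurable_past l)
  refine Measure.ext_of_lintegral _ fun g hg => ?_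
  rw [lintegral_map hg (hm _ _), lintegral_map hg (hm _ _),
    lintegral_tagged P (g := fun q => g (past (Equiv.swap a b n) q, past (Equiv.swap a b m) q))
      (by fun_prop), lintegral_tagged P (g := fun q => g (past n q, past m q)) (by fun_prop)]
  exact h.lintegral_tsum_past_swap hq hP a b n m
    (G := fun x => ENNReal.ofReal x.1 * g (x.2.1, x.2.2)) (by fun_prop)

/-- The past increments of a tagged particle are identically distributed. -/
lemma IsRegular.map_past (h : IsRegular r ψ μ)
    (hq : IsQuasiStationary r (fun x => lam * ψ x) μ)
    (hP : IsStationaryExtension r (fun x => lam * ψ x) μ P) (n : ℕ) :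
    (tagged P).map (past n) = (tagged P).map (past 0) := by
  have h1 := congrArg (Measure.map Prod.fst) (h.map_past_swap hq hP n 0 0 0)
  rw [Measure.map_map measurable_fst ((measurable_past _).prodMk (measurable_past _)),
    Measure.map_map measurable_fst ((measurable_past _).prodMk (measurable_past _)),
    Equiv.swap_apply_right] at h1
  exact h1

/-- The pairs of distinct past increments of a tagged particle are identically distributed. -/
lemma IsRegular.map_past_pair (h : IsRegular r ψ μ)
    (hq : IsQuasiStationary r (fun x => lam * ψ x) μ)
    (hP : IsStationaryExtension r (fun x => lam * ψ x) μ P) {n m : ℕ} (hnm : n ≠ m) :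
    (tagged P).map (fun q => (past n q, past m q))
      = (tagged P).map (fun q => (past 0 q, past 1 q)) := by
  have h1 := h.map_past_swap hq hP n 0 n m
  rw [Equiv.swap_apply_left] at h1
  -- A first transposition carries `(n, m)` to `(0, m')` with `m' ≠ 0`, and a second one carries
  -- `(0, m')` to `(0, 1)`.
  set m' := Equiv.swap n 0 m with hm'
  have h0 : m' ≠ 0 := by
    rw [hm', Equiv.swap_apply_def]
    split_ifs <;> omega
  have h2 := h.map_past_swap hq hP m' 1 0 m'
  rw [Equiv.swap_apply_left, Equiv.swap_apply_of_ne_of_ne h0.symm (by norm_num)] at h2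
  rw [← h1, ← h2]

lemma IsRegular.isProbabilityMeasure_tagged (h : IsRegular r ψ μ)
    (hq : IsQuasiStationary r (fun x => lam * ψ x) μ)
    (hP : IsStationaryExtension r (fun x => lam * ψ x) μ P) :
    IsProbabilityMeasure (tagged P) := by
  have := hP.isProbabilityMeasure
  constructor
  rw [← lintegral_one, lintegral_tagged P measurable_const]
  have : ∀ᵐ ω ∂P, ∑' i, ENNReal.ofReal (ω.1.1 i) * 1 = 1 := by
    filter_upwards [h.ae_orbit_history hq hP] with ω hω
    have hpos : ∀ j, 0 < ω.1.1 j := (hω 0).pos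
    have hsum : HasSum ω.1.1 1 := (hω 0).hasSum
    simp only [mul_one]
    rw [← ENNReal.ofReal_tsum_of_nonneg (fun j => (hpos j).le) hsum.summable,
      hsum.tsum_eq, ENNReal.ofReal_one]
  rw [lintegral_congr_ae this]
  simp

/-- Pulled back by one step, the weights become the tilted weights of the current increments, whose
moments are bounded by `tsum_exp_div_le`. -/
lemma IsRegular.lintegral_exp_past_ne_top (h : IsRegular r ψ μ)
    (hq : IsQuasiStationary r (fun x => lam * ψ x) μ)
    (hP : IsStationaryExtension r (fun x => lam * ψ x) μ P) (c : ℝ) :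
    ∫⁻ ω, ∑' i, ENNReal.ofReal (ω.1.1 i) *
      ENNReal.ofReal (Real.exp (c * |ψ (past 0 (ω, i))|)) ∂P ≠ ⊤ := by
  have hψ := h.measurable
  rw [h.lintegral_tsum_past hq hP (T := 1) (n := 0) (m := 0) one_pos one_pos
    (G := fun x => ENNReal.ofReal x.1 * ENNReal.ofReal (Real.exp (c * |ψ x.2.1|))) (by fun_prop)]
  refine ne_top_of_le_ne_top (h.lintegral_exp_ne_top (2 * (|lam| + |c|))) (lintegral_mono_ae ?_)
  filter_upwards [h.ae_isGood hq] with w hw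
  obtain ⟨h1, h2⟩ := tsum_exp_div_le (fun j => (hw.pos j).le) hw.hasSum hw.expSums lam c
  rw [← hw.ofReal_tsum_exp]
  refine le_trans (le_of_eq ?_) (ENNReal.ofReal_le_ofReal h2)
  have hZ : 0 ≤ ∑' k, w.1.1 k * Real.exp (lam * ψ (w.2 0 k)) :=
    tsum_nonneg fun k => mul_nonneg (hw.pos k).le (Real.exp_pos _).le
  have hnn : ∀ j, 0 ≤ w.1.1 j * Real.exp (lam * ψ (w.2 0 j))
      / ∑' k, w.1.1 k * Real.exp (lam * ψ (w.2 0 k)) := fun j =>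
    div_nonneg (mul_nonneg (hw.pos j).le (Real.exp_pos _).le) hZ
  rw [ENNReal.ofReal_tsum_of_nonneg (fun j => mul_nonneg (hnn j) (Real.exp_pos _).le) h1]
  refine tsum_congr fun j => ?_
  rw [ENNReal.ofReal_mul (hnn j)]
  simp only [partition, rawWeight_one]

lemma IsRegular.ae_hasExpSums_past (h : IsRegular r ψ μ)
    (hq : IsQuasiStationary r (fun x => lam * ψ x) μ)
    (hP : IsStationaryExtension r (fun x => lam * ψ x) μ P) :
    ∀ᵐ ω ∂P, HasExpSums ψ ω.1.1 fun i => past 0 (ω, i) := by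
  have hψ := h.measurable
  have hc : ∀ᵐ ω ∂P, ∀ c : ℕ, ∑' i, ENNReal.ofReal (ω.1.1 i) *
      ENNReal.ofReal (Real.exp (c * |ψ (past 0 (ω, i))|)) < ⊤ := by
    rw [ae_all_iff]
    intro c
    exact ae_lt_top (Measurable.tsum fun j => by fun_prop) (h.lintegral_exp_past_ne_top hq hP c)
  filter_upwards [h.ae_orbit_history hq hP, hc] with ω hω h3 c
  have h2 : ∀ i, 0 < ω.1.1 i := (hω 0).pos
  obtain ⟨n, hn⟩ := exists_nat_ge c
  have h4 := ENNReal.summable_toReal (h3 n).ne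
  refine Summable.of_nonneg_of_le (fun j => mul_nonneg (h2 j).le (Real.exp_pos _).le)
    (fun j => ?_) h4
  rw [ENNReal.toReal_mul, ENNReal.toReal_ofReal (h2 j).le, ENNReal.toReal_ofReal (Real.exp_pos _).le]
  exact mul_le_mul_of_nonneg_left
    (Real.exp_le_exp.2 (mul_le_mul_of_nonneg_right hn (abs_nonneg _))) (h2 j).le

lemma sq_le_two_mul_exp_abs (x : ℝ) : x ^ 2 ≤ 2 * Real.exp (2 * |x|) := by
  have h1 := Real.quadratic_le_exp_of_nonneg (abs_nonneg x)
  have h2 : Real.exp |x| ≤ Real.exp (2 * |x|) := Real.exp_le_exp.2 (by linarith [abs_nonneg x])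
  have h3 := sq_abs x
  nlinarith [abs_nonneg x]

/-- The last increment is square integrable by its exponential moments; the earlier ones have the
same law. -/
lemma IsRegular.memLp_past (h : IsRegular r ψ μ)
    (hq : IsQuasiStationary r (fun x => lam * ψ x) μ)
    (hP : IsStationaryExtension r (fun x => lam * ψ x) μ P) (n : ℕ) :
    MemLp (fun q => ψ (past n q)) 2 (tagged P) := by
  have := hP.isProbabilityMeasure
  have hψ := h.measurable
  have h0 : MemLp (fun q => ψ (past 0 q)) 2 (tagged P) := by
    have hm : Measurable fun q => ψ (past 0 q) := hψ.comp (measurable_past 0)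
    rw [memLp_two_iff_integrable_sq hm.aestronglyMeasurable]
    refine ⟨(hm.pow_const 2).aestronglyMeasurable, ?_⟩
    have hlt : ∫⁻ q, 2 * ENNReal.ofReal (Real.exp (2 * |ψ (past 0 q)|)) ∂(tagged P) < ⊤ := by
      have hm2 : Measurable fun q => ENNReal.ofReal (Real.exp (2 * |ψ (past 0 q)|)) := by
        have : Measurable fun x : ℝ => ENNReal.ofReal (Real.exp (2 * |x|)) := by fun_prop
        exact this.comp hm
      rw [lintegral_const_mul _ hm2, lintegral_tagged P hm2]
      exact ENNReal.mul_lt_top (by norm_num) (h.lintegral_exp_past_ne_top hq hP 2).lt_top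
    refine lt_of_le_of_lt (lintegral_mono fun q => ?_) hlt
    rw [← ofReal_norm, Real.norm_of_nonneg (sq_nonneg _),
      show (2 : ℝ≥0∞) = ENNReal.ofReal 2 by simp, ← ENNReal.ofReal_mul (by norm_num)]
    exact ENNReal.ofReal_le_ofReal (sq_le_two_mul_exp_abs _)
  have h1 : MemLp ψ 2 ((tagged P).map (past 0)) :=
    (memLp_map_measure_iff hψ.aestronglyMeasurable (measurable_past 0).aemeasurable).2 h0
  rw [← h.map_past hq hP n] at h1
  exact (memLp_map_measure_iff hψ.aestronglyMeasurable (measurable_past n).aemeasurable).1 h1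

/-- The past averages of the increments of a tagged particle converge. -/
lemma IsRegular.exists_ae_tendsto_past (h : IsRegular r ψ μ)
    (hq : IsQuasiStationary r (fun x => lam * ψ x) μ)
    (hP : IsStationaryExtension r (fun x => lam * ψ x) μ P) :
    ∃ v : History × ℕ → ℝ, Measurable v ∧ MemLp v 2 (tagged P) ∧
      (∀ᵐ q ∂(tagged P), Tendsto
        (fun n : ℕ => (n : ℝ)⁻¹ * ∑ i ∈ Finset.range n, ψ (past i q)) atTop (𝓝 (v q))) ∧
      ∃ C : ℝ, ∀ n : ℕ, 1 ≤ n →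
        ∫⁻ q, ENNReal.ofReal (((n : ℝ)⁻¹ * ∑ i ∈ Finset.range n, ψ (past i q) - v q) ^ 2)
          ∂(tagged P) ≤ ENNReal.ofReal (C * (n : ℝ)⁻¹) := by
  have hψ := h.measurable
  have hm2 : ∀ n m, Measurable fun q => (past n q, past m q) := fun n m =>
    (measurable_past n).prodMk (measurable_past m)
  have hg : Measurable fun x : ℝ × ℝ => ψ x.1 * ψ x.2 := by fun_prop
  have hint : ∀ n m, ∫ q, ψ (past n q) * ψ (past m q) ∂(tagged P)
      = ∫ x, ψ x.1 * ψ x.2 ∂((tagged P).map fun q => (past n q, past m q)) := fun n m => by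
    rw [integral_map (hm2 n m).aemeasurable hg.aestronglyMeasurable]
  refine exists_ae_tendsto_average (f := fun n q => ψ (past n q)) (h.memLp_past hq hP)
    (a := ∫ q, ψ (past 0 q) * ψ (past 1 q) ∂(tagged P))
    (b := ∫ q, ψ (past 0 q) * ψ (past 0 q) ∂(tagged P)) (fun n => ?_) (fun n m hnm => ?_)
  · have hg1 : Measurable fun x => ψ x * ψ x := hψ.mul hψ
    have h1 : ∀ k, ∫ q, ψ (past k q) * ψ (past k q) ∂(tagged P)
        = ∫ x, ψ x * ψ x ∂((tagged P).map (past k)) := fun k => by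
      rw [integral_map (measurable_past k).aemeasurable hg1.aestronglyMeasurable]
    rw [h1, h1, h.map_past hq hP n]
  · rw [hint, hint, h.map_past_pair hq hP hnm]

end Stationary

/-! ### The past velocities of all the particles coincide -/

/-- The sum `∑_i ξ_i e^{ε (ψ(κ_i(-1)) + ⋯ + ψ(κ_i(-T)))}`. -/
def pastPartition (ψ : ℝ → ℝ) (ε : ℝ) (T : ℕ) (ω : History) : ℝ :=
  ∑' i, ω.1.1 i * Real.exp (ε * ∑ n ∈ Finset.range T, ψ (past n (ω, i)))

lemma measurable_pastPartition {ψ : ℝ → ℝ} (hψ : Measurable ψ) (ε : ℝ) (T : ℕ) :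
    Measurable (pastPartition ψ ε T) :=
  Measurable.tsum fun i => by fun_prop

/-- Each sum dominates any one of its terms: the term `i` is kept in the first sum and the term `j`
in the second. Jensen for `x` and `-x` gives nonnegativity. -/
lemma log_tsum_exp_add_log_tsum_exp_neg {ξ x : ℕ → ℝ} (hξ : ∀ i, 0 < ξ i) (h1 : HasSum ξ 1)
    (he : Summable fun i => ξ i * Real.exp (x i)) (he' : Summable fun i => ξ i * Real.exp (-x i)) :
    0 ≤ Real.log (∑' i, ξ i * Real.exp (x i)) + Real.log (∑' i, ξ i * Real.exp (-x i)) ∧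
      ∀ i j, Real.log (ξ i) + x i + (Real.log (ξ j) - x j) ≤
        Real.log (∑' i, ξ i * Real.exp (x i)) + Real.log (∑' i, ξ i * Real.exp (-x i)) := by
  have hx : Summable fun i => ξ i * x i := by
    refine Summable.of_norm_bounded (he.add he') fun i => ?_
    rw [norm_mul, Real.norm_eq_abs, abs_of_pos (hξ i), Real.norm_eq_abs, ← mul_add]
    refine mul_le_mul_of_nonneg_left ?_ (hξ i).le
    have e1 := Real.add_one_le_exp (x i)
    have e2 := Real.add_one_le_exp (-x i)
    have e3 := Real.exp_pos (x i)
    have e4 := Real.exp_pos (-x i)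
    rw [abs_le]
    constructor <;> linarith
  have hx' : Summable fun i => ξ i * -x i := by simpa using hx.neg
  obtain ⟨-, h2⟩ := tsum_mul_le_log_tsum_mul_exp (fun i => (hξ i).le) h1 hx he
  obtain ⟨-, h3⟩ := tsum_mul_le_log_tsum_mul_exp (fun i => (hξ i).le) h1 hx' he'
  have h4 : ∑' i, ξ i * -x i = -∑' i, ξ i * x i := by
    rw [← tsum_neg]; exact tsum_congr fun i => by ring
  refine ⟨by linarith, fun i j => ?_⟩
  have key : ∀ {y : ℕ → ℝ} (i : ℕ), (Summable fun i => ξ i * Real.exp (y i)) →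
      Real.log (ξ i) + y i ≤ Real.log (∑' i, ξ i * Real.exp (y i)) := by
    intro y i hy
    rw [← Real.log_exp (y i), ← Real.log_mul (hξ i).ne' (Real.exp_pos _).ne']
    exact Real.log_le_log (mul_pos (hξ i) (Real.exp_pos _))
      (hy.le_tsum i fun k _ => (mul_pos (hξ k) (Real.exp_pos _)).le)
  have e1 := key i he
  have e2 := key (y := fun i => -x i) j he'
  linarith

/-- For `y = |x|` the left side is `e^y (1 - e^{-y})²`, and `1 - e^{-y} ≤ y`. -/
lemma exp_add_exp_neg_sub_two_le (x : ℝ) :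
    Real.exp x + Real.exp (-x) - 2 ≤ x ^ 2 * Real.exp |x| := by
  have key : ∀ y : ℝ, 0 ≤ y → Real.exp y + Real.exp (-y) - 2 ≤ y ^ 2 * Real.exp y := by
    intro y hy
    have h1 : 1 - y ≤ Real.exp (-y) := by linarith [Real.add_one_le_exp (-y)]
    have h2 : Real.exp (-y) ≤ 1 := Real.exp_le_one_iff.2 (by linarith)
    have h3 : Real.exp y * Real.exp (-y) = 1 := by rw [← Real.exp_add]; simp
    have h4 : (1 - Real.exp (-y)) ^ 2 ≤ y ^ 2 := by
      apply pow_le_pow_left₀ <;> linarith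
    have h5 := mul_le_mul_of_nonneg_left h4 (Real.exp_pos y).le
    have h6 : Real.exp y * (1 - Real.exp (-y)) ^ 2 = Real.exp y + Real.exp (-y) - 2 := by
      calc Real.exp y * (1 - Real.exp (-y)) ^ 2
          = Real.exp y - 2 * (Real.exp y * Real.exp (-y))
            + (Real.exp y * Real.exp (-y)) * Real.exp (-y) := by ring
        _ = _ := by rw [h3]; ring
    linarith
  rcases abs_cases x with ⟨h, h0⟩ | ⟨h, h0⟩
  · rw [h]; exact key x h0
  · rw [h]
    have := key (-x) (by linarith)
    rw [neg_neg] at this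
    have e : (-x) ^ 2 = x ^ 2 := by ring
    rw [e] at this
    linarith

/-- The first order terms in `ε` cancel between the two signs; `log z ≤ z - 1` leaves the second
order term `e^x + e^{-x} - 2`. -/
lemma log_add_log_le_sq_mul {ψ : ℝ → ℝ} {ξ κ : ℕ → ℝ} (hξ : ∀ i, 0 < ξ i) (h1 : HasSum ξ 1)
    (h : HasExpSums ψ ξ κ) {ε : ℝ} (hε : |ε| ≤ 1) :
    Real.log (∑' i, ξ i * Real.exp (ε * ψ (κ i))) + Real.log (∑' i, ξ i * Real.exp (-ε * ψ (κ i)))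
      ≤ 2 * ε ^ 2 * ∑' i, ξ i * Real.exp (2 * |ψ (κ i)|) := by
  have hpos : ∀ c : ℝ, 0 < ∑' i, ξ i * Real.exp (c * ψ (κ i)) := fun c =>
    (h.summable_exp (fun j => (hξ j).le) c).tsum_pos
      (fun j => (mul_pos (hξ j) (Real.exp_pos _)).le) 0 (mul_pos (hξ 0) (Real.exp_pos _))
  have e1 := Real.log_le_sub_one_of_pos (hpos ε)
  have e2 := Real.log_le_sub_one_of_pos (hpos (-ε))
  have hs := ((h.summable_exp (fun j => (hξ j).le) ε).hasSum.add
    (h.summable_exp (fun j => (hξ j).le) (-ε)).hasSum).sub (h1.mul_left 2)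
  have hle := hasSum_le (fun i => ?_) hs ((h 2).hasSum.mul_left (2 * ε ^ 2))
  · linarith
  · have h3 := exp_add_exp_neg_sub_two_le (ε * ψ (κ i))
    have h4 : Real.exp |ε * ψ (κ i)| ≤ Real.exp |ψ (κ i)| := by
      refine Real.exp_le_exp.2 ?_
      rw [abs_mul]
      exact mul_le_of_le_one_left (abs_nonneg _) hε
    have h5 := Real.quadratic_le_exp_of_nonneg (abs_nonneg (ψ (κ i)))
    have h6 : ψ (κ i) ^ 2 ≤ 2 * Real.exp |ψ (κ i)| := by
      nlinarith [sq_abs (ψ (κ i)), abs_nonneg (ψ (κ i))]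
    have h7 : (ε * ψ (κ i)) ^ 2 * Real.exp |ε * ψ (κ i)|
        ≤ 2 * ε ^ 2 * Real.exp (2 * |ψ (κ i)|) := by
      calc (ε * ψ (κ i)) ^ 2 * Real.exp |ε * ψ (κ i)|
          ≤ (ε * ψ (κ i)) ^ 2 * Real.exp |ψ (κ i)| :=
            mul_le_mul_of_nonneg_left h4 (sq_nonneg _)
        _ = ε ^ 2 * (ψ (κ i) ^ 2 * Real.exp |ψ (κ i)|) := by ring
        _ ≤ ε ^ 2 * ((2 * Real.exp |ψ (κ i)|) * Real.exp |ψ (κ i)|) := by gcongr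
        _ = _ := by rw [two_mul |ψ (κ i)|, Real.exp_add]; ring
    have h8 := mul_le_mul_of_nonneg_left (h3.trans h7) (hξ i).le
    rw [show -ε * ψ (κ i) = -(ε * ψ (κ i)) by ring]
    linarith

/-! ### Comparison of the velocities by perturbing `λ` -/

section Velocity

variable {r : ℕ} {ψ : ℝ → ℝ} {μ : Measure Config} {lam : ℝ} {P : Measure History}

lemma exists_perm_pastPartition {ω : History}
    (hω : ∀ n, IsGood ψ ((forwardStep fun x => lam * ψ x)^[n] (forward ω))) (ε : ℝ) (T : ℕ) :
    ∃ π : Equiv.Perm ℕ, ∀ i, ((timeStep fun x => lam * ψ x)^[T] ω).1.1 i *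
        Real.exp (ε * ∑ n ∈ Finset.range T, ψ (past n ((timeStep fun x => lam * ψ x)^[T] ω, i)))
      = rawWeight (fun x => (lam + ε) * ψ x) T (forward ω) (π i)
          / partition (fun x => lam * ψ x) T (forward ω) := by
  obtain ⟨π, hπ⟩ := exists_perm_past hω T
  refine ⟨π, fun i => ?_⟩
  have hs : ∑ n ∈ Finset.range T, ψ (past n ((timeStep fun x => lam * ψ x)^[T] ω, i))
      = ∑ t ∈ Finset.range T, ψ ((forward ω).2 t (π i)) := by
    rw [← Finset.sum_range_reflect (fun t => ψ ((forward ω).2 t (π i)))]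
    refine Finset.sum_congr rfl fun n hn => ?_
    rw [← (hπ i).2 n (Finset.mem_range.1 hn)]
    rfl
  rw [hs, (hπ i).1]
  simp only [rawWeight]
  rw [← Finset.mul_sum, ← Finset.mul_sum, add_mul, Real.exp_add]
  ring

/-- Weighting the past by `e^{ε S}` shifts `λ` to `λ + ε` in the forward picture. This is where
quasi-stationarity at the neighbouring parameters enters. -/
lemma pastPartition_iterate {ω : History}
    (hω : ∀ n, IsGood ψ ((forwardStep fun x => lam * ψ x)^[n] (forward ω))) (ε : ℝ) (T : ℕ) :
    pastPartition ψ ε T ((timeStep fun x => lam * ψ x)^[T] ω)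
      = partition (fun x => (lam + ε) * ψ x) T (forward ω)
          / partition (fun x => lam * ψ x) T (forward ω) := by
  obtain ⟨π, hπ⟩ := exists_perm_pastPartition hω ε T
  rw [pastPartition, funext hπ, π.tsum_eq (fun j => rawWeight (fun x => (lam + ε) * ψ x) T
    (forward ω) j / partition (fun x => lam * ψ x) T (forward ω)), tsum_div_const]
  rfl

/-- After `T` steps these terms are, up to order, the normalized raw weights for the parameter `lam
+ ε`, which are summable by quasi-stationarity for that parameter. -/
lemma IsRegular.ae_summable_exp_past (h : IsRegular r ψ μ)
    (hq : IsQuasiStationary r (fun x => lam * ψ x) μ)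
    (hP : IsStationaryExtension r (fun x => lam * ψ x) μ P) {ε : ℝ}
    (hq' : IsQuasiStationary r (fun x => (lam + ε) * ψ x) μ) (T : ℕ) :
    ∀ᵐ ω ∂P, Summable fun i =>
      ω.1.1 i * Real.exp (ε * ∑ n ∈ Finset.range T, ψ (past n (ω, i))) := by
  have hψ := h.measurable
  have hmp := hP.invariant.iterate T
  have hm : MeasurableSet {ω : History | ∑' i, ENNReal.ofReal
      (ω.1.1 i * Real.exp (ε * ∑ n ∈ Finset.range T, ψ (past n (ω, i)))) < ⊤} :=
    (Measurable.tsum fun i => by fun_prop : Measurable fun ω : History => ∑' i, ENNReal.ofReal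
      (ω.1.1 i * Real.exp (ε * ∑ n ∈ Finset.range T, ψ (past n (ω, i))))) measurableSet_Iio
  have h1 : ∀ᵐ ω ∂P, ∑' i, ENNReal.ofReal
      (ω.1.1 i * Real.exp (ε * ∑ n ∈ Finset.range T, ψ (past n (ω, i)))) < ⊤ := by
    rw [← hmp.map_eq, ae_map_iff hmp.measurable.aemeasurable hm]
    filter_upwards [h.ae_orbit_history hq hP,
      hP.measurePreserving_forward.quasiMeasurePreserving.ae (h.ae_orbit hq')] with ω hω hω'
    obtain ⟨π, hπ⟩ := exists_perm_pastPartition hω ε T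
    have hs := ((summable_rawWeight_of_orbit T hω').1.div_const
      (partition (fun x => lam * ψ x) T (forward ω)))
    have hs' : Summable fun i => ((timeStep fun x => lam * ψ x)^[T] ω).1.1 i *
        Real.exp (ε * ∑ n ∈ Finset.range T,
          ψ (past n ((timeStep fun x => lam * ψ x)^[T] ω, i))) := by
      rw [funext hπ]
      exact (π.summable_iff (f := fun j => rawWeight (fun x => (lam + ε) * ψ x) T (forward ω) j
          / partition (fun x => lam * ψ x) T (forward ω))).2 hs
    exact hs'.tsum_ofReal_lt_top
  filter_upwards [h1, h.ae_orbit_history hq hP] with ω h2 hω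
  have hpos : ∀ j, 0 < ω.1.1 j := (hω 0).pos
  refine (ENNReal.summable_toReal h2.ne).congr fun i => ?_
  exact ENNReal.toReal_ofReal (mul_nonneg (hpos i).le (Real.exp_pos _).le)

/-- The mean of `log ∑_i ξ_i e^{ε S_i} + log ∑_i ξ_i e^{-ε S_i}`, where `S_i` is the displacement of
the particle `i` during the last `T` steps, is proportional to `T`. -/
lemma IsRegular.integral_log_pastPartition (h : IsRegular r ψ μ)
    (hq : IsQuasiStationary r (fun x => lam * ψ x) μ)
    (hP : IsStationaryExtension r (fun x => lam * ψ x) μ P) {ε : ℝ}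
    (hq₁ : IsQuasiStationary r (fun x => (lam + ε) * ψ x) μ)
    (hq₂ : IsQuasiStationary r (fun x => (lam + -ε) * ψ x) μ) (T : ℕ) :
    Integrable (fun ω => Real.log (pastPartition ψ ε T ω) + Real.log (pastPartition ψ (-ε) T ω)) P ∧
      ∫ ω, (Real.log (pastPartition ψ ε T ω) + Real.log (pastPartition ψ (-ε) T ω)) ∂P
        = T * ∫ ω, (Real.log (pastPartition ψ ε 1 ω) + Real.log (pastPartition ψ (-ε) 1 ω)) ∂P := by
  have hψ := h.measurable
  set L : ℝ → ℝ := fun c => ∫ w, Real.log (partition (fun x => c * ψ x) 1 w) ∂(forwardLaw r μ)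
  -- The mean is `T` times the second difference of `L` at `lam`. Only its proportionality to `T` is
  -- kept.
  have key : ∀ T : ℕ, Integrable (fun ω => Real.log (pastPartition ψ ε T ω)
        + Real.log (pastPartition ψ (-ε) T ω)) P ∧
      ∫ ω, (Real.log (pastPartition ψ ε T ω) + Real.log (pastPartition ψ (-ε) T ω)) ∂P
        = T * (L (lam + ε) + L (lam + -ε) - 2 * L lam) := by
    intro T
    have hmp := hP.invariant.iterate T
    have hfw := hP.measurePreserving_forward
    have hm : Measurable fun ω => Real.log (pastPartition ψ ε T ω)
        + Real.log (pastPartition ψ (-ε) T ω) :=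
      (Real.measurable_log.comp (measurable_pastPartition hψ ε T)).add
        (Real.measurable_log.comp (measurable_pastPartition hψ (-ε) T))
    have hl : ∀ c, IsQuasiStationary r (fun x => c * ψ x) μ →
        Integrable (fun ω => Real.log (partition (fun x => c * ψ x) T (forward ω))) P ∧
        ∫ ω, Real.log (partition (fun x => c * ψ x) T (forward ω)) ∂P = T * L c := by
      intro c hc
      obtain ⟨h1, h2⟩ := h.integral_log_partition hc T
      obtain ⟨h3, h4⟩ := integrable_comp_measurePreserving hfw
        (Real.measurable_log.comp (measurable_partition (hψ.const_mul c) T)) h1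
      exact ⟨h3, h4.trans h2⟩
    obtain ⟨i1, e1⟩ := hl _ hq₁
    obtain ⟨i2, e2⟩ := hl _ hq₂
    obtain ⟨i3, e3⟩ := hl _ hq
    have heq : (fun ω => Real.log (pastPartition ψ ε T ((timeStep fun x => lam * ψ x)^[T] ω))
        + Real.log (pastPartition ψ (-ε) T ((timeStep fun x => lam * ψ x)^[T] ω))) =ᵐ[P]
        fun ω => Real.log (partition (fun x => (lam + ε) * ψ x) T (forward ω))
          + Real.log (partition (fun x => (lam + -ε) * ψ x) T (forward ω))
          - 2 * Real.log (partition (fun x => lam * ψ x) T (forward ω)) := by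
      filter_upwards [h.ae_orbit_history hq hP, hfw.quasiMeasurePreserving.ae (h.ae_orbit hq₁),
        hfw.quasiMeasurePreserving.ae (h.ae_orbit hq₂)] with ω h0 h1 h2
      have p0 := (summable_rawWeight_of_orbit T h0).2
      have p1 := (summable_rawWeight_of_orbit T h1).2
      have p2 := (summable_rawWeight_of_orbit T h2).2
      rw [pastPartition_iterate h0, pastPartition_iterate h0, Real.log_div p1.ne' p0.ne',
        Real.log_div p2.ne' p0.ne']
      ring
    have i12 : Integrable (fun ω => Real.log (partition (fun x => (lam + ε) * ψ x) T (forward ω))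
          + Real.log (partition (fun x => (lam + -ε) * ψ x) T (forward ω))) P := i1.add i2
    have hi := (i12.sub (i3.const_mul 2)).congr heq.symm
    have hi' := (hmp.integrable_comp hm.aestronglyMeasurable).1 hi
    refine ⟨hi', ?_⟩
    rw [← (integrable_comp_measurePreserving hmp hm hi').2, integral_congr_ae heq,
      integral_sub i12 (i3.const_mul 2), integral_add i1 i2, integral_const_mul, e1, e2, e3]
    ring
  refine ⟨(key T).1, ?_⟩
  rw [(key T).2, (key 1).2]
  simp

/-- The difference of the past velocities of two particles is small on average. -/
lemma IsRegular.lintegral_velocity_sub_le (h : IsRegular r ψ μ)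
    (hq : IsQuasiStationary r (fun x => lam * ψ x) μ)
    (hP : IsStationaryExtension r (fun x => lam * ψ x) μ P) {ε : ℝ} (hε0 : 0 < ε) (hε1 : ε ≤ 1)
    (hq₁ : IsQuasiStationary r (fun x => (lam + ε) * ψ x) μ)
    (hq₂ : IsQuasiStationary r (fun x => (lam + -ε) * ψ x) μ) {v : History × ℕ → ℝ}
    (hv : ∀ᵐ ω ∂P, ∀ i, Tendsto
      (fun n : ℕ => (n : ℝ)⁻¹ * ∑ k ∈ Finset.range n, ψ (past k (ω, i))) atTop (𝓝 (v (ω, i))))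
    (i j : ℕ) :
    ∫⁻ ω, ENNReal.ofReal (v (ω, i) - v (ω, j)) ∂P
      ≤ ENNReal.ofReal (2 * ε) * ∫⁻ ω, ∑' i, ENNReal.ofReal (ω.1.1 i) *
        ENNReal.ofReal (Real.exp (2 * |ψ (past 0 (ω, i))|)) ∂P := by
  have hψ := h.measurable
  set Y : ℕ → History → ℝ := fun T ω =>
    Real.log (pastPartition ψ ε T ω) + Real.log (pastPartition ψ (-ε) T ω) with hY
  set D := ∫⁻ ω, ∑' i, ENNReal.ofReal (ω.1.1 i) *
        ENNReal.ofReal (Real.exp (2 * |ψ (past 0 (ω, i))|)) ∂P with hD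
  set A : ℕ → History → ℕ → ℝ := fun n ω i =>
    (n : ℝ)⁻¹ * ∑ k ∈ Finset.range n, ψ (past k (ω, i)) with hA
  have hlow : ∀ T, ∀ᵐ ω ∂P, 0 ≤ Y T ω ∧ Real.log (ω.1.1 i)
      + ε * ∑ k ∈ Finset.range T, ψ (past k (ω, i)) + (Real.log (ω.1.1 j)
      - ε * ∑ k ∈ Finset.range T, ψ (past k (ω, j))) ≤ Y T ω := by
    intro T
    filter_upwards [h.ae_orbit_history hq hP, h.ae_summable_exp_past hq hP hq₁ T,
      h.ae_summable_exp_past hq hP hq₂ T] with ω hω h1 h2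
    simp only [neg_mul] at h2
    have h3 := log_tsum_exp_add_log_tsum_exp_neg (hω 0).pos (hω 0).hasSum h1 h2
    simp only [hY, pastPartition, neg_mul]
    exact ⟨h3.1, h3.2 i j⟩
  have hint := fun T => h.integral_log_pastPartition hq hP hq₁ hq₂ T
  have hlint : ∀ T, ∫⁻ ω, ENNReal.ofReal (Y T ω) ∂P = ENNReal.ofReal (T * ∫ ω, Y 1 ω ∂P) := by
    intro T
    rw [← ofReal_integral_eq_lintegral_ofReal (hint T).1 ((hlow T).mono fun ω hω => hω.1),
      (hint T).2]
  -- The one-step bound is quadratic in `ε`, while the velocity difference enters `Y T` with the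
  -- factor `ε`; this leaves a factor `ε` to spare.
  have hone : ENNReal.ofReal (∫ ω, Y 1 ω ∂P) ≤ ENNReal.ofReal (2 * ε ^ 2) * D := by
    have h1 := hlint 1
    rw [Nat.cast_one, one_mul] at h1
    rw [← h1, hD, ← lintegral_const_mul _ (Measurable.tsum fun k => by fun_prop)]
    refine lintegral_mono_ae ?_
    filter_upwards [h.ae_orbit_history hq hP, h.ae_hasExpSums_past hq hP] with ω hω he
    have hpos : ∀ k, 0 < ω.1.1 k := (hω 0).pos
    have h2 := log_add_log_le_sq_mul hpos (hω 0).hasSum he (ε := ε)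
      (by rw [abs_of_pos hε0]; exact hε1)
    have h3 : Y 1 ω ≤ 2 * ε ^ 2 * ∑' k, ω.1.1 k * Real.exp (2 * |ψ (past 0 (ω, k))|) := by
      simpa only [hY, pastPartition, Finset.sum_range_one] using h2
    refine (ENNReal.ofReal_le_ofReal h3).trans (le_of_eq ?_)
    rw [ENNReal.ofReal_mul (by positivity), ENNReal.ofReal_tsum_of_nonneg
      (fun k => mul_nonneg (hpos k).le (Real.exp_pos _).le) (he 2)]
    congr 1
    exact tsum_congr fun k => ENNReal.ofReal_mul (hpos k).le
  set q : ℕ → History → ℝ≥0∞ := fun T ω => ENNReal.ofReal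
    ((T : ℝ)⁻¹ * (Real.log (ω.1.1 i) + Real.log (ω.1.1 j)) + ε * (A T ω i - A T ω j)) with hqd
  have hqm : ∀ T, Measurable (q T) := by
    intro T
    simp only [hqd, hA]
    fun_prop
  have hqle : ∀ T : ℕ, 1 ≤ T → ∫⁻ ω, q T ω ∂P ≤ ENNReal.ofReal (∫ ω, Y 1 ω ∂P) := by
    intro T hT
    have hT0 : (0 : ℝ) < T := by exact_mod_cast hT
    calc ∫⁻ ω, q T ω ∂P ≤ ∫⁻ ω, ENNReal.ofReal (T : ℝ)⁻¹ * ENNReal.ofReal (Y T ω) ∂P := by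
          refine lintegral_mono_ae ?_
          filter_upwards [hlow T] with ω hω
          rw [← ENNReal.ofReal_mul (by positivity)]
          refine ENNReal.ofReal_le_ofReal ?_
          have := mul_le_mul_of_nonneg_left hω.2 (inv_nonneg.2 hT0.le)
          refine le_trans (le_of_eq ?_) this
          simp only [hA]
          ring
      _ = ENNReal.ofReal (T : ℝ)⁻¹ * ∫⁻ ω, ENNReal.ofReal (Y T ω) ∂P :=
          lintegral_const_mul' _ _ ENNReal.ofReal_ne_top
      _ = ENNReal.ofReal (∫ ω, Y 1 ω ∂P) := by
          rw [hlint, ← ENNReal.ofReal_mul (by positivity), ← mul_assoc, inv_mul_cancel₀ hT0.ne',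
            one_mul]
  -- Divided by `T`, the terms `log ξ_i` and `log ξ_j` vanish in the limit, so their integrability
  -- is never needed.
  have hlim : ∀ᵐ ω ∂P, liminf (fun T => q T ω) atTop
      = ENNReal.ofReal (ε * (v (ω, i) - v (ω, j))) := by
    filter_upwards [hv] with ω hω
    refine Tendsto.liminf_eq (ENNReal.tendsto_ofReal ?_)
    have h1 := (tendsto_inv_atTop_nhds_zero_nat (𝕜 := ℝ)).mul_const
      (Real.log (ω.1.1 i) + Real.log (ω.1.1 j))
    have h2 := h1.add (((hω i).sub (hω j)).const_mul ε)
    simpa using h2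
  have hfatou : ∫⁻ ω, ENNReal.ofReal (ε * (v (ω, i) - v (ω, j))) ∂P
      ≤ ENNReal.ofReal (∫ ω, Y 1 ω ∂P) := by
    rw [← lintegral_congr_ae hlim]
    refine (lintegral_liminf_le hqm).trans ?_
    refine (liminf_le_liminf (v := fun _ => ENNReal.ofReal (∫ ω, Y 1 ω ∂P)) ?_).trans
      (by simp)
    filter_upwards [eventually_ge_atTop 1] with T hT using hqle T hT
  have hfin := hfatou.trans hone
  have e1 : ∫⁻ ω, ENNReal.ofReal (ε * (v (ω, i) - v (ω, j))) ∂P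
      = ENNReal.ofReal ε * ∫⁻ ω, ENNReal.ofReal (v (ω, i) - v (ω, j)) ∂P := by
    rw [← lintegral_const_mul' _ _ ENNReal.ofReal_ne_top]
    exact lintegral_congr fun ω => ENNReal.ofReal_mul hε0.le
  have e2 : ENNReal.ofReal (2 * ε ^ 2) * D = ENNReal.ofReal ε * (ENNReal.ofReal (2 * ε) * D) := by
    rw [← mul_assoc, ← ENNReal.ofReal_mul hε0.le]
    congr 2
    ring
  rw [e1, e2] at hfin
  exact (ENNReal.mul_le_mul_iff_right (by simpa using hε0) ENNReal.ofReal_ne_top).1 hfin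

/-- The past velocities of all the particles coincide. -/
lemma IsRegular.ae_velocity_le (h : IsRegular r ψ μ) {U : Set ℝ} (hU : IsOpen U)
    (hqU : ∀ c ∈ U, IsQuasiStationary r (fun x => c * ψ x) μ) (hlam : lam ∈ U)
    (hP : IsStationaryExtension r (fun x => lam * ψ x) μ P) {v : History × ℕ → ℝ}
    (hv : ∀ᵐ ω ∂P, ∀ i, Tendsto
      (fun n : ℕ => (n : ℝ)⁻¹ * ∑ k ∈ Finset.range n, ψ (past k (ω, i))) atTop (𝓝 (v (ω, i)))) :
    ∀ᵐ ω ∂P, ∀ i j, v (ω, i) ≤ v (ω, j) := by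
  have hψ := h.measurable
  have hq := hqU lam hlam
  rw [ae_all_iff]
  intro i
  rw [ae_all_iff]
  intro j
  set D := ∫⁻ ω, ∑' i, ENNReal.ofReal (ω.1.1 i) *
        ENNReal.ofReal (Real.exp (2 * |ψ (past 0 (ω, i))|)) ∂P with hD
  have hDtop : D ≠ ⊤ := h.lintegral_exp_past_ne_top hq hP 2
  obtain ⟨δ, hδ, hball⟩ := Metric.isOpen_iff.1 hU lam hlam
  -- The left side does not depend on `ε`, and openness of `U` keeps `lam ± ε` in `U` for all small
  -- `ε`.
  have hzero : ∫⁻ ω, ENNReal.ofReal (v (ω, i) - v (ω, j)) ∂P = 0 := by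
    have hle : ∀ᶠ ε in 𝓝[>] (0 : ℝ), ∫⁻ ω, ENNReal.ofReal (v (ω, i) - v (ω, j)) ∂P
        ≤ ENNReal.ofReal (2 * ε) * D := by
      filter_upwards [self_mem_nhdsWithin, Ioo_mem_nhdsGT (lt_min hδ one_pos)] with ε h0 h1
      have hε : (0 : ℝ) < ε := h0
      refine h.lintegral_velocity_sub_le hq hP hε (h1.2.le.trans (min_le_right _ _))
        (hqU _ (hball ?_)) (hqU _ (hball ?_)) hv i j
      all_goals
        rw [Metric.mem_ball, Real.dist_eq]
        simp only [add_sub_cancel_left, abs_neg, abs_of_pos hε]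
        exact h1.2.trans_le (min_le_left _ _)
    have hlim : Tendsto (fun ε : ℝ => ENNReal.ofReal (2 * ε) * D) (𝓝[>] 0) (𝓝 0) := by
      have h1 : Tendsto (fun ε : ℝ => ENNReal.ofReal (2 * ε)) (𝓝[>] 0) (𝓝 0) := by
        have h2 : Continuous fun ε : ℝ => ENNReal.ofReal (2 * ε) :=
          ENNReal.continuous_ofReal.comp (by fun_prop)
        have h3 := h2.tendsto 0
        simp only [mul_zero, ENNReal.ofReal_zero] at h3
        exact h3.mono_left nhdsWithin_le_nhds
      simpa using ENNReal.Tendsto.mul_const h1 (Or.inr hDtop)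
    exact le_antisymm (ge_of_tendsto hlim hle) zero_le
  have hm : ∀ k, AEMeasurable (fun ω => v (ω, k)) P := fun k =>
    aemeasurable_of_tendsto_metrizable_ae atTop
      (f := fun (n : ℕ) ω => (n : ℝ)⁻¹ * ∑ l ∈ Finset.range n, ψ (past l (ω, k)))
      (fun n => Measurable.aemeasurable (by fun_prop)) (hv.mono fun ω hω => hω k)
  have hmij : AEMeasurable (fun ω => ENNReal.ofReal (v (ω, i) - v (ω, j))) P :=
    ((hm i).sub (hm j)).ennreal_ofReal
  rw [lintegral_eq_zero_iff' hmij] at hzero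
  filter_upwards [hzero] with ω hω
  have h1 : ENNReal.ofReal (v (ω, i) - v (ω, j)) = 0 := hω
  rw [ENNReal.ofReal_eq_zero] at h1
  linarith

end Velocity

/-! ### Symmetric functions of the increments -/

/-- A permutation of the times that maps the times before `n` to the even times before `2 * n`. -/
def evenPerm (n : ℕ) : Equiv.Perm ℕ where
  toFun t := if t < n then 2 * t else if t < 2 * n then 2 * (t - n) + 1 else t
  invFun s := if s < 2 * n then (if s % 2 = 0 then s / 2 else n + s / 2) else s
  left_inv t := by grind
  right_inv s := by grind

/-- A permutation of the times that maps the times before `n` to the odd times before `2 * n`. -/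
def oddPerm (n : ℕ) : Equiv.Perm ℕ where
  toFun t := if t < n then 2 * t + 1 else if t < 2 * n then 2 * (t - n) else t
  invFun s := if s < 2 * n then (if s % 2 = 0 then n + s / 2 else s / 2) else s
  left_inv t := by grind
  right_inv s := by grind

lemma evenPerm_of_lt {n t : ℕ} (h : t < n) : evenPerm n t = 2 * t := if_pos h

lemma oddPerm_of_lt {n t : ℕ} (h : t < n) : oddPerm n t = 2 * t + 1 := if_pos h

lemma evenPerm_lt_iff (n t : ℕ) : evenPerm n t < 2 * n ↔ t < 2 * n := by
  change (if t < n then 2 * t else if t < 2 * n then 2 * (t - n) + 1 else t) < 2 * n ↔ _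
  grind

lemma oddPerm_lt_iff (n t : ℕ) : oddPerm n t < 2 * n ↔ t < 2 * n := by
  change (if t < n then 2 * t + 1 else if t < 2 * n then 2 * (t - n) else t) < 2 * n ↔ _
  grind

lemma ofReal_abs_sub_le (x y z : ℝ) :
    ENNReal.ofReal |x - z| ≤ ENNReal.ofReal |x - y| + ENNReal.ofReal |y - z| :=
  (ENNReal.ofReal_le_ofReal (abs_sub_le x y z)).trans ENNReal.ofReal_add_le

lemma measurable_ofReal_abs_sub {α : Type*} [MeasurableSpace α] {f g : α → ℝ} (hf : Measurable f)
    (hg : Measurable g) : Measurable fun x => ENNReal.ofReal |f x - g x| := by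
  fun_prop

/-- The distance of a bounded function to its mean is at most its mean distance to an independent
copy. -/
lemma lintegral_abs_sub_integral_le {α : Type*} [MeasurableSpace α] {ν : Measure α}
    [IsProbabilityMeasure ν] {g : α → ℝ} (hg : Measurable g) {M : ℝ} (hM : ∀ x, |g x| ≤ M) :
    ∫⁻ x, ENNReal.ofReal |g x - ∫ y, g y ∂ν| ∂ν
      ≤ ∫⁻ x, ∫⁻ y, ENNReal.ofReal |g x - g y| ∂ν ∂ν := by
  have hi : Integrable g ν := Integrable.of_bound hg.aestronglyMeasurable M (.of_forall hM)
  refine lintegral_mono fun x => ?_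
  have hx : Integrable (fun y => g x - g y) ν := (integrable_const _).sub hi
  rw [← ofReal_integral_eq_lintegral_ofReal hx.abs (.of_forall fun y => abs_nonneg _)]
  refine ENNReal.ofReal_le_ofReal ?_
  have : g x - ∫ y, g y ∂ν = ∫ y, (g x - g y) ∂ν := by
    rw [integral_sub (integrable_const _) hi]
    simp
  rw [this]
  exact abs_integral_le_integral_abs

/-! ### A conditional Hewitt–Savage argument -/

section HewittSavage

variable {r : ℕ} {μ : Measure Config}

/-- A symmetric function of the increments is nearly independent of them, given the configuration,
when it is close to a function of fewer increments. -/
lemma lintegral_noise_abs_sub_le (hF : forwardLaw r μ ≠ 0)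
    {u : ℕ → Config × (ℕ → ℕ → ℝ) → ℝ} (hu : ∀ n, Measurable (u n))
    (hloc : ∀ n p κ κ', (∀ t < n, κ t = κ' t) → u n (p, κ) = u n (p, κ'))
    (hsymm : ∀ n (σ : Equiv.Perm ℕ), (∀ t, σ t < n ↔ t < n) → ∀ w,
      u n (w.1, fun t => w.2 (σ t)) = u n w) (n : ℕ) :
    ∫⁻ p, ∫⁻ κ, ∫⁻ κ', ENNReal.ofReal |u n (p, κ) - u n (p, κ')| ∂(noise r p) ∂(noise r p) ∂μ
      ≤ 2 * ∫⁻ w, ENNReal.ofReal |u n w - u (2 * n) w| ∂(forwardLaw r μ) := by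
  have hg : Measurable fun q : Config × (ℕ → ℕ → ℝ) × (ℕ → ℕ → ℝ) =>
      ENNReal.ofReal |u n (q.1, q.2.1) - u n (q.1, q.2.2)| :=
    measurable_ofReal_abs_sub ((hu n).comp (by fun_prop)) ((hu n).comp (by fun_prop))
  have hd := measurable_ofReal_abs_sub (hu n) (hu (2 * n))
  rw [← lintegral_forwardLaw_even_odd hF hg, two_mul]
  -- Evaluated at the even and at the odd times below `2 * n`, the function `u n` gives two
  -- conditionally independent copies. Each lies as far in mean from `u (2 * n)` as `u n` does,
  -- because permuting those times does not change `u (2 * n)`. The triangle inequality gives the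
  -- factor `2`.
  nth_rewrite 1 [← (measurePreserving_permute_time hF (evenPerm n)).lintegral_comp hd]
  rw [← (measurePreserving_permute_time hF (oddPerm n)).lintegral_comp hd,
    ← lintegral_add_left (μ := forwardLaw r μ) (f := fun w => ENNReal.ofReal
      |u n (w.1, fun t => w.2 (evenPerm n t)) - u (2 * n) (w.1, fun t => w.2 (evenPerm n t))|)
      (hd.comp (measurePreserving_permute_time hF (evenPerm n)).measurable)]
  refine lintegral_mono fun w => ?_
  simp only
  rw [hsymm (2 * n) _ (evenPerm_lt_iff n), hsymm (2 * n) _ (oddPerm_lt_iff n),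
    hloc n w.1 (fun t => w.2 (2 * t)) (fun t => w.2 (evenPerm n t))
      fun t ht => by rw [evenPerm_of_lt ht],
    hloc n w.1 (fun t => w.2 (2 * t + 1)) (fun t => w.2 (oddPerm n t))
      fun t ht => by rw [oddPerm_of_lt ht]]
  refine (ofReal_abs_sub_le _ (u (2 * n) w) _).trans (le_of_eq ?_)
  rw [abs_sub_comm (u (2 * n) w)]

/-- A limit of symmetric functions of the increments depends only on the configuration. -/
theorem exists_measurable_eq_of_symmetric_limit [IsProbabilityMeasure μ] (hF : forwardLaw r μ ≠ 0)
    {Ω : Type*} [MeasurableSpace Ω] {P : Measure Ω} {X : Ω → Config × (ℕ → ℕ → ℝ)}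
    (hX : MeasurePreserving X P (forwardLaw r μ))
    {u : ℕ → Config × (ℕ → ℕ → ℝ) → ℝ} (hu : ∀ n, Measurable (u n)) {M : ℝ}
    (hM : ∀ n w, |u n w| ≤ M)
    (hloc : ∀ n p κ κ', (∀ t < n, κ t = κ' t) → u n (p, κ) = u n (p, κ'))
    (hsymm : ∀ n (σ : Equiv.Perm ℕ), (∀ t, σ t < n ↔ t < n) → ∀ w,
      u n (w.1, fun t => w.2 (σ t)) = u n w)
    {Y : Ω → ℝ} (hY : Measurable Y) (hYM : ∀ ω, |Y ω| ≤ M)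
    (hlim : Tendsto (fun n => ∫⁻ ω, ENNReal.ofReal |u n (X ω) - Y ω| ∂P) atTop (𝓝 0)) :
    ∃ f : Config → ℝ, Measurable f ∧ (∀ p, |f p| ≤ M) ∧ ∀ᵐ ω ∂P, f (X ω).1 = Y ω := by
  set a : ℕ → ℝ≥0∞ := fun n => ∫⁻ ω, ENNReal.ofReal |u n (X ω) - Y ω| ∂P with ha
  have hmX : ∀ n, Measurable fun ω => u n (X ω) := fun n => (hu n).comp hX.measurable
  have hb : ∀ n, ∫⁻ w, ENNReal.ofReal |u n w - u (2 * n) w| ∂(forwardLaw r μ)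
      ≤ a n + a (2 * n) := by
    intro n
    rw [← hX.lintegral_comp (measurable_ofReal_abs_sub (hu n) (hu (2 * n))), ha,
      ← lintegral_add_left (measurable_ofReal_abs_sub (hmX n) hY)]
    refine lintegral_mono fun ω => ?_
    refine (ofReal_abs_sub_le _ (Y ω) _).trans (le_of_eq ?_)
    rw [abs_sub_comm (Y ω)]
  have hmu : ∀ n p, Measurable fun κ => u n (p, κ) := fun n p => (hu n).comp (by fun_prop)
  -- The conditional mean of `u n` approximates `Y`. Adding `M` makes the integrand nonnegative, so
  -- measurability follows from that of lower integrals.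
  have hFm : ∀ n, AEMeasurable (fun p => ∫ κ, u n (p, κ) ∂(noise r p)) μ := by
    intro n
    have h1 : Measurable fun w => ENNReal.ofReal (u n w + M) := by
      have := hu n
      fun_prop
    refine ((aemeasurable_lintegral_noise hF h1).ennreal_toReal.sub_const M).congr
      (.of_forall fun p => ?_)
    have hi : Integrable (fun κ => u n (p, κ)) (noise r p) :=
      Integrable.of_bound (hmu n p).aestronglyMeasurable M (.of_forall fun κ => hM n _)
    have h2 := integral_eq_lintegral_of_nonneg_ae (μ := noise r p) (f := fun κ => u n (p, κ) + M)
      (.of_forall fun κ => by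
        have := (abs_le.1 (hM n (p, κ))).1
        simp only [Pi.zero_apply]
        linarith)
      ((hmu n p).add_const M).aestronglyMeasurable
    simp only
    rw [← h2, integral_add hi (integrable_const _)]
    simp
  set G : ℕ → Config → ℝ := fun n => (hFm n).mk _ with hG
  have hGm : ∀ n, Measurable (G n) := fun n => (hFm n).measurable_mk
  have hGlim : ∀ n, ∫⁻ ω, ENNReal.ofReal |G n (X ω).1 - Y ω| ∂P
      ≤ 2 * (a n + a (2 * n)) + a n := by
    intro n
    have h1 := hmX n
    have h2 : Measurable fun ω => G n (X ω).1 := (hGm n).comp (measurable_fst.comp hX.measurable)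
    have h3 : Measurable fun w : Config × (ℕ → ℕ → ℝ) => ENNReal.ofReal |u n w - G n w.1| :=
      measurable_ofReal_abs_sub (hu n) ((hGm n).comp measurable_fst)
    calc ∫⁻ ω, ENNReal.ofReal |G n (X ω).1 - Y ω| ∂P
        ≤ ∫⁻ ω, (ENNReal.ofReal |u n (X ω) - G n (X ω).1| + ENNReal.ofReal |u n (X ω) - Y ω|) ∂P :=
          lintegral_mono fun ω => by
            refine (ofReal_abs_sub_le _ (u n (X ω)) _).trans (le_of_eq ?_)
            rw [abs_sub_comm (u n (X ω)) (G n _)]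
      _ = ∫⁻ w, ENNReal.ofReal |u n w - G n w.1| ∂(forwardLaw r μ) + a n := by
          rw [lintegral_add_left (measurable_ofReal_abs_sub h1 h2), ← hX.lintegral_comp h3]
      _ = ∫⁻ p, ∫⁻ κ, ENNReal.ofReal |u n (p, κ) - ∫ κ', u n (p, κ') ∂(noise r p)| ∂(noise r p) ∂μ
            + a n := by
          rw [lintegral_forwardLaw (g := fun w => ENNReal.ofReal |u n w - G n w.1|) hF h3]
          congr 1
          refine lintegral_congr_ae ?_
          filter_upwards [(hFm n).ae_eq_mk] with p hp
          simp only [hG, ← hp]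
      _ ≤ 2 * (a n + a (2 * n)) + a n := by
          gcongr
          refine (lintegral_mono fun p => lintegral_abs_sub_integral_le (hmu n p)
            fun κ => hM n _).trans ?_
          exact (lintegral_noise_abs_sub_le hF hu hloc hsymm n).trans
            (by gcongr; exact hb n)
  have ha2 : Tendsto (fun n => a (2 * n)) atTop (𝓝 0) :=
    hlim.comp (tendsto_id.const_mul_atTop' two_pos)
  have hb0 : Tendsto (fun n => 2 * (a n + a (2 * n)) + a n) atTop (𝓝 0) := by
    have h1 := (ENNReal.Tendsto.const_mul (a := 2) (hlim.add ha2) (Or.inr (by norm_num))).add hlim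
    simpa using h1
  have hG0 : Tendsto (fun n => eLpNorm ((fun ω => G n (X ω).1) - Y) 1 P) atTop (𝓝 0) := by
    refine tendsto_of_tendsto_of_tendsto_of_le_of_le tendsto_const_nhds hb0 (fun _ => zero_le)
      fun n => ?_
    rw [eLpNorm_one_eq_lintegral_enorm]
    refine le_trans (le_of_eq (lintegral_congr fun ω => ?_)) (hGlim n)
    rw [← ofReal_norm]
    rfl
  obtain ⟨ns, -, hns⟩ := (tendstoInMeasure_of_tendsto_eLpNorm one_ne_zero
    (fun n => ((hGm n).comp (measurable_fst.comp hX.measurable)).aestronglyMeasurable)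
    hY.aestronglyMeasurable hG0).exists_seq_tendsto_ae
  have hM0 : -M ≤ M := by
    have := (abs_nonneg _).trans (hM 0 ((0, 0), 0))
    linarith
  -- Along an a.e. convergent subsequence the limit is `Y`. The `liminf` and the truncation make the
  -- function measurable and bounded at every configuration.
  refine ⟨fun p => max (-M) (min M (liminf (fun k => G (ns k) p) atTop)), ?_, fun p => ?_, ?_⟩
  · have := Measurable.liminf fun k => hGm (ns k)
    fun_prop
  · rw [abs_le]
    exact ⟨le_max_left _ _, max_le hM0 (min_le_left _ _)⟩
  · filter_upwards [hns] with ω hω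
    obtain ⟨h1, h2⟩ := abs_le.1 (hYM ω)
    have h3 : liminf (fun k => G (ns k) (X ω).1) atTop = Y ω := Tendsto.liminf_eq hω
    simp only [h3]
    rw [min_eq_right h2, max_eq_right h1]

end HewittSavage

/-! ### Weighted means over the particles -/

/-- The weighted mean `∑_i ξ_i g(ω, i)` of a function over the particles. -/
def weightedMean (g : History × ℕ → ℝ) (ω : History) : ℝ := ∑' i, ω.1.1 i * g (ω, i)

lemma integral_count_nat {f : ℕ → ℝ} (hf : Integrable f Measure.count) :
    ∫ i, f i ∂Measure.count = ∑' i, f i := by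
  rw [integral_countable hf]
  exact tsum_congr fun i => by simp [Measure.real]

section WeightedMean

variable {P : Measure History} [SFinite P]

/-- Fubini for `P` times the counting measure, with the weights as density. -/
lemma integrable_weightedMean (hpos : ∀ᵐ ω ∂P, ∀ i, 0 < ω.1.1 i) {g : History × ℕ → ℝ}
    (hg : Integrable g (tagged P)) :
    (∀ᵐ ω ∂P, Summable fun i => ω.1.1 i * g (ω, i)) ∧ Integrable (weightedMean g) P ∧
      ∫ ω, weightedMean g ω ∂P = ∫ q, g q ∂(tagged P) := by
  have hlt : ∀ᵐ q : History × ℕ ∂(P.prod Measure.count), ENNReal.ofReal (q.1.1.1 q.2) < ⊤ :=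
    .of_forall fun q => ENNReal.ofReal_lt_top
  have hpos' : ∀ᵐ q : History × ℕ ∂(P.prod Measure.count), ∀ i, 0 < q.1.1.1 i :=
    Measure.quasiMeasurePreserving_fst.ae hpos
  have he : (fun q : History × ℕ => (ENNReal.ofReal (q.1.1.1 q.2)).toReal • g q)
      =ᵐ[P.prod Measure.count] fun q => q.1.1.1 q.2 * g q := by
    filter_upwards [hpos'] with q hq
    rw [ENNReal.toReal_ofReal (hq q.2).le, smul_eq_mul]
  have h1 : Integrable (fun q : History × ℕ => q.1.1.1 q.2 * g q) (P.prod Measure.count) :=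
    ((integrable_withDensity_iff_integrable_smul' measurable_tag_weight hlt).1 hg).congr he
  have h2 : ∀ᵐ ω ∂P, Integrable (fun i => ω.1.1 i * g (ω, i)) Measure.count := h1.prod_right_ae
  have h3 : (fun ω => ∫ i, ω.1.1 i * g (ω, i) ∂Measure.count) =ᵐ[P] weightedMean g := by
    filter_upwards [h2] with ω hω
    exact integral_count_nat hω
  refine ⟨?_, h1.integral_prod_left.congr h3, ?_⟩
  · filter_upwards [h2] with ω hω
    exact (integrable_count_iff.1 hω).of_norm
  · rw [← integral_congr_ae h3, tagged,
      integral_withDensity_eq_integral_toReal_smul measurable_tag_weight hlt, integral_congr_ae he,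
      integral_prod _ h1]

lemma lintegral_abs_weightedMean_sub_le (hpos : ∀ᵐ ω ∂P, ∀ i, 0 < ω.1.1 i)
    {g k : History × ℕ → ℝ} (hgm : Measurable g) (hkm : Measurable k)
    (hg : Integrable g (tagged P)) (hk : Integrable k (tagged P)) :
    ∫⁻ ω, ENNReal.ofReal |weightedMean g ω - weightedMean k ω| ∂P
      ≤ ∫⁻ q, ENNReal.ofReal |g q - k q| ∂(tagged P) := by
  rw [lintegral_tagged P (measurable_ofReal_abs_sub hgm hkm)]
  refine lintegral_mono_ae ?_
  filter_upwards [hpos, (integrable_weightedMean hpos hg).1, (integrable_weightedMean hpos hk).1]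
    with ω h1 h2 h3
  rw [weightedMean, weightedMean, ← h2.tsum_sub h3, ← Real.norm_eq_abs, ofReal_norm]
  refine enorm_tsum_le_tsum_enorm.trans (le_of_eq (tsum_congr fun i => ?_))
  rw [← mul_sub, enorm_mul, ← ofReal_norm, ← ofReal_norm, Real.norm_of_nonneg (h1 i).le,
    Real.norm_eq_abs]

end WeightedMean

/-- Convergence in mean square at rate `1 / n` implies convergence in mean. -/
lemma tendsto_lintegral_abs_of_sq_le {α : Type*} [MeasurableSpace α] {M : Measure α}
    [IsProbabilityMeasure M] {x : ℕ → α → ℝ} (hx : ∀ n, Measurable (x n)) {C : ℝ}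
    (hC : ∀ n : ℕ, 1 ≤ n →
      ∫⁻ q, ENNReal.ofReal (x n q ^ 2) ∂M ≤ ENNReal.ofReal (C * (n : ℝ)⁻¹)) :
    Tendsto (fun n => ∫⁻ q, ENNReal.ofReal |x n q| ∂M) atTop (𝓝 0) := by
  have h0 : Tendsto (fun n : ℕ => (√(n : ℝ))⁻¹) atTop (𝓝 0) :=
    tendsto_inv_atTop_zero.comp (Real.tendsto_sqrt_atTop.comp tendsto_natCast_atTop_atTop)
  have h1 : Tendsto (fun n : ℕ => ENNReal.ofReal ((√(n : ℝ))⁻¹)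
      + ENNReal.ofReal (C * (√(n : ℝ))⁻¹)) atTop (𝓝 0) := by
    have := (ENNReal.tendsto_ofReal h0).add (ENNReal.tendsto_ofReal (h0.const_mul C))
    simpa using this
  refine tendsto_of_tendsto_of_tendsto_of_le_of_le' tendsto_const_nhds h1
    (.of_forall fun _ => zero_le) ?_
  filter_upwards [eventually_ge_atTop 1] with n hn
  have hn0 : (0 : ℝ) < n := by exact_mod_cast hn
  have hs : 0 < √(n : ℝ) := Real.sqrt_pos.2 hn0
  have hsq : √(n : ℝ) * √(n : ℝ) = n := Real.mul_self_sqrt hn0.le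
  have hm := hx n
  calc ∫⁻ q, ENNReal.ofReal |x n q| ∂M
      ≤ ∫⁻ q, (ENNReal.ofReal ((√(n : ℝ))⁻¹)
          + ENNReal.ofReal (√(n : ℝ)) * ENNReal.ofReal (x n q ^ 2)) ∂M := by
        -- With `s = √n`, completing the square gives `|x| ≤ s⁻¹ + s x²`; this `s` balances the two
        -- terms against the rate `1/n`.
        refine lintegral_mono fun q => ?_
        rw [← ENNReal.ofReal_mul hs.le, ← ENNReal.ofReal_add (by positivity) (by positivity)]
        refine ENNReal.ofReal_le_ofReal ?_
        rw [← sub_nonneg]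
        have : (√(n : ℝ))⁻¹ + √(n : ℝ) * x n q ^ 2 - |x n q|
            = (√(n : ℝ))⁻¹ * ((√(n : ℝ) * |x n q| - 1 / 2) ^ 2 + 3 / 4) := by
          rw [← sq_abs (x n q)]
          field_simp
          ring
        rw [this]
        positivity
    _ = ENNReal.ofReal ((√(n : ℝ))⁻¹)
          + ENNReal.ofReal (√(n : ℝ)) * ∫⁻ q, ENNReal.ofReal (x n q ^ 2) ∂M := by
        rw [lintegral_add_left measurable_const, lintegral_const_mul _ (by fun_prop)]
        simp
    _ ≤ ENNReal.ofReal ((√(n : ℝ))⁻¹)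
          + ENNReal.ofReal (√(n : ℝ)) * ENNReal.ofReal (C * (n : ℝ)⁻¹) := by
        gcongr
        exact hC n hn
    _ = _ := by
        rw [← ENNReal.ofReal_mul hs.le]
        have hinv : (n : ℝ)⁻¹ = (√(n : ℝ))⁻¹ * (√(n : ℝ))⁻¹ := by rw [← mul_inv, hsq]
        rw [hinv]
        congr 2
        field_simp

lemma abs_arctan_sub_le (x y : ℝ) : |Real.arctan x - Real.arctan y| ≤ |x - y| := by
  have h := lipschitzWith_of_nnnorm_deriv_le (𝕜 := ℝ) (C := 1) Real.differentiable_arctan fun x => by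
    rw [← NNReal.coe_le_coe, coe_nnnorm, Real.deriv_arctan, Real.norm_of_nonneg (by positivity)]
    simp only [NNReal.coe_one]
    rw [div_le_one (by positivity)]
    nlinarith [sq_nonneg x]
  simpa [Real.dist_eq] using h.dist_le_mul x y

lemma abs_arctan_le (x : ℝ) : |Real.arctan x| ≤ Real.pi / 2 :=
  abs_le.2 ⟨(Real.neg_pi_div_two_lt_arctan x).le, (Real.arctan_lt_pi_div_two x).le⟩

/-! ### The common velocity under ergodicity -/

/-- The average of the `n` last increments of a tagged particle. -/
def pastAverage (ψ : ℝ → ℝ) (n : ℕ) (q : History × ℕ) : ℝ :=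
  (n : ℝ)⁻¹ * ∑ k ∈ Finset.range n, ψ (past k q)

lemma measurable_pastAverage {ψ : ℝ → ℝ} (hψ : Measurable ψ) (n : ℕ) :
    Measurable (pastAverage ψ n) := by
  unfold pastAverage
  fun_prop

/-- The weighted mean, with the weights after `n` steps, of the averages of the `n` first
increments. -/
def forwardMean (φ ψ : ℝ → ℝ) (n : ℕ) (w : Config × (ℕ → ℕ → ℝ)) : ℝ :=
  ∑' j, rawWeight φ n w j / partition φ n w * ((n : ℝ)⁻¹ * ∑ t ∈ Finset.range n, ψ (w.2 t j))

lemma measurable_forwardMean {φ ψ : ℝ → ℝ} (hφ : Measurable φ) (hψ : Measurable ψ) (n : ℕ) :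
    Measurable (forwardMean φ ψ n) := by
  have h1 := measurable_rawWeight hφ n
  have h2 := measurable_partition hφ n
  unfold forwardMean
  exact Measurable.tsum fun j => by fun_prop

lemma forwardMean_congr (φ ψ : ℝ → ℝ) (n : ℕ) (p : Config) {κ κ' : ℕ → ℕ → ℝ}
    (h : ∀ t < n, κ t = κ' t) : forwardMean φ ψ n (p, κ) = forwardMean φ ψ n (p, κ') := by
  have h1 : ∀ (f : ℝ → ℝ) j, ∑ t ∈ Finset.range n, f (κ t j) = ∑ t ∈ Finset.range n, f (κ' t j) :=
    fun f j => Finset.sum_congr rfl fun t ht => by rw [h t (Finset.mem_range.1 ht)]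
  simp only [forwardMean, partition, rawWeight, h1]

lemma forwardMean_permute (φ ψ : ℝ → ℝ) (n : ℕ) {σ : Equiv.Perm ℕ} (hσ : ∀ t, σ t < n ↔ t < n)
    (w : Config × (ℕ → ℕ → ℝ)) :
    forwardMean φ ψ n (w.1, fun t => w.2 (σ t)) = forwardMean φ ψ n w := by
  have h1 : ∀ (f : ℝ → ℝ) j,
      ∑ t ∈ Finset.range n, f (w.2 (σ t) j) = ∑ t ∈ Finset.range n, f (w.2 t j) := fun f j =>
    Finset.sum_equiv σ (fun t => by simp [hσ]) fun t _ => rfl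
  simp only [forwardMean, partition, rawWeight, h1]

/-! ### The velocity as a limit of symmetric functions -/

section Velocity

variable {r : ℕ} {ψ : ℝ → ℝ} {μ : Measure Config} {lam : ℝ} {P : Measure History}

/-- This identity turns an average over the past into a function of the first `n` forward increments
that is symmetric in time. -/
lemma weightedMean_pastAverage_iterate {ω : History}
    (hω : ∀ n, IsGood ψ ((forwardStep fun x => lam * ψ x)^[n] (forward ω))) (n : ℕ) :
    weightedMean (pastAverage ψ n) ((timeStep fun x => lam * ψ x)^[n] ω)
      = forwardMean (fun x => lam * ψ x) ψ n (forward ω) := by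
  obtain ⟨π, hπ⟩ := exists_perm_past hω n
  rw [forwardMean, ← π.tsum_eq]
  refine tsum_congr fun i => ?_
  rw [(hπ i).1, pastAverage]
  congr 2
  rw [← Finset.sum_range_reflect]
  refine Finset.sum_congr rfl fun k hk => ?_
  have hk' := Finset.mem_range.1 hk
  rw [past, (hπ i).2 _ (by omega), show n - 1 - (n - 1 - k) = k by omega]

/-- The past average of a particle is shifted, at the next time, to that of the particle of another
rank. -/
lemma pastAverage_timeStep_succ (φ : ℝ → ℝ) (ω : History) (i n : ℕ) :
    pastAverage ψ (n + 1) (timeStep φ ω, i)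
      = ((n + 1 : ℕ) : ℝ)⁻¹ * ψ (ω.2 0 (reshuffle (fun i => φ (ω.2 0 i)) ω.1 i))
        + (n : ℝ) / (n + 1) * pastAverage ψ n (ω, reshuffle (fun i => φ (ω.2 0 i)) ω.1 i) := by
  have h0 : past 0 (timeStep φ ω, i) = ω.2 0 (reshuffle (fun i => φ (ω.2 0 i)) ω.1 i) := by
    simp [past, timeStep]
  have h1 : ∀ k, past (k + 1) (timeStep φ ω, i)
      = past k (ω, reshuffle (fun i => φ (ω.2 0 i)) ω.1 i) := fun k => by
    simp only [past, timeStep]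
    congr 1
  rw [pastAverage, Finset.sum_range_succ', h0, pastAverage]
  simp only [h1]
  rcases Nat.eq_zero_or_pos n with rfl | hn
  · simp
  · have : (n : ℝ) ≠ 0 := by positivity
    push_cast
    field_simp
    ring

/-- One step adds a single increment to the past and relabels the particles. The increment is
negligible after averaging, and the label does not matter since all velocities are equal. -/
lemma velocity_timeStep {φ : ℝ → ℝ} {ω : History} {i : ℕ} {a b : ℝ}
    (ha : Tendsto (fun n => pastAverage ψ n (timeStep φ ω, i)) atTop (𝓝 a))
    (hb : ∀ j, Tendsto (fun n => pastAverage ψ n (ω, j)) atTop (𝓝 b)) : a = b := by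
  have h1 : Tendsto (fun n : ℕ => ((n + 1 : ℕ) : ℝ)⁻¹) atTop (𝓝 0) :=
    tendsto_inv_atTop_zero.comp (tendsto_natCast_atTop_atTop.comp (tendsto_add_atTop_nat 1))
  have h2 := (h1.mul_const (ψ (ω.2 0 (reshuffle (fun i => φ (ω.2 0 i)) ω.1 i)))).add
    ((tendsto_natCast_div_add_atTop (1 : ℝ)).mul
      (hb (reshuffle (fun i => φ (ω.2 0 i)) ω.1 i)))
  simp only [zero_mul, zero_add, one_mul] at h2
  refine tendsto_nhds_unique ((tendsto_add_atTop_iff_nat 1).2 ha) (h2.congr fun n => ?_)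
  rw [pastAverage_timeStep_succ]

/-- Under ergodicity, a function of the configuration that is almost surely invariant is almost
surely constant. -/
lemma IsErgodic.exists_ae_eq_const {φ : ℝ → ℝ} (hE : IsErgodic r φ μ) (hφ : Measurable φ)
    (hF : forwardLaw r μ ≠ 0) {f : Config → ℝ} (hf : Measurable f) {M : ℝ} (hM : ∀ p, |f p| ≤ M)
    (hinv : ∀ᵐ w ∂(forwardLaw r μ), f (forwardStep φ w).1 = f w.1) :
    ∃ c, ∀ᵐ p ∂μ, f p = c := by
  refine hE f hf ⟨M, hM⟩ ?_
  have hg : Measurable fun w => ENNReal.ofReal |f (forwardStep φ w).1 - f w.1| :=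
    measurable_ofReal_abs_sub (hf.comp (measurable_fst.comp (measurable_forwardStep hφ)))
      (hf.comp measurable_fst)
  have h0 : ∫⁻ w, ENNReal.ofReal |f (forwardStep φ w).1 - f w.1| ∂(forwardLaw r μ) = 0 := by
    rw [lintegral_eq_zero_iff hg]
    filter_upwards [hinv] with w hw
    simp [hw]
  rw [lintegral_forwardLaw (g := fun w => ENNReal.ofReal |f (forwardStep φ w).1 - f w.1|) hF hg,
    lintegral_eq_zero_iff' (aemeasurable_lintegral_noise
      (g := fun w => ENNReal.ofReal |f (forwardStep φ w).1 - f w.1|) hF hg)] at h0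
  filter_upwards [h0] with p hp
  have hgp : Measurable fun κ => ENNReal.ofReal |f (forwardStep φ (p, κ)).1 - f p| :=
    hg.comp (measurable_const.prodMk measurable_id)
  have hp' := (lintegral_eq_zero_iff hgp).1 hp
  have hev : Measurable fun x : ℕ → ℝ => f (evolve (fun i => φ (x i)) p) := by
    have hx : Measurable fun x : ℕ → ℝ => (((fun i => φ (x i)), p) : (ℕ → ℝ) × Config) := by
      fun_prop
    exact hf.comp (measurable_evolve.comp hx)
  -- The new configuration depends on the increments at time `0` only, so the full noise integrates
  -- to the one-step kernel in the definition of ergodicity.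
  have h2 : ∫ κ, f (evolve (fun i => φ (κ i)) p) ∂gaussianField (entrywisePow p.2 r)
      = ∫ κ, f (forwardStep φ (p, κ)).1 ∂(noise r p) := by
    rw [← Measure.infinitePi_map_eval (fun _ : ℕ => gaussianField (entrywisePow p.2 r)) 0,
      integral_map (measurable_pi_apply 0).aemeasurable hev.aestronglyMeasurable]
    rfl
  rw [h2, integral_congr_ae (g := fun _ => f p)]
  · simp
  · filter_upwards [hp'] with κ hκ
    simpa [sub_eq_zero] using hκ

/-- Under ergodicity the common velocity is the mean of the weighted mean of the last
increments. -/
theorem IsRegular.velocity_eq_integral (h : IsRegular r ψ μ)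
    (hq : IsQuasiStationary r (fun x => lam * ψ x) μ)
    (hE : IsErgodic r (fun x => lam * ψ x) μ)
    (hP : IsStationaryExtension r (fun x => lam * ψ x) μ P) {v : History × ℕ → ℝ}
    (hvm : Measurable v) (hv2 : MemLp v 2 (tagged P))
    (hv : ∀ᵐ ω ∂P, ∀ i, Tendsto (fun n => pastAverage ψ n (ω, i)) atTop (𝓝 (v (ω, i))))
    (hcommon : ∀ᵐ ω ∂P, ∀ i j, v (ω, i) = v (ω, j)) {C : ℝ}
    (hC : ∀ n : ℕ, 1 ≤ n → ∫⁻ q, ENNReal.ofReal ((pastAverage ψ n q - v q) ^ 2) ∂(tagged P)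
      ≤ ENNReal.ofReal (C * (n : ℝ)⁻¹)) :
    ∀ᵐ ω ∂P, ∀ i, v (ω, i) = ∫ ω', weightedMean (fun q => ψ (past 0 q)) ω' ∂P := by
  set φ : ℝ → ℝ := fun x => lam * ψ x with hφ
  have hψ := h.measurable
  have hφm : Measurable φ := hψ.const_mul lam
  have hF := h.forwardLaw_ne_zero
  have := h.isProbabilityMeasure
  have := hP.isProbabilityMeasure
  have := h.isProbabilityMeasure_tagged hq hP
  have horbit := h.ae_orbit_history hq hP
  have hpos : ∀ᵐ ω ∂P, ∀ i, 0 < ω.1.1 i := by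
    filter_upwards [horbit] with ω hω
    exact (hω 0).pos
  have hpast : ∀ k, Integrable (fun q => ψ (past k q)) (tagged P) := fun k =>
    (h.memLp_past hq hP k).integrable one_le_two
  have hAi : ∀ n, Integrable (pastAverage ψ n) (tagged P) := fun n =>
    (integrable_finsetSum _ fun k _ => hpast k).const_mul _
  have hAm := measurable_pastAverage hψ
  have hvi : Integrable v (tagged P) := hv2.integrable one_le_two
  set V : History → ℝ := fun ω => v (ω, 0) with hV
  have hVm : Measurable V := hvm.comp (measurable_id.prodMk measurable_const)
  have hwv : weightedMean v =ᵐ[P] V := by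
    filter_upwards [horbit, hcommon] with ω h1 h2
    have h3 : HasSum ω.1.1 1 := (h1 0).hasSum
    rw [weightedMean, tsum_congr fun i => by rw [h2 i 0], tsum_mul_right, h3.tsum_eq, one_mul]
  have he0 : Tendsto (fun n => ∫⁻ ω, ENNReal.ofReal |weightedMean (pastAverage ψ n) ω - V ω| ∂P)
      atTop (𝓝 0) := by
    refine tendsto_of_tendsto_of_tendsto_of_le_of_le tendsto_const_nhds
      (tendsto_lintegral_abs_of_sq_le (x := fun n q => pastAverage ψ n q - v q)
        (fun n => (hAm n).sub hvm) hC) (fun _ => zero_le) fun n => ?_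
    refine le_trans (le_of_eq (lintegral_congr_ae ?_))
      (lintegral_abs_weightedMean_sub_le hpos (hAm n) hvm (hAi n) hvi)
    filter_upwards [hwv] with ω hω
    rw [hω]
  have hinv : ∀ᵐ ω ∂P, V (timeStep φ ω) = V ω := by
    filter_upwards [hv, hP.invariant.quasiMeasurePreserving.ae hv, hcommon] with ω h1 h2 h3
    exact velocity_timeStep (h2 0) fun j => by
      have := h1 j
      rwa [h3 j 0] at this
  have hinvn : ∀ n : ℕ, ∀ᵐ ω ∂P, V ((timeStep φ)^[n] ω) = V ω := by
    intro n
    induction n with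
    | zero => exact .of_forall fun ω => rfl
    | succ n ih =>
      filter_upwards [ih, (hP.invariant.iterate n).quasiMeasurePreserving.ae hinv] with ω h1 h2
      rw [Function.iterate_succ_apply', h2, h1]
  -- `V` may be unbounded, whereas the Hewitt–Savage argument and ergodicity use bounded functions.
  -- `Real.arctan` is bounded, injective and `1`-Lipschitz, so it preserves convergence in mean.
  -- Invariance of `P` and of `V` replaces the past averages by `forwardMean`.
  have hlim : Tendsto (fun n => ∫⁻ ω, ENNReal.ofReal
      |Real.arctan (forwardMean φ ψ n (forward ω)) - Real.arctan (V ω)| ∂P) atTop (𝓝 0) := by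
    refine tendsto_of_tendsto_of_tendsto_of_le_of_le tendsto_const_nhds he0 (fun _ => zero_le)
      fun n => ?_
    have hDm : AEMeasurable (fun ω => ENNReal.ofReal |weightedMean (pastAverage ψ n) ω - V ω|) P := by
      have h1 := (integrable_weightedMean hpos (hAi n)).2.1.aestronglyMeasurable.aemeasurable
      fun_prop
    have hmp := hP.invariant.iterate n
    simp only
    rw [← hmp.map_eq] at hDm
    conv_rhs => rw [← hmp.map_eq]
    rw [lintegral_map' hDm hmp.measurable.aemeasurable]
    refine lintegral_mono_ae ?_
    filter_upwards [horbit, hinvn n] with ω h1 h2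
    rw [weightedMean_pastAverage_iterate h1, h2]
    exact ENNReal.ofReal_le_ofReal (abs_arctan_sub_le _ _)
  obtain ⟨f, hfm, hfM, hf⟩ := exists_measurable_eq_of_symmetric_limit hF
    hP.measurePreserving_forward
    (u := fun n w => Real.arctan (forwardMean φ ψ n w)) (M := Real.pi / 2)
    (fun n => Real.measurable_arctan.comp (measurable_forwardMean hφm hψ n))
    (fun n w => abs_arctan_le _)
    (fun n p κ κ' hκ => by rw [forwardMean_congr φ ψ n p hκ])
    (fun n σ hσ w => by rw [forwardMean_permute φ ψ n hσ]) (Y := fun ω => Real.arctan (V ω))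
    (Real.measurable_arctan.comp hVm) (fun ω => abs_arctan_le _) hlim
  have hfinv : ∀ᵐ w ∂(forwardLaw r μ), f (forwardStep φ w).1 = f w.1 := by
    rw [← hP.measurePreserving_forward.map_eq, ae_map_iff measurable_forward.aemeasurable
      (p := fun w => f (forwardStep φ w).1 = f w.1) (measurableSet_eq_fun
        (hfm.comp (measurable_fst.comp (measurable_forwardStep hφm))) (hfm.comp measurable_fst))]
    -- The identity `f (ξ, Q) = arctan V` holds at `ω` and at `Λ ω`, so `f` inherits the invariance
    -- of `V`.
    filter_upwards [hf, hP.invariant.quasiMeasurePreserving.ae hf, hinv] with ω h1 h2 h3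
    rw [h1, ← h3, ← h2]
    rfl
  obtain ⟨c, hc⟩ := hE.exists_ae_eq_const hφm hF hfm hfM hfinv
  have hc' : ∀ᵐ ω ∂P, V ω = Real.tan c := by
    have h1 := ((measurePreserving_fst_forwardLaw hF).comp
      hP.measurePreserving_forward).quasiMeasurePreserving.ae hc
    filter_upwards [h1, hf] with ω h1 h2
    have h3 : Real.arctan (V ω) = c := by rw [← h2]; exact h1
    rw [← h3, Real.tan_arctan]
  -- Every average has the mean of a single increment, and convergence in mean carries this over to
  -- the limit.
  have hmean : ∫ q, v q ∂(tagged P) = ∫ q, ψ (past 0 q) ∂(tagged P) := by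
    have h1 : ∀ n : ℕ, 1 ≤ n →
        ∫ q, pastAverage ψ n q ∂(tagged P) = ∫ q, ψ (past 0 q) ∂(tagged P) := by
      intro n hn
      have h2 : ∀ k, ∫ q, ψ (past k q) ∂(tagged P) = ∫ q, ψ (past 0 q) ∂(tagged P) := fun k => by
        rw [← integral_map (measurable_past k).aemeasurable (f := ψ) hψ.aestronglyMeasurable,
          h.map_past hq hP k,
          integral_map (measurable_past 0).aemeasurable hψ.aestronglyMeasurable]
      simp only [pastAverage]
      rw [integral_const_mul, integral_finsetSum _ fun k _ => hpast k,
        Finset.sum_congr rfl fun k _ => h2 k]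
      have : (n : ℝ) ≠ 0 := by positivity
      simp [this]
    have h2 : Tendsto (fun n => ∫ q, pastAverage ψ n q ∂(tagged P)) atTop
        (𝓝 (∫ q, v q ∂(tagged P))) := by
      refine tendsto_integral_of_L1 _ hvi.1 (.of_forall hAi) ?_
      refine (tendsto_lintegral_abs_of_sq_le (x := fun n q => pastAverage ψ n q - v q)
        (fun n => (hAm n).sub hvm) hC).congr fun n => lintegral_congr fun q => ?_
      rw [← ofReal_norm, Real.norm_eq_abs]
    exact tendsto_nhds_unique h2 (tendsto_const_nhds.congr' (by
      filter_upwards [eventually_ge_atTop 1] with n hn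
      exact (h1 n hn).symm))
  have hval : Real.tan c = ∫ ω', weightedMean (fun q => ψ (past 0 q)) ω' ∂P := by
    rw [(integrable_weightedMean hpos (hpast 0)).2.2, ← hmean,
      ← (integrable_weightedMean hpos hvi).2.2, integral_congr_ae (hwv.trans hc')]
    simp
  filter_upwards [hc', hcommon] with ω h1 h2 i
  rw [← hval, ← h1, h2 i 0]

end Velocity

/-! ### From the hypotheses of the statement to the working conditions -/

lemma IsStationaryExtension.isRegular {r : ℕ} {ψ φ : ℝ → ℝ} {μ : Measure Config}
    {P : Measure History} (hψ : IsAdmissible ψ) (hμ : IsROSt μ) (hpos : ∀ᵐ p ∂μ, ∀ i, 0 < p.1 i)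
    (hP : IsStationaryExtension r φ μ P) : IsRegular r ψ μ where
  isProbabilityMeasure := hμ.isProbabilityMeasure
  ae_mem := hμ.ae_mem
  ae_pos := hpos
  forwardLaw_ne_zero := hP.forwardLaw_ne_zero
  measurable := hψ.contDiff.continuous.measurable
  exp_moment := by
    obtain ⟨M, hM⟩ := hψ.bounded_deriv
    exact lintegral_exp_abs_gaussianReal_ne_top (hψ.contDiff.differentiable (by norm_num)) hM

/-- Only the time index is shifted: `past n` is the increment at time `-(n + 1)`, so `range n`
corresponds to the times `-1, …, -n`. -/
lemma hasPastVelocity_iff {ψ : ℝ → ℝ} {ω : History} {i : ℕ} {v : ℝ} :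
    HasPastVelocity ψ ω i v ↔ Tendsto (fun n => pastAverage ψ n (ω, i)) atTop (𝓝 v) := by
  rw [HasPastVelocity]
  refine tendsto_congr fun n => ?_
  have h := Finset.sum_Ico_add' (fun t : ℕ => ψ (ω.2 (-(t : ℤ)) i)) 0 n 1
  rw [pastAverage, Finset.range_eq_Ico, show Finset.Icc 1 n = Finset.Ico (0 + 1) (n + 1) from rfl,
    ← h]
  simp [past]

lemma meanLastIncrement_eq (ψ : ℝ → ℝ) :
    meanLastIncrement ψ = weightedMean fun q => ψ (past 0 q) := by
  funext ω
  simp [meanLastIncrement, weightedMean, past]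

end CompetingParticles

end

theorem proposition2p3 (r : ℕ) (hr : 1 ≤ r) (ψ : ℝ → ℝ)
    (hψ : CompetingParticles.IsAdmissible ψ)
    (μ : Measure CompetingParticles.Config) (hμ : CompetingParticles.IsROSt μ)
    -- infinitely many particles, with overlaps of modulus less than one off the diagonal
    (hpos : ∀ᵐ p ∂μ, ∀ i, 0 < p.1 i)
    (hlt : ∀ᵐ p ∂μ, ∀ i j, i ≠ j → |p.2 i j| < 1)
    (U : Set ℝ) (hU : IsOpen U)
    (hqs : ∀ lam ∈ U, CompetingParticles.IsQuasiStationary r (fun x => lam * ψ x) μ) :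
    ∀ lam ∈ U, ∀ P : Measure CompetingParticles.History,
      CompetingParticles.IsStationaryExtension r (fun x => lam * ψ x) μ P →
      (∀ᵐ ω ∂P, ∃ v, ∀ i, CompetingParticles.HasPastVelocity ψ ω i v) ∧
      (CompetingParticles.IsErgodic r (fun x => lam * ψ x) μ →
        (∀ᵐ ω ∂P, Summable fun i => ω.1.1 i * ψ (ω.2 (-1) i)) ∧
        Integrable (CompetingParticles.meanLastIncrement ψ) P ∧
        ∀ᵐ ω ∂P, ∀ i, CompetingParticles.HasPastVelocity ψ ω i
          (∫ ω', CompetingParticles.meanLastIncrement ψ ω' ∂P)) := by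
  open CompetingParticles in
  intro lam hlam P hP
  have h := hP.isRegular hψ hμ hpos
  have hq := hqs lam hlam
  have := hP.isProbabilityMeasure
  have hpos' : ∀ᵐ ω ∂P, ∀ i, 0 < ω.1.1 i := by
    filter_upwards [h.ae_orbit_history hq hP] with ω hω
    exact (hω 0).pos
  have := h.isProbabilityMeasure_tagged hq hP
  obtain ⟨v, hvm, hv2, hv, C, hC⟩ := h.exists_ae_tendsto_past hq hP
  have hv' := ae_forall_of_ae_tagged hpos' hv
  have hle := h.ae_velocity_le hU hqs hlam hP hv'
  refine ⟨?_, fun hE => ?_⟩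
  · filter_upwards [hv', hle] with ω h1 h2
    refine ⟨v (ω, 0), fun i => hasPastVelocity_iff.2 ?_⟩
    rw [(h2 0 i).antisymm (h2 i 0)]
    exact h1 i
  · obtain ⟨h1, h2, -⟩ := integrable_weightedMean hpos'
      ((h.memLp_past hq hP 0).integrable one_le_two)
    rw [meanLastIncrement_eq]
    refine ⟨by simpa [past] using h1, h2, ?_⟩
    filter_upwards [hv', h.velocity_eq_integral hq hE hP hvm hv2 hv'
      (hle.mono fun ω h i j => (h i j).antisymm (h j i)) hC] with ω h3 h4 i
    rw [← h4 i]
    exact hasPastVelocity_iff.2 (h3 i)
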